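/- **Setting.** Let $\mathcal X\subseteq\mathbb R^{n_x}$ be open and consider the system with observations $$\dot x=f(x)+Bu+B_w(t)w_x(t),\qquad y=h(x,\theta)+B_yw_y(t),$$ with $f\in C^1(\mathcal X)$, $\|B_w(t)\|\le 1$, $\|w_x(t)\|\le\bar w_x$, $\|w_y(t)\|\le\bar w_y$, a safe set $\mathcal X_{\rm safe}$, a goal $\mathcal G$, a set $\mathcal U$ of nominal controls, an initial planned state $x_I$ and a parameter $\theta\in D_\theta$. Let $C_r$ be a matrix that selects $n_r$ distinct coordinates of $x$, let $\hat h^{-1}$ be the learned perception map $(y,\theta)\mapsto\hat h^{-1}(y,\theta)\in\mathbb R^{n_r}$, and put $\epsilon(x,\theta)=\|\hat h^{-1}(h(x,\theta),\theta)-C_rx\|$. Let $(x_i,\theta_i)\in D_p\times D_\theta$, $1\le i\le N$, $N\ge 1$, be the data, $\epsilon_i=\epsilon(x_i,\theta_i)$. The domains $D_p,D_c,D_e\subseteq\mathcal X$ are open; $D_r=\{x\in\mathcal X: C_rx\in C_rD_p\}$ and $D_x=D_r\cap D_c\cap D_e$. Let $M_c$ be a smooth complete Riemannian metric on $\mathcal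 X$, $W_c=M_c^{-1}$, that satisfies on $D_c$ the strong control contraction conditions with rate $\lambda_c>0$: with $A=\partial f/\partial x$ and the columns of $B_\perp$ a basis of $\ker B^\top$, $B_\perp^\top(-\partial_fW_c+AW_c+W_cA^\top+2\lambda_cW_c)B_\perp\preceq 0$ and $B_\perp^\top(\partial_{B^j}W_c)B_\perp=0$ for all $j$. Let $M_e$ be a constant positive definite matrix, $W_e=M_e^{-1}$, $\rho\ge 0$ constant, $\lambda_e>0$, with $W_eA+A^\top W_e-\rho C_r^\top C_r\preceq-2\lambda_eW_e$ on $D_e$. Let $d_c,d_e$ be the Riemannian distances of $M_c$ (on $\mathcal X$) and of the constant metric $W_e$. Let $\underline m_c>0$, $\overline m_c$ be lower and upper eigenvalue bounds of $M_c$ over $D_c$, and $\bar\lambda(W_e),\bar\lambda(M_e)$ upper eigenvalue bounds of $W_e,M_e$. Any two points of $\mathcal X$ are joined by a minimizing $M_c$-geodesic; let $\gamma$ be the one from $x^*$ to $x$ that the controller uses, parametrized over $[0,1]$ proportionally to arc length, and let $$\mathcal U_{\rm feas}(x,x^*,u^*)=\{k:\ \gamma_s(1)^\top M_c(x)(f(x)+B(u^*+k))-\gamma_s(0)^\top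 M_c(x^*)(f(x^*)+Bu^*)\le-\lambda_cd_c(x^*,x)^2\}.$$ The controller is $u(\hat x,x^*,u^*)=u^*+k(\hat x,x^*,u^*)$, where $k(\hat x,x^*,u^*)$ is the minimum norm element of $\mathcal U_{\rm feas}(\hat x,x^*,u^*)$. For $M_c=R_c^\top R_c$ let $\Delta k(\hat x,x,x^*,u^*)=\max_{s\in[0,1]}\|R_c(\gamma(s))B(k(\hat x,x^*,u^*)-k_{\rm closest})\|$ along the geodesic $\gamma$ from $x^*$ to $x$, $k_{\rm closest}$ being the element of $\mathcal U_{\rm feas}(x,x^*,u^*)$ closest to $k(\hat x,x^*,u^*)$. **Validity of the estimated constants.** Assume: * $L_{\Delta k}\ge0$ and $|\Delta k(\hat x_1,x,x^*,u^*)-\Delta k(\hat x_2,x,x^*,u^*)|\le L_{\Delta k}\,d_e(\hat x_1,\hat x_2)$ for all $x^*\in D_x$, $u^*\in\mathcal U$, $x$ with $d_c(x^*,x)\le\bar c$ and $\hat x_1,\hat x_2$ with $d_e(x,\hat x_i)\le\bar e$ for which both sides are defined; * $L_{\hat h^{-1}}\ge0$ and $\|\hat h^{-1}(\tilde y,\tilde\theta)-\hat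 h^{-1}(\check y,\tilde\theta)\|\le L_{\hat h^{-1}}\|\tilde y-\check y\|$ for all $\tilde\theta\in D_\theta$ and $\tilde y,\check y\in h(D_r,D_\theta)\oplus\{B_yw:\|w\|\le\bar w_y\}$; * for the error bound in use, one of 1. $\epsilon\le\bar\epsilon_1$ on $D_r\times D_\theta$; 2. $L_p\ge 0$ is a Lipschitz constant of $\epsilon$ on $D_r\times D_\theta$; 3. $L_p$ is as in 2, and $\mathcal R\ge 0$ bounds the dispersion of the data in the tube sections. Here, for $\Omega=\{x:d_c(p,x)\le r\}$ with $p\in D_x$, $0\le r\le\bar c$ and $\Omega\subseteq D_c\cap D_r$ that contains some $x_i$, let $\eta^*$ be the least $\|\theta_i-\theta\|$ over the data with $x_i\in\Omega$, and let $\Omega^B$ be the set of $(\tilde x,\tilde\theta)\in D_r\times D_\theta$ with $\tilde x\in\Omega$ and $\|\tilde\theta-\theta\|\le\eta^*$; every point of $\Omega^B$ has distance at most $\mathcal R$ to some datapoint in $\Omega^B$. **Planner (CORRT).** The tree starts from the root $(x_I,\bar d_c(0),\bar d_e(0),0)$. A candidate extension of a node (state $x_n$, radii $\bar d_c^n,\bar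 d_e^n$, time $t_n$) is given by a control $u\in\mathcal U$ held for a dwell time $t_p>0$; it consists of the solution $x^*$ of $\dot x^*=f(x^*)+Bu$ in $\mathcal X$ on $[t_n,t_n+t_p]$ with $x^*(t_n)=x_n$, and of tubes $(\bar d_c,\bar d_e)$ that start at $(\bar d_c^n,\bar d_e^n)$ and solve (in integral form) $$\dot{\bar d}_c=-\lambda_c\bar d_c+L_{\Delta k}\bar d_e+\sqrt{\overline m_c}\,\bar w_x,$$ $$\dot{\bar d}_e=\beta\,\bar d_c-\lambda_e\bar d_e+\sqrt{\bar\lambda(W_e)}\,\bar w_x+\tfrac\rho2\sqrt{\bar\lambda(M_e)}\,\big(L_{\hat h^{-1}}\|B_y\|\bar w_y+e(t)\big),$$ where $e$ is an integrable function with, at each time, respectively $e\ge\bar\epsilon_1$; $e\ge\min_i\{L_p\|(x^*,\theta)-(x_i,\theta_i)\|+\epsilon_i\}$; $e\ge L_p\mathcal R+\max\{\epsilon_i:(x_i,\theta_i)\in\Omega_c^B\}$ (some $x_i$ being in $\Omega_c$), and $\beta=\frac12L_p\rho\sqrt{\bar\lambda(M_e)/\underline m_c}$ in case 2, $\beta=0$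 otherwise. With $\Omega_c(t)=\{x:d_c(x^*(t),x)\le\bar d_c(t)\}$ and $\Omega_e(t)=\{\hat x:d_e(x,\hat x)\le\bar d_e(t)\}$ (centred at $x$; the set $\Omega_e(t)\ominus\{x\}$ does not depend on $x$), the extension is accepted if for all $t\in[t_n,t_n+t_p)$: $\bar d_c(t)<\bar c$ and $\bar d_e(t)<\bar e$; $\Omega_c(t)\subseteq D_c\cap D_r\cap\mathcal X_{\rm safe}$; and $\Omega_c(t)\oplus(\Omega_e(t)\ominus\{x\})\subseteq D_e\cap D_c$. Accepted extensions add their end node to the tree. If $\Omega_c(T)\subseteq\mathcal G$ at some time $T\in[t_n,t_n+t_p)$ of an accepted extension, the planner returns the branch up to $T$ as its plan $(x^*,u^*)$ on $[0,T]$. **Theorem 2 (CORRT correctness).** Under these assumptions, with any of the three error bounds, let $(x^*,u^*)$ on $[0,T]$ be any plan that the planner can return. Let $x,\hat x:[0,T]\to\mathcal X$ be any (Carathéodory) solution of $$\dot x=f(x)+Bu(\hat x,x^*,u^*)+B_ww_x,$$ $$\dot{\hat x}=f(\hat x)+Bu(\hat x,x^*,u^*)+\tfrac12\rho M_eC_r^\top\big(\hat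 h^{-1}(h(x,\theta)+B_yw_y,\theta)-C_r\hat x\big),$$ with disturbances $\|w_x\|\le\bar w_x$, $\|w_y\|\le\bar w_y$ and with $d_c(x^*(0),x(0))\le\bar d_c(0)$, $d_e(x(0),\hat x(0))\le\bar d_e(0)$. Then $x(t)\in\mathcal X_{\rm safe}$ for all $t\in[0,T]$, and $x(T)\in\mathcal G$. -/

import Mathlib

open Set MeasureTheory
open scoped ContDiff ENNReal Pointwise

noncomputable section

namespace CORRT

/-- Euclidean space `ℝⁿ` with the 2-norm. -/
abbrev Vec (n : ℕ) : Type := EuclideanSpace ℝ (Fin n)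

/-- Real `n × n` matrices, as operators on `ℝⁿ`. The norm is the induced 2-norm. -/
abbrev Op (n : ℕ) : Type := Vec n →L[ℝ] Vec n

/-! ### Riemannian distance -/

/-- The metric form `vᵀ Q v`. -/
def quad {n : ℕ} (Q : Op n) (v : Vec n) : ℝ := inner ℝ v (Q v)

/-- `Q` is symmetric positive definite. -/
def IsPosDefOp {n : ℕ} (Q : Op n) : Prop :=
  IsSelfAdjoint Q ∧ ∀ v : Vec n, v ≠ 0 → 0 < quad Q v

/-- The smooth curves `[0,1] → X` from `p` to `q` (a curve that is smooth on the closed interval is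
the restriction of a smooth curve on the line, and only its values on `[0,1]` are constrained). -/
def curves {n : ℕ} (X : Set (Vec n)) (p q : Vec n) : Set (ℝ → Vec n) :=
  {c | ContDiff ℝ ∞ c ∧ c 0 = p ∧ c 1 = q ∧ ∀ s ∈ Icc (0 : ℝ) 1, c s ∈ X}

/-- Length of a curve with respect to the Riemannian metric `M`. -/
def curveLength {n : ℕ} (M : Vec n → Op n) (c : ℝ → Vec n) : ℝ :=
  ∫ s in (0 : ℝ)..1, √(quad (M (c s)) (deriv c s))

/-- Riemannian distance on `X` of the metric `M`. -/
def riemDist {n : ℕ} (X : Set (Vec n)) (M : Vec n → Op n) (p q : Vec n) : ℝ :=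
  sInf (curveLength M '' curves X p q)

/-- A (minimizing) geodesic from `p` to `q`: a curve that attains the Riemannian distance,
parametrized over `[0,1]` proportionally to arc length. -/
def IsGeodesic {n : ℕ} (X : Set (Vec n)) (M : Vec n → Op n) (p q : Vec n) (c : ℝ → Vec n) : Prop :=
  c ∈ curves X p q ∧ curveLength M c = riemDist X M p q ∧
    ∀ s ∈ Icc (0 : ℝ) 1, √(quad (M (c s)) (deriv c s)) = riemDist X M p q

/-- Dispersion of the points `A` in the set `B`: the radius of the largest open ball that is centred
in `B` and contains no point of `A`, that is, the largest distance of a point of `B` to `A`. -/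
def dispersion {α : Type*} [PseudoEMetricSpace α] (A B : Set α) : ℝ≥0∞ :=
  ⨆ z ∈ B, ⨅ a ∈ A, edist z a

/-- `u` has minimal norm in `S`. -/
def IsMinNorm {n : ℕ} (S : Set (Vec n)) (u : Vec n) : Prop :=
  u ∈ S ∧ ∀ v ∈ S, ‖u‖ ≤ ‖v‖

/-- `l` is a point of `S` closest to `u`. -/
def IsClosest {n : ℕ} (S : Set (Vec n)) (u l : Vec n) : Prop :=
  l ∈ S ∧ ∀ v ∈ S, ‖l - u‖ ≤ ‖v - u‖

/-! ### The data of the problem -/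

/-- The three available bounds on the perception error: a uniform bound, a bound from the Lipschitz
constant and the nearest data, and a bound from the Lipschitz constant, the dispersion and the
training errors inside the tube. -/
inductive BoundKind
  | uniform
  | lipschitz
  | dispersed

/-- All data of an output feedback planning problem (data only: what is required of them is stated
in the predicates below). -/
structure Problem (nx nu nwx ny nwy np nr N : ℕ) where
  /-- State space. -/
  X : Set (Vec nx)
  /-- Drift. -/
  f : Vec nx → Vec nx
  /-- Input matrix. -/
  B : Vec nu →L[ℝ] Vec nx
  /-- Disturbance matrix. -/
  Bw : ℝ → (Vec nwx →L[ℝ] Vec nx)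
  /-- Sensor noise matrix. -/
  By : Vec nwy →L[ℝ] Vec ny
  /-- Bound on the state disturbance. -/
  wxBar : ℝ
  /-- Bound on the sensor noise. -/
  wyBar : ℝ
  /-- Observation map. -/
  h : Vec nx → Vec np → Vec ny
  /-- Nominal controls. -/
  U : Set (Vec nu)
  Xsafe : Set (Vec nx)
  goal : Set (Vec nx)
  /-- Initial state of the plan. -/
  xI : Vec nx
  /-- External parameter. -/
  θ : Vec np
  /-- The coordinates of the state that are selected by the reduced observation. -/
  sel : Fin nr ↪ Fin nx
  /-- Domain from which the states of the dataset are drawn. -/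
  Dp : Set (Vec nx)
  /-- Domain from which the parameters of the dataset are drawn. -/
  Dθ : Set (Vec np)
  /-- Domain of the control contraction metric. -/
  Dc : Set (Vec nx)
  /-- Domain of the observer contraction metric. -/
  De : Set (Vec nx)
  /-- The state-parameter pairs of the dataset. -/
  data : Fin N → WithLp 2 (Vec nx × Vec np)
  /-- Learned perception module (approximate inverse of the observation map). -/
  hinv : Vec ny → Vec np → Vec nr
  /-- Control contraction metric. -/
  Mc : Vec nx → Op nx
  /-- The geodesics (with respect to `Mc`) that the controller uses. -/
  geo : Vec nx → Vec nx → ℝ → Vec nx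
  lamc : ℝ
  /-- Observer contraction metric (constant). -/
  Me : Op nx
  /-- Observer multiplier (constant). -/
  rho : ℝ
  lame : ℝ
  /-- Lower eigenvalue bound of `Mc` over `Dc`. -/
  mcLo : ℝ
  /-- Upper eigenvalue bound of `Mc` over `Dc`. -/
  mcHi : ℝ
  /-- Upper eigenvalue bound of `Me⁻¹`. -/
  weHi : ℝ
  /-- Upper eigenvalue bound of `Me`. -/
  meHi : ℝ
  /-- Estimated Lipschitz constant of the controller error. -/
  Lk : ℝ
  /-- Estimated Lipschitz constant of the perception module. -/
  Lh : ℝ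
  /-- Estimated uniform bound on the perception error. -/
  eps1 : ℝ
  /-- Estimated Lipschitz constant of the perception error. -/
  Lp : ℝ
  /-- Estimated dispersion. -/
  R : ℝ
  /-- Bound on the initial tracking distance. -/
  dc0 : ℝ
  /-- Bound on the initial estimation distance. -/
  de0 : ℝ
  /-- Largest tracking distance for which `Lk` is estimated. -/
  cBar : ℝ
  /-- Largest estimation distance for which `Lk` is estimated. -/
  eBar : ℝ

namespace Problem

variable {nx nu nwx ny nwy np nr N : ℕ} (P : Problem nx nu nwx ny nwy np nr N)

/-- The dual metric `W_c(x) = M_c(x)⁻¹`. -/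
def Wc (x : Vec nx) : Op nx := (P.Mc x).inverse

/-- The dual metric `W_e = M_e⁻¹`. -/
def We : Op nx := P.Me.inverse

/-- The selection matrix `C_r`. -/
def Cr : Vec nx →L[ℝ] Vec nr :=
  LinearMap.toContinuousLinearMap
    { toFun := fun x => WithLp.toLp 2 (fun i => x (P.sel i))
      map_add' := fun _ _ => rfl
      map_smul' := fun _ _ => rfl }

/-- States whose selected coordinates occur in the data domain. -/
def Dr : Set (Vec nx) := {x | x ∈ P.X ∧ P.Cr x ∈ P.Cr '' P.Dp}

/-- The state part of the trusted domain. -/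
def Dx : Set (Vec nx) := P.Dr ∩ P.Dc ∩ P.De

/-- Riemannian distance of the control contraction metric on the state space. -/
def distC (p q : Vec nx) : ℝ := riemDist P.X P.Mc p q

/-- Riemannian distance of the constant metric `W_e`. -/
def distE (p q : Vec nx) : ℝ := riemDist univ (fun _ => P.We) p q

/-- The tracking tube section of radius `r` around the planned state `p`. -/
def tubeC (p : Vec nx) (r : ℝ) : Set (Vec nx) := {x | x ∈ P.X ∧ P.distC p x ≤ r}

/-- The estimation tube section of radius `r` around the state `x`. -/
def tubeE (x : Vec nx) (r : ℝ) : Set (Vec nx) := {z | P.distE x z ≤ r}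

/-! ### Contraction metrics -/

/-- The (strong) control contraction conditions on `Dc` with rate `lamc`; `ker Bᵀ` is the space that
the columns of `B_⊥` span. -/
def IsCCM : Prop :=
  ∀ x ∈ P.Dc,
    (∀ v : Vec nx, (ContinuousLinearMap.adjoint P.B) v = 0 →
      inner ℝ v ((-(fderiv ℝ P.Wc x (P.f x)) + (fderiv ℝ P.f x) ∘L (P.Wc x)
        + (P.Wc x) ∘L (ContinuousLinearMap.adjoint (fderiv ℝ P.f x))
        + (2 * P.lamc) • P.Wc x) v) ≤ 0) ∧
    (∀ j : Fin nu, ∀ v w : Vec nx, (ContinuousLinearMap.adjoint P.B) v = 0 →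
      (ContinuousLinearMap.adjoint P.B) w = 0 →
      inner ℝ v (fderiv ℝ P.Wc x (P.B (EuclideanSpace.single j 1)) w) = 0)

/-- The observer contraction condition on `De` with rate `lame`, for constant `Me`, `rho` and the
reduced observation. -/
def IsOCM : Prop :=
  ∀ x ∈ P.De, ∀ v : Vec nx,
    inner ℝ v ((P.We ∘L (fderiv ℝ P.f x)
      + (ContinuousLinearMap.adjoint (fderiv ℝ P.f x)) ∘L P.We
      - P.rho • ((ContinuousLinearMap.adjoint P.Cr) ∘L P.Cr)) v)
      ≤ inner ℝ v (((-(2 * P.lame)) • P.We) v)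

/-! ### Controller and perception error -/

/-- The feedback terms that contract `x` towards the plan `(xs, us)` at rate `lamc`. -/
def Ufeas (x xs : Vec nx) (us : Vec nu) : Set (Vec nu) :=
  {k | inner ℝ (deriv (P.geo xs x) 1) (P.Mc x (P.f x + P.B (us + k)))
      - inner ℝ (deriv (P.geo xs x) 0) (P.Mc xs (P.f xs + P.B us))
      ≤ -P.lamc * P.distC xs x ^ 2}

/-- `max_s ‖R_c(γ(s)) B v‖` along the geodesic `γ` from `xs` to `x`, where `R_cᵀ R_c = M_c`. -/
def gain (x xs : Vec nx) (v : Vec nu) : ℝ :=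
  sSup ((fun s => √(quad (P.Mc (P.geo xs x s)) (P.B v))) '' Icc (0 : ℝ) 1)

/-- The perception error `ε(x, θ')`. -/
def percErr (x : Vec nx) (θ' : Vec np) : ℝ := ‖P.hinv (P.h x θ') θ' - P.Cr x‖

/-- `Lk` is valid: on its domain it is a Lipschitz constant of the controller error
`Δk(x̂, x, xs, us) = max_s ‖R_c(γ(s)) B (u(x̂, xs, us) - u_closest)‖` in `x̂`, with distances
measured by `distE`. Here `kᵢ` is the minimum norm feedback at `x̂ᵢ`, and `lᵢ` is the feedback
closest to `kᵢ` that contracts at `x` (both are unique where they exist). -/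
def ValidLk : Prop :=
  ∀ xs ∈ P.Dx, ∀ us ∈ P.U, ∀ x ∈ P.X, P.distC xs x ≤ P.cBar →
    ∀ z₁ ∈ P.X, ∀ z₂ ∈ P.X, P.distE x z₁ ≤ P.eBar → P.distE x z₂ ≤ P.eBar →
    ∀ k₁ k₂ l₁ l₂ : Vec nu,
      IsMinNorm (P.Ufeas z₁ xs us) k₁ → IsMinNorm (P.Ufeas z₂ xs us) k₂ →
      IsClosest (P.Ufeas x xs us) k₁ l₁ → IsClosest (P.Ufeas x xs us) k₂ l₂ →
      |P.gain x xs (k₁ - l₁) - P.gain x xs (k₂ - l₂)| ≤ P.Lk * P.distE z₁ z₂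

/-- Possible noisy observations over the data domains. -/
def noisyObs : Set (Vec ny) :=
  {y | ∃ x ∈ P.Dr, ∃ θ' ∈ P.Dθ, y = P.h x θ'} + {y | ∃ w : Vec nwy, ‖w‖ ≤ P.wyBar ∧ y = P.By w}

/-- `Lh` is valid: it is a Lipschitz constant of the perception module in the observation. -/
def ValidLh : Prop :=
  ∀ y₁ ∈ P.noisyObs, ∀ y₂ ∈ P.noisyObs, ∀ θ' ∈ P.Dθ,
    ‖P.hinv y₁ θ' - P.hinv y₂ θ'‖ ≤ P.Lh * ‖y₁ - y₂‖

/-- `Lp` is a Lipschitz constant of the perception error over the data domains. -/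
def ValidLp : Prop :=
  ∀ x₁ ∈ P.Dr, ∀ x₂ ∈ P.Dr, ∀ θ₁ ∈ P.Dθ, ∀ θ₂ ∈ P.Dθ,
    |P.percErr x₁ θ₁ - P.percErr x₂ θ₂|
      ≤ P.Lp * dist (WithLp.toLp 2 (x₁, θ₁)) (WithLp.toLp 2 (x₂, θ₂))

/-- Smallest radius around `θ` such that some datapoint has its state in the set `Ω` and its
parameter within that radius. -/
def etaStar (Ω : Set (Vec nx)) : ℝ :=
  sInf {r | ∃ i, (P.data i).fst ∈ Ω ∧ r = dist (P.data i).snd P.θ}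

/-- The set `Ω × (ball of radius η* around θ)`, within the data domains. -/
def buffered (Ω : Set (Vec nx)) : Set (WithLp 2 (Vec nx × Vec np)) :=
  {z | z.fst ∈ Ω ∧ dist z.snd P.θ ≤ P.etaStar Ω ∧ z.fst ∈ P.Dr ∧ z.snd ∈ P.Dθ}

/-- `R` is valid: it bounds the dispersion of the data in the buffered tube sections, for all tube
sections in the domains of the controller and the perception that meet the data. -/
def ValidR : Prop :=
  ∀ p ∈ P.Dx, ∀ r : ℝ, 0 ≤ r → r ≤ P.cBar → P.tubeC p r ⊆ P.Dc ∩ P.Dr →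
    (∃ i, (P.data i).fst ∈ P.tubeC p r) →
    dispersion (range P.data ∩ P.buffered (P.tubeC p r)) (P.buffered (P.tubeC p r))
      ≤ ENNReal.ofReal P.R

/-- The constants of the chosen perception error bound are valid. -/
def ValidBound : BoundKind → Prop
  | .uniform => ∀ x ∈ P.Dr, ∀ θ' ∈ P.Dθ, P.percErr x θ' ≤ P.eps1
  | .lipschitz => 0 ≤ P.Lp ∧ P.ValidLp
  | .dispersed => 0 ≤ P.Lp ∧ 0 ≤ P.R ∧ P.ValidLp ∧ P.ValidR

/-- Training error of a datapoint. -/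
def trainErr (i : Fin N) : ℝ := P.percErr (P.data i).fst (P.data i).snd

/-- `e` is an upper bound of the term that the chosen perception error bound contributes to the
tube, for planned state `p` and tracking tube radius `r` (for the Lipschitz bound, its part
`Lp * r / √mcLo` is a separate term of the tube equation). -/
def IsErrLevel (κ : BoundKind) (p : Vec nx) (r e : ℝ) : Prop :=
  match κ with
  | .uniform => P.eps1 ≤ e
  | .lipschitz => (⨅ i, (P.Lp * dist (WithLp.toLp 2 (p, P.θ)) (P.data i) + P.trainErr i)) ≤ e
  | .dispersed => (∃ i, (P.data i).fst ∈ P.tubeC p r) ∧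
      P.Lp * P.R + sSup {a | ∃ i, P.data i ∈ P.buffered (P.tubeC p r) ∧ a = P.trainErr i} ≤ e

/-! ### Tubes -/

/-- Coupling coefficient of the estimation tube. -/
def coupling (κ : BoundKind) : ℝ :=
  match κ with
  | .lipschitz => (1 / 2) * P.Lp * P.rho * √(P.meHi / P.mcLo)
  | _ => 0

/-- Right hand side of the tube equation for the tracking distance. -/
def rhsC (dc de : ℝ) : ℝ := -P.lamc * dc + P.Lk * de + √P.mcHi * P.wxBar

/-- Right hand side of the tube equation for the estimation distance. -/
def rhsE (κ : BoundKind) (e dc de : ℝ) : ℝ :=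
  P.coupling κ * dc - P.lame * de + √P.weHi * P.wxBar
    + P.rho / 2 * √P.meHi * (P.Lh * ‖P.By‖ * P.wyBar + e)

/-- `(dc, de)` are tubes over `[t₀, t₁]` around the planned states `xp`, with initial values `c₀` and
`e₀`: they solve the tube equation, driven by an integrable upper bound `e` of the perception error
bound along the plan. -/
def IsTube (κ : BoundKind) (t₀ t₁ c₀ e₀ : ℝ) (xp : ℝ → Vec nx) (dc de : ℝ → ℝ) : Prop :=
  ContinuousOn dc (Icc t₀ t₁) ∧ ContinuousOn de (Icc t₀ t₁) ∧
    ∃ e : ℝ → ℝ, IntervalIntegrable e volume t₀ t₁ ∧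
      (∀ t ∈ Ico t₀ t₁, P.IsErrLevel κ (xp t) (dc t) (e t)) ∧
      ∀ t ∈ Icc t₀ t₁,
        dc t = c₀ + (∫ τ in t₀..t, P.rhsC (dc τ) (de τ)) ∧
        de t = e₀ + ∫ τ in t₀..t, P.rhsE κ (e τ) (dc τ) (de τ)

/-! ### The planner -/

end Problem

/-- A node of the search tree: state, tube radii and time, with the planned states and controls on
the branch that leads to it from the root (functions of time, meaningful on `[0, time)`). -/
structure Node (nx nu : ℕ) where
  state : Vec nx
  dc : ℝ
  de : ℝ
  time : ℝ
  xs : ℝ → Vec nx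
  us : ℝ → Vec nu

/-- The branch of `n` up to its time, continued by `xp` and the control `u`. -/
def Node.splice {nx nu : ℕ} (n : Node nx nu) (xp : ℝ → Vec nx) (u : Vec nu) :
    (ℝ → Vec nx) × (ℝ → Vec nu) :=
  (fun t => if t < n.time then n.xs t else xp t, fun t => if t < n.time then n.us t else u)

/-- The node reached from `n` by holding the control `u` for the time `tp`. -/
def Node.extend {nx nu : ℕ} (n : Node nx nu) (u : Vec nu) (tp : ℝ) (xp : ℝ → Vec nx)
    (dc de : ℝ → ℝ) : Node nx nu where
  state := xp (n.time + tp)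
  dc := dc (n.time + tp)
  de := de (n.time + tp)
  time := n.time + tp
  xs := (n.splice xp u).1
  us := (n.splice xp u).2

namespace Problem

variable {nx nu nwx ny nwy np nr N : ℕ} (P : Problem nx nu nwx ny nwy np nr N)

/-- The root of the search tree. -/
def root : Node nx nu := ⟨P.xI, P.dc0, P.de0, 0, fun _ => P.xI, fun _ => 0⟩

/-- A candidate extension of the node `n` that passes all checks: a control `u` is held for the
dwell time `tp`, the nominal dynamics are integrated to `xp`, and tubes `dc`, `de` are computed. -/
structure Accepted (κ : BoundKind) (n : Node nx nu) (u : Vec nu) (tp : ℝ) (xp : ℝ → Vec nx)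
    (dc de : ℝ → ℝ) : Prop where
  control : u ∈ P.U
  dwell : 0 < tp
  start : xp n.time = n.state
  mem : ∀ t ∈ Icc n.time (n.time + tp), xp t ∈ P.X
  dynamics : ∀ t ∈ Icc n.time (n.time + tp),
    HasDerivWithinAt xp (P.f (xp t) + P.B u) (Icc n.time (n.time + tp)) t
  tube : P.IsTube κ n.time (n.time + tp) n.dc n.de xp dc de
  /-- The tubes stay where the controller error constant is valid. -/
  bounds : ∀ t ∈ Ico n.time (n.time + tp), dc t < P.cBar ∧ de t < P.eBar
  /-- Check of the tracking tube. -/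
  tracking : ∀ t ∈ Ico n.time (n.time + tp), P.tubeC (xp t) (dc t) ⊆ P.Dc ∩ P.Dr ∩ P.Xsafe
  /-- Check of the estimator tube (a Minkowski sum; it does not depend on the true state `x`). -/
  estimation : ∀ t ∈ Ico n.time (n.time + tp), ∀ x ∈ P.tubeC (xp t) (dc t),
    P.tubeC (xp t) (dc t) + (P.tubeE x (de t) - {x}) ⊆ P.De ∩ P.Dc

/-- The search trees that the planner can build, for arbitrary samples of nodes, controls and dwell
times (rejected candidates leave the tree unchanged). -/
inductive IsTree (κ : BoundKind) : Set (Node nx nu) → Prop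
  | root : IsTree κ {P.root}
  | grow {𝒯 : Set (Node nx nu)} {n : Node nx nu} {u : Vec nu} {tp : ℝ} {xp : ℝ → Vec nx}
      {dc de : ℝ → ℝ} : IsTree κ 𝒯 → n ∈ 𝒯 → P.Accepted κ n u tp xp dc de →
      IsTree κ (insert (n.extend u tp xp dc de) 𝒯)

/-- The planner returns the plan `(xs, us)` on `[0, T]`: an accepted extension of a node of the tree
has a tracking tube that lies in the goal at the time `T`. -/
def Returns (κ : BoundKind) (T : ℝ) (xs : ℝ → Vec nx) (us : ℝ → Vec nu) : Prop :=
  ∃ (𝒯 : Set (Node nx nu)) (n : Node nx nu) (u : Vec nu) (tp : ℝ) (xp : ℝ → Vec nx)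
    (dc de : ℝ → ℝ),
    P.IsTree κ 𝒯 ∧ n ∈ 𝒯 ∧ P.Accepted κ n u tp xp dc de ∧
      T ∈ Ico n.time (n.time + tp) ∧ P.tubeC (xp T) (dc T) ⊆ P.goal ∧
      (∀ t ∈ Icc 0 T, xs t = (n.splice xp u).1 t ∧ us t = (n.splice xp u).2 t)

/-! ### Execution -/

/-- An execution on `[0, T]` of the true system, with the minimum norm contracting feedback at the
state estimate and the learned perception observer: the true state `x`, the estimate `z`, the
feedback `k` (the applied control is `us + k`), the disturbance `wx` and the sensor noise `wy`. The
differential equations are meant in the sense of Carathéodory (integral form). -/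
structure IsExecution (T : ℝ) (xs : ℝ → Vec nx) (us : ℝ → Vec nu) (x z : ℝ → Vec nx)
    (k : ℝ → Vec nu) (wx : ℝ → Vec nwx) (wy : ℝ → Vec nwy) : Prop where
  mem_x : ∀ t ∈ Icc 0 T, x t ∈ P.X
  mem_z : ∀ t ∈ Icc 0 T, z t ∈ P.X
  cont_x : ContinuousOn x (Icc 0 T)
  cont_z : ContinuousOn z (Icc 0 T)
  bound_wx : ∀ t ∈ Icc 0 T, ‖wx t‖ ≤ P.wxBar
  bound_wy : ∀ t ∈ Icc 0 T, ‖wy t‖ ≤ P.wyBar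
  start_c : P.distC (xs 0) (x 0) ≤ P.dc0
  start_e : P.distE (x 0) (z 0) ≤ P.de0
  feedback : ∀ t ∈ Icc 0 T, IsMinNorm (P.Ufeas (z t) (xs t) (us t)) (k t)
  integrable_x : IntervalIntegrable
    (fun τ => P.f (x τ) + P.B (us τ + k τ) + P.Bw τ (wx τ)) volume 0 T
  system : ∀ t ∈ Icc 0 T,
    x t = x 0 + ∫ τ in (0 : ℝ)..t, (P.f (x τ) + P.B (us τ + k τ) + P.Bw τ (wx τ))
  integrable_z : IntervalIntegrable
    (fun τ => P.f (z τ) + P.B (us τ + k τ)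
      + (P.rho / 2) • P.Me ((ContinuousLinearMap.adjoint P.Cr)
          (P.hinv (P.h (x τ) P.θ + P.By (wy τ)) P.θ - P.Cr (z τ)))) volume 0 T
  observer : ∀ t ∈ Icc 0 T,
    z t = z 0 + ∫ τ in (0 : ℝ)..t, (P.f (z τ) + P.B (us τ + k τ)
      + (P.rho / 2) • P.Me ((ContinuousLinearMap.adjoint P.Cr)
          (P.hinv (P.h (x τ) P.θ + P.By (wy τ)) P.θ - P.Cr (z τ))))

/-! ### Standing assumptions -/

/-- The setting. Nothing is assumed here about the constants that are estimated from data, except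
that Lipschitz constants are nonnegative. -/
structure Setting : Prop where
  open_X : IsOpen P.X
  open_Dp : IsOpen P.Dp
  open_Dc : IsOpen P.Dc
  open_De : IsOpen P.De
  Dp_sub : P.Dp ⊆ P.X
  Dc_sub : P.Dc ⊆ P.X
  De_sub : P.De ⊆ P.X
  smooth_f : ContDiffOn ℝ 1 P.f P.X
  norm_Bw : ∀ t, 0 ≤ t → ‖P.Bw t‖ ≤ 1
  θ_mem : P.θ ∈ P.Dθ
  data_pos : 0 < N
  data_mem : ∀ i, (P.data i).fst ∈ P.Dp ∧ (P.data i).snd ∈ P.Dθ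
  /-- `Mc` is a smooth Riemannian metric on the state space. -/
  smooth_Mc : ContDiffOn ℝ ∞ P.Mc P.X
  posDef_Mc : ∀ x ∈ P.X, IsPosDefOp (P.Mc x)
  /-- The metric is complete: closed balls are compact. If `X` is the whole space, this holds whenever
  `Mc` is uniformly positive definite. -/
  complete_Mc : ∀ p ∈ P.X, ∀ r : ℝ, IsCompact (P.tubeC p r)
  /-- The controller uses geodesics. -/
  geodesic : ∀ p ∈ P.X, ∀ q ∈ P.X, IsGeodesic P.X P.Mc p q (P.geo p q)
  posDef_Me : IsPosDefOp P.Me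
  lamc_pos : 0 < P.lamc
  lame_pos : 0 < P.lame
  rho_nonneg : 0 ≤ P.rho
  mcLo_pos : 0 < P.mcLo
  eig_Mc : ∀ x ∈ P.Dc, ∀ v : Vec nx, P.mcLo * ‖v‖ ^ 2 ≤ quad (P.Mc x) v ∧
    quad (P.Mc x) v ≤ P.mcHi * ‖v‖ ^ 2
  eig_We : ∀ v : Vec nx, quad P.We v ≤ P.weHi * ‖v‖ ^ 2
  eig_Me : ∀ v : Vec nx, quad P.Me v ≤ P.meHi * ‖v‖ ^ 2
  Lk_nonneg : 0 ≤ P.Lk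
  Lh_nonneg : 0 ≤ P.Lh

end Problem

end CORRT

end

namespace CORRT

open Filter Topology intervalIntegral

/-! ### Quadratic forms -/

section Quad

variable {n : ℕ} {Q : Op n}

/-! The tracking distance `d_c(x*, x)` and the estimation distance `d_e(x, x̂)` satisfy, while the
trajectories stay in the domains of the contraction conditions, differential inequalities whose
right hand sides are those of the tube equations. The cross terms have nonnegative coefficients, so
a comparison principle for cooperative pairs (`nonpos_of_deriv_le`) keeps the distances below the
tubes. The planner's checks on the tubes then give safety and the goal.

Tracking. A Riemannian distance need not be differentiable, but along absolutely continuous curves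
it is absolutely continuous, hence differentiable almost everywhere. Where it is, its derivative
follows from any minimizing geodesic: the energy of a varied geodesic minus the squared distance of
its end points is minimal at the geodesic itself, so its derivative vanishes, and the Euler–Lagrange
equation leaves only boundary terms (`IsGeodesic.riemDist_mul_deriv`). These are the terms in the
definition of the feasible feedbacks. Feasible feedbacks form a half-space, which could be empty
only if `Bᵀ` annihilates the final momentum of the geodesic. The strong conditions then propagate
this along the whole geodesic, and the drift contracts by itself (`Ufeas_nonempty`). Since the
controller error vanishes when the estimate is exact, its Lipschitz constant bounds it by `Lk * d_e`
(`closedLoop_contracts`).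

Estimation. The metric `W_e` is constant, so its geodesics are segments. The mean value inequality
leaves a term `ρ/2 ‖C_r v‖²`, which the innovation term of the observer cancels exactly; perception
error and disturbance remain (`deriv_distE_le`). Each of the three bounds controls the perception
error (`percErr_le`).

The argument is circular: the inequalities need the domains, and membership in the domains comes
from the tubes. The circle is broken by continuous induction in time (`distances_le_tubes`): where
the distances lie below the tubes, compactness of tube sections and openness of the domains give
validity for a little longer (`eventually_trusted`). Induction over the search tree then joins the
extensions. -/

lemma IsPosDefOp.quad_nonneg (hQ : IsPosDefOp Q) (v : Vec n) : 0 ≤ quad Q v := by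
  by_cases h : v = 0
  · simp [h, quad]
  · exact (hQ.2 v h).le

lemma quad_smul (Q : Op n) (c : ℝ) (v : Vec n) : quad Q (c • v) = c ^ 2 * quad Q v := by
  simp only [quad, map_smul, inner_smul_left, inner_smul_right, RCLike.conj_to_real]; ring

lemma sqrt_quad_smul (Q : Op n) {c : ℝ} (hc : 0 ≤ c) (v : Vec n) :
    √(quad Q (c • v)) = c * √(quad Q v) := by
  rw [quad_smul, Real.sqrt_mul (sq_nonneg c), Real.sqrt_sq hc]

lemma quad_le_norm (Q : Op n) (v : Vec n) : quad Q v ≤ ‖Q‖ * ‖v‖ ^ 2 := by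
  calc quad Q v ≤ ‖v‖ * ‖Q v‖ := real_inner_le_norm _ _
    _ ≤ ‖v‖ * (‖Q‖ * ‖v‖) := by gcongr; exact Q.le_opNorm v
    _ = _ := by ring

lemma IsSelfAdjoint.inner_apply_comm (hQ : IsSelfAdjoint Q) (v w : Vec n) :
    inner ℝ v (Q w) = inner ℝ w (Q v) := by
  have h := ContinuousLinearMap.isSelfAdjoint_iff_isSymmetric.1 hQ
  rw [real_inner_comm]
  exact h w v

lemma sqrt_quad_le_of_quad_le {c : ℝ} {v : Vec n} (h : quad Q v ≤ c * ‖v‖ ^ 2) :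
    √(quad Q v) ≤ √c * ‖v‖ := by
  calc √(quad Q v) ≤ √(c * ‖v‖ ^ 2) := Real.sqrt_le_sqrt h
    _ = √c * ‖v‖ := by rw [Real.sqrt_mul' _ (sq_nonneg _), Real.sqrt_sq (norm_nonneg _)]

/-- Cauchy–Schwarz inequality for a positive definite form. -/
lemma IsPosDefOp.inner_le (hQ : IsPosDefOp Q) (v w : Vec n) :
    inner ℝ v (Q w) ≤ √(quad Q v) * √(quad Q w) := by
  have hd : discrim (quad Q w) (2 * inner ℝ v (Q w)) (quad Q v) ≤ 0 := by
    refine discrim_le_zero fun t => ?_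
    have h := hQ.quad_nonneg (v + t • w)
    have hs := IsSelfAdjoint.inner_apply_comm hQ.1 w v
    simp only [quad, map_add, map_smul, inner_add_left, inner_add_right, inner_smul_left,
      inner_smul_right, RCLike.conj_to_real] at h ⊢
    rw [hs] at h
    linarith
  rw [← Real.sqrt_mul (hQ.quad_nonneg v)]
  refine Real.le_sqrt_of_sq_le ?_
  rw [discrim] at hd
  nlinarith

lemma IsPosDefOp.abs_inner_le (hQ : IsPosDefOp Q) (v w : Vec n) :
    |inner ℝ v (Q w)| ≤ √(quad Q v) * √(quad Q w) := by
  refine abs_le.2 ⟨?_, hQ.inner_le v w⟩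
  have h := hQ.inner_le (-v) w
  have e : quad Q (-v) = quad Q v := by simp [quad]
  rw [inner_neg_left, e] at h
  linarith

lemma IsPosDefOp.exists_equiv (hQ : IsPosDefOp Q) :
    ∃ e : Vec n ≃L[ℝ] Vec n, (e : Op n) = Q := by
  have hinj : Function.Injective (Q : Vec n →ₗ[ℝ] Vec n) := by
    rw [← LinearMap.ker_eq_bot, LinearMap.ker_eq_bot']
    intro v hv
    by_contra h
    have hp := hQ.2 v h
    have : Q v = 0 := hv
    simp [quad, this] at hp
  refine ⟨(LinearEquiv.ofInjectiveEndo _ hinj).toContinuousLinearEquiv, ?_⟩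
  ext v
  rfl

lemma IsPosDefOp.inverse_apply (hQ : IsPosDefOp Q) (v : Vec n) : Q.inverse (Q v) = v := by
  obtain ⟨e, rfl⟩ := hQ.exists_equiv
  simp

lemma IsPosDefOp.apply_inverse (hQ : IsPosDefOp Q) (v : Vec n) : Q (Q.inverse v) = v := by
  obtain ⟨e, rfl⟩ := hQ.exists_equiv
  simp

lemma IsPosDefOp.inner_inverse (hQ : IsPosDefOp Q) (v w : Vec n) :
    inner ℝ v (Q.inverse w) = inner ℝ w (Q.inverse v) := by
  have h := IsSelfAdjoint.inner_apply_comm hQ.1 (Q.inverse v) (Q.inverse w)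
  rw [hQ.apply_inverse, hQ.apply_inverse] at h
  exact (real_inner_comm _ _).trans (h.symm.trans (real_inner_comm _ _))

lemma IsPosDefOp.inverse (hQ : IsPosDefOp Q) : IsPosDefOp Q.inverse := by
  refine ⟨ContinuousLinearMap.isSelfAdjoint_iff_isSymmetric.2 fun v w => ?_, fun v hv => ?_⟩
  · change inner ℝ (Q.inverse v) w = inner ℝ v (Q.inverse w)
    rw [hQ.inner_inverse v w, real_inner_comm]
  · have h0 : Q.inverse v ≠ 0 := fun h => hv (by rw [← hQ.apply_inverse v, h, map_zero])
    have h := hQ.2 _ h0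
    rw [quad, hQ.apply_inverse, real_inner_comm] at h
    exact h

/-- An upper eigenvalue bound of `Q` is a lower bound for the form of the inverse. -/
lemma IsPosDefOp.norm_le_of_quad_le (hQ : IsPosDefOp Q) {c : ℝ}
    (h : ∀ v, quad Q v ≤ c * ‖v‖ ^ 2) (v : Vec n) : ‖v‖ ≤ √c * √(quad Q.inverse v) := by
  by_cases hv : v = 0
  · simp only [hv, norm_zero]; positivity
  have hp : 0 < ‖v‖ := norm_pos_iff.2 hv
  -- Cauchy–Schwarz for `Q` between `v` and `Q⁻¹ v`: the product is `‖v‖²`, and the `Q`-form of `Q⁻¹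
  -- v` is the `Q⁻¹`-form of `v`.
  have h1 := hQ.inner_le v (Q.inverse v)
  have h2 : quad Q (Q.inverse v) = quad Q.inverse v := by
    rw [quad, hQ.apply_inverse, real_inner_comm, quad]
  rw [hQ.apply_inverse, real_inner_self_eq_norm_sq, h2] at h1
  have h3 := sqrt_quad_le_of_quad_le (h v)
  have h4 : ‖v‖ * ‖v‖ ≤ (√c * √(quad Q.inverse v)) * ‖v‖ := by
    calc ‖v‖ * ‖v‖ = ‖v‖ ^ 2 := by ring
      _ ≤ √(quad Q v) * √(quad Q.inverse v) := h1
      _ ≤ (√c * ‖v‖) * √(quad Q.inverse v) := by gcongr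
      _ = _ := by ring
  exact le_of_mul_le_mul_right h4 hp

end Quad

/-! ### Riemannian distance -/

section Dist

variable {n : ℕ} {X : Set (Vec n)} {M : Vec n → Op n}

lemma continuous_quad_comp {α : Type*} [TopologicalSpace α] {s : Set α} {Q : α → Op n}
    {v : α → Vec n} (hQ : ContinuousOn Q s) (hv : ContinuousOn v s) :
    ContinuousOn (fun a => quad (Q a) (v a)) s :=
  hv.inner (𝕜 := ℝ) (hQ.clm_apply hv)

lemma continuousOn_speed (hM : ContinuousOn M X) {c : ℝ → Vec n} (hc : ContDiff ℝ ∞ c)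
    {s : Set ℝ} (hs : ∀ t ∈ s, c t ∈ X) :
    ContinuousOn (fun t => √(quad (M (c t)) (deriv c t))) s :=
  (continuous_quad_comp (hM.comp hc.continuous.continuousOn hs)
    (hc.continuous_deriv (by simp)).continuousOn).sqrt

lemma curveLength_nonneg (M : Vec n → Op n) (c : ℝ → Vec n) : 0 ≤ curveLength M c :=
  intervalIntegral.integral_nonneg zero_le_one fun _ _ => Real.sqrt_nonneg _

lemma riemDist_nonneg (X : Set (Vec n)) (M : Vec n → Op n) (p q : Vec n) : 0 ≤ riemDist X M p q := by
  refine Real.sInf_nonneg ?_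
  rintro _ ⟨c, -, rfl⟩
  exact curveLength_nonneg M c

lemma riemDist_le {p q : Vec n} {c : ℝ → Vec n} (hc : c ∈ curves X p q) :
    riemDist X M p q ≤ curveLength M c :=
  csInf_le ⟨0, by rintro _ ⟨c, -, rfl⟩; exact curveLength_nonneg M c⟩ ⟨c, hc, rfl⟩

lemma segment_mem_curves {p q : Vec n} (h : segment ℝ p q ⊆ X) :
    (fun s : ℝ => p + s • (q - p)) ∈ curves X p q := by
  refine ⟨by fun_prop, by simp, by simp, fun s hs => h ?_⟩
  rw [segment_eq_image']
  exact ⟨s, hs, rfl⟩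

lemma deriv_segment (p v : Vec n) (s : ℝ) : deriv (fun s : ℝ => p + s • v) s = v := by
  have h : HasDerivAt (fun s : ℝ => p + s • v) ((1 : ℝ) • v) s :=
    ((hasDerivAt_id s).smul_const v).const_add p
  simpa using h.deriv

lemma riemDist_le_of_segment {p q : Vec n} {C : ℝ} (h : segment ℝ p q ⊆ X)
    (hC : ∀ z ∈ segment ℝ p q, ‖M z‖ ≤ C) : riemDist X M p q ≤ √C * ‖q - p‖ := by
  refine (riemDist_le (segment_mem_curves h)).trans ?_
  have h1 : ‖∫ s in (0 : ℝ)..1, √(quad (M (p + s • (q - p))) (q - p))‖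
      ≤ (√C * ‖q - p‖) * |1 - 0| := by
    refine intervalIntegral.norm_integral_le_of_norm_le_const fun s hs => ?_
    rw [uIoc_of_le zero_le_one] at hs
    rw [Real.norm_of_nonneg (Real.sqrt_nonneg _)]
    refine sqrt_quad_le_of_quad_le ((quad_le_norm _ _).trans ?_)
    gcongr
    refine hC _ ?_
    rw [segment_eq_image']
    exact ⟨s, ⟨hs.1.le, hs.2⟩, rfl⟩
  rw [curveLength]
  simp only [deriv_segment]
  refine (le_abs_self _).trans (h1.trans ?_)
  simp

lemma riemDist_self {p : Vec n} (hp : p ∈ X) : riemDist X M p p = 0 := by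
  refine le_antisymm ?_ (riemDist_nonneg _ _ _ _)
  have := riemDist_le_of_segment (M := M) (p := p) (q := p) (X := X) (C := ‖M p‖) (by simpa using hp)
    (by simp)
  simpa using this

/-- The Riemannian distance is bounded by a multiple of the Euclidean distance near a compact set. -/
lemma exists_riemDist_le_of_isCompact (hX : IsOpen X) (hM : ContinuousOn M X) {K : Set (Vec n)}
    (hK : IsCompact K) (hKX : K ⊆ X) :
    ∃ r > 0, ∃ C, 0 ≤ C ∧ ∀ p ∈ K, ∀ q, dist p q < r →
      q ∈ X ∧ riemDist X M p q ≤ C * dist p q ∧ riemDist X M q p ≤ C * dist p q := by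
  -- A closed thickening of `K` is compact and contains every short segment that starts in `K`, so
  -- one bound on `‖M‖` serves all these segments.
  obtain ⟨δ, hδ, hsub⟩ := hK.exists_cthickening_subset_open hX hKX
  obtain ⟨C, hC⟩ := hK.cthickening.exists_bound_of_continuousOn (hM.mono hsub)
  refine ⟨δ, hδ, √C, Real.sqrt_nonneg _, fun p hp q hq => ?_⟩
  have hseg : segment ℝ p q ⊆ Metric.cthickening δ K := by
    refine ((convex_closedBall p δ).segment_subset (Metric.mem_closedBall_self hδ.le) ?_).trans
      (Metric.closedBall_subset_cthickening hp δ)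
    rw [Metric.mem_closedBall, dist_comm]
    exact hq.le
  refine ⟨hsub (hseg (right_mem_segment ℝ p q)), ?_, ?_⟩
  · rw [dist_comm, dist_eq_norm]
    exact riemDist_le_of_segment (hseg.trans hsub) fun z hz => hC z (hseg hz)
  · rw [dist_eq_norm]
    rw [segment_symm] at hseg
    exact riemDist_le_of_segment (hseg.trans hsub) fun z hz => hC z (hseg hz)

/-- Length of a reparametrized curve. -/
lemma integral_speed_reparam (hM : ContinuousOn M X) {c : ℝ → Vec n} (hc : ContDiff ℝ ∞ c)
    {φ φ' : ℝ → ℝ} {a b : ℝ} (hφ : ∀ t, HasDerivAt φ (φ' t) t) (hφ' : Continuous φ')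
    (hpos : ∀ t, 0 ≤ φ' t) (hcX : ∀ t ∈ uIcc a b, c (φ t) ∈ X) :
    ∫ t in a..b, √(quad (M (c (φ t))) (φ' t • deriv c (φ t)))
      = ∫ s in φ a..φ b, √(quad (M (c s)) (deriv c s)) := by
  rw [← intervalIntegral.integral_comp_mul_deriv'' (f := φ) (f' := φ')
    (g := fun s => √(quad (M (c s)) (deriv c s)))]
  · refine intervalIntegral.integral_congr fun t _ => ?_
    simp only [Function.comp_apply]
    rw [sqrt_quad_smul _ (hpos t), mul_comm]
  · exact fun t _ => (hφ t).continuousAt.continuousWithinAt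
  · exact fun t _ => (hφ t).hasDerivWithinAt
  · exact hφ'.continuousOn
  · refine continuousOn_speed hM hc ?_
    rintro _ ⟨t, ht, rfl⟩
    exact hcX t ht

lemma integrable_speed (hM : ContinuousOn M X) {p q : Vec n} {c : ℝ → Vec n}
    (hc : c ∈ curves X p q) : IntervalIntegrable (fun t => √(quad (M (c t)) (deriv c t))) volume 0 1 :=
  (continuousOn_speed hM hc.1 (by rw [uIcc_of_le zero_le_one]; exact hc.2.2.2)).intervalIntegrable

/-- Distance to a point on a curve. -/
lemma riemDist_le_subcurve (hM : ContinuousOn M X) {p q : Vec n} {c : ℝ → Vec n}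
    (hc : c ∈ curves X p q) {s : ℝ} (hs : s ∈ Icc (0 : ℝ) 1) :
    riemDist X M p (c s) ≤ ∫ t in (0 : ℝ)..s, √(quad (M (c t)) (deriv c t)) := by
  have hmem : ∀ t ∈ Icc (0 : ℝ) 1, s * t ∈ Icc (0 : ℝ) 1 := fun t ht =>
    ⟨mul_nonneg hs.1 ht.1, mul_le_one₀ hs.2 ht.1 ht.2⟩
  have hcs : (fun t => c (s * t)) ∈ curves X p (c s) :=
    ⟨hc.1.comp (by fun_prop), by simp [hc.2.1], by simp, fun t ht => hc.2.2.2 _ (hmem t ht)⟩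
  refine (riemDist_le hcs).trans (le_of_eq ?_)
  have hd : ∀ t, HasDerivAt (fun t => s * t) s t := fun t => by
    simpa using (hasDerivAt_id t).const_mul s
  have h := integral_speed_reparam (a := 0) (b := 1) hM hc.1 hd continuous_const (fun _ => hs.1)
    (fun t ht => hc.2.2.2 _ (hmem t (by rwa [uIcc_of_le zero_le_one] at ht)))
  simp only [mul_zero, mul_one] at h
  rw [← h, curveLength]
  refine intervalIntegral.integral_congr fun t _ => ?_
  have : deriv (fun t => c (s * t)) t = s • deriv c (s * t) :=
    (((hc.1.differentiable (by simp)) (s * t)).hasDerivAt.scomp t (hd t)).deriv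
  simp only [this]

/-- Triangle inequality for concatenated curves. -/
lemma riemDist_le_add (hM : ContinuousOn M X) {p q r : Vec n} {c d : ℝ → Vec n}
    (hc : c ∈ curves X p q) (hd : d ∈ curves X q r) :
    riemDist X M p r ≤ curveLength M c + curveLength M d := by
  set σ := Real.smoothTransition
  have hσ : ContDiff ℝ ∞ σ := Real.smoothTransition.contDiff
  have hσd : ∀ t, HasDerivAt σ (deriv σ t) t := fun t =>
    (hσ.differentiable (by simp) t).hasDerivAt
  have hσ' : Continuous (deriv σ) := hσ.continuous_deriv (by simp)
  have hσpos : ∀ t, 0 ≤ deriv σ t := fun t => Real.smoothTransition.monotone.deriv_nonneg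
  have hσ01 : ∀ t, σ t ∈ Icc (0 : ℝ) 1 := fun t =>
    ⟨Real.smoothTransition.nonneg t, Real.smoothTransition.le_one t⟩
  have h1d : ∀ t : ℝ, HasDerivAt (fun t => σ (2 * t)) (2 * deriv σ (2 * t)) t := fun t => by
    have h : HasDerivAt (fun t : ℝ => 2 * t) 2 t := by simpa using (hasDerivAt_id t).const_mul 2
    rw [mul_comm]
    exact (hσd (2 * t)).comp t h
  have h2d : ∀ t : ℝ, HasDerivAt (fun t => σ (2 * t - 1)) (2 * deriv σ (2 * t - 1)) t := fun t => by
    have h : HasDerivAt (fun t : ℝ => 2 * t - 1) 2 t := by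
      simpa using ((hasDerivAt_id t).const_mul 2).sub_const 1
    rw [mul_comm]
    exact (hσd (2 * t - 1)).comp t h
  -- The transition function is constant outside `[0, 1]`. On each half of the interval one summand
  -- therefore equals `q` and cancels against `- q`, so the concatenation is smooth without any
  -- gluing.
  set e : ℝ → Vec n := fun t => c (σ (2 * t)) + d (σ (2 * t - 1)) - q
  have he : ContDiff ℝ ∞ e :=
    ((hc.1.comp (hσ.comp (by fun_prop))).add (hd.1.comp (hσ.comp (by fun_prop)))).sub contDiff_const
  have he1 : ∀ t ≤ (1 / 2 : ℝ), e t = c (σ (2 * t)) := fun t ht => by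
    have : σ (2 * t - 1) = 0 := Real.smoothTransition.zero_of_nonpos (by linarith)
    simp [e, this, hd.2.1]
  have he2 : ∀ t ≥ (1 / 2 : ℝ), e t = d (σ (2 * t - 1)) := fun t ht => by
    have : σ (2 * t) = 1 := Real.smoothTransition.one_of_one_le (by linarith)
    simp [e, this, hc.2.2.1]
  have heX : ∀ t, e t ∈ X := fun t => by
    rcases le_total t (1 / 2) with h | h
    · rw [he1 t h]; exact hc.2.2.2 _ (hσ01 _)
    · rw [he2 t h]; exact hd.2.2.2 _ (hσ01 _)
  have hemem : e ∈ curves X p r := by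
    refine ⟨he, ?_, ?_, fun t _ => heX t⟩
    · rw [he1 0 (by norm_num)]
      simp [σ, hc.2.1]
    · rw [he2 1 (by norm_num)]
      norm_num [σ, hd.2.2.1]
  have hde : ∀ t, deriv e t
      = (2 * deriv σ (2 * t)) • deriv c (σ (2 * t))
        + (2 * deriv σ (2 * t - 1)) • deriv d (σ (2 * t - 1)) := fun t =>
    ((((hc.1.differentiable (by simp)) _).hasDerivAt.scomp t (h1d t)).add
      (((hd.1.differentiable (by simp)) _).hasDerivAt.scomp t (h2d t))).sub_const q |>.deriv
  -- Where the transition function takes an extreme value its derivative vanishes; the inactive half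
  -- contributes no velocity, even at the junction `t = 1/2`.
  have hflat0 : ∀ t ≤ (0 : ℝ), deriv σ t = 0 := fun t ht => by
    have hmin : IsLocalMin σ t := by
      refine Filter.Eventually.of_forall fun s => ?_
      rw [show σ t = 0 from Real.smoothTransition.zero_of_nonpos ht]
      exact (hσ01 s).1
    exact hmin.deriv_eq_zero
  have hflat1 : ∀ t ≥ (1 : ℝ), deriv σ t = 0 := fun t ht => by
    have hmax : IsLocalMax σ t := by
      refine Filter.Eventually.of_forall fun s => ?_
      rw [show σ t = 1 from Real.smoothTransition.one_of_one_le ht]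
      exact (hσ01 s).2
    exact hmax.deriv_eq_zero
  refine (riemDist_le hemem).trans (le_of_eq ?_)
  have hint : ∀ a b : ℝ, IntervalIntegrable (fun t => √(quad (M (e t)) (deriv e t))) volume a b :=
    fun a b => (continuousOn_speed hM he fun t _ => heX t).intervalIntegrable
  rw [curveLength, ← intervalIntegral.integral_add_adjacent_intervals (hint 0 (1 / 2))
    (hint (1 / 2) 1)]
  congr 1
  · have h := integral_speed_reparam (a := 0) (b := 1 / 2) hM hc.1 h1d (by fun_prop)
      (fun t => mul_nonneg zero_le_two (hσpos _)) (fun t _ => hc.2.2.2 _ (hσ01 _))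
    have e0 : σ (2 * 0) = 0 := by simp [σ]
    have e1 : σ (2 * (1 / 2)) = 1 := by norm_num [σ]
    rw [e0, e1] at h
    rw [curveLength, ← h]
    refine intervalIntegral.integral_congr fun t ht => ?_
    rw [uIcc_of_le (by norm_num)] at ht
    simp only [he1 t ht.2, hde, hflat0 (2 * t - 1) (by linarith [ht.2]), mul_zero, zero_smul, add_zero]
  · have h := integral_speed_reparam (a := 1 / 2) (b := 1) hM hd.1 h2d (by fun_prop)
      (fun t => mul_nonneg zero_le_two (hσpos _)) (fun t _ => hd.2.2.2 _ (hσ01 _))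
    have e0 : σ (2 * (1 / 2) - 1) = 0 := by norm_num [σ]
    have e1 : σ (2 * 1 - 1) = 1 := by norm_num [σ]
    rw [e0, e1] at h
    rw [curveLength, ← h]
    refine intervalIntegral.integral_congr fun t ht => ?_
    rw [uIcc_of_le (by norm_num)] at ht
    simp only [he2 t ht.1, hde, hflat1 (2 * t) (by linarith [ht.1]), mul_zero, zero_smul, zero_add]

/-- A set in which any two points are joined by a geodesic. -/
def GeodesicallyConnected (X : Set (Vec n)) (M : Vec n → Op n) : Prop :=
  ∀ p ∈ X, ∀ q ∈ X, ∃ c, IsGeodesic X M p q c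

/-- Both infima on the right are attained by geodesics, so concatenating these two curves suffices
and no approximation is needed. -/
lemma riemDist_triangle (hM : ContinuousOn M X) (hg : GeodesicallyConnected X M) {p q r : Vec n}
    (hp : p ∈ X) (hq : q ∈ X) (hr : r ∈ X) :
    riemDist X M p r ≤ riemDist X M p q + riemDist X M q r := by
  obtain ⟨c, hc, hc', -⟩ := hg p hp q hq
  obtain ⟨d, hd, hd', -⟩ := hg q hq r hr
  rw [← hc', ← hd']
  exact riemDist_le_add hM hc hd

/-- The speed is constant, so the initial piece up to parameter `s` has length `s` times the whole.
-/
lemma IsGeodesic.riemDist_le (hM : ContinuousOn M X) {p q : Vec n} {c : ℝ → Vec n}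
    (hc : IsGeodesic X M p q c) {s : ℝ} (hs : s ∈ Icc (0 : ℝ) 1) :
    riemDist X M p (c s) ≤ s * riemDist X M p q := by
  refine (riemDist_le_subcurve hM hc.1 hs).trans (le_of_eq ?_)
  rw [intervalIntegral.integral_congr (g := fun _ => riemDist X M p q)]
  · simp
  · intro t ht
    rw [uIcc_of_le hs.1] at ht
    exact hc.2.2 t ⟨ht.1, ht.2.trans hs.2⟩

/-- Lengths in the direction of a geodesic dominate Euclidean lengths. -/
lemma IsGeodesic.norm_sub_le {p q : Vec n} {c : ℝ → Vec n} (hc : IsGeodesic X M p q c) {m : ℝ}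
    (hm : 0 < m) (h : ∀ s ∈ Icc (0 : ℝ) 1, ∀ v, m * ‖v‖ ^ 2 ≤ quad (M (c s)) v) {s : ℝ}
    (hs : s ∈ Icc (0 : ℝ) 1) : ‖q - c s‖ ≤ (1 - s) * riemDist X M p q / √m := by
  have hd : ∀ t ∈ Icc s 1, HasDerivWithinAt c (deriv c t) (Icc s 1) t := fun t _ =>
    ((hc.1.1.differentiable (by simp)) t).hasDerivAt.hasDerivWithinAt
  have hb : ∀ t ∈ Ico s 1, ‖deriv c t‖ ≤ riemDist X M p q / √m := fun t ht => by
    have ht' : t ∈ Icc (0 : ℝ) 1 := ⟨hs.1.trans ht.1, ht.2.le⟩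
    rw [le_div_iff₀ (Real.sqrt_pos.2 hm), ← hc.2.2 t ht', mul_comm]
    refine Real.le_sqrt_of_sq_le ?_
    rw [mul_pow, Real.sq_sqrt hm.le]
    exact h t ht' _
  have := norm_image_sub_le_of_norm_deriv_le_segment' hd hb 1 (right_mem_Icc.2 hs.2)
  rw [hc.1.2.2.1] at this
  refine this.trans (le_of_eq ?_)
  ring

/-- By the triangle inequality in each argument, the change of the distance is at most the sum of
the distances by which the two points move; these are locally bounded by multiples of Euclidean
distances. -/
lemma continuousAt_riemDist (hX : IsOpen X) (hM : ContinuousOn M X)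
    (hg : GeodesicallyConnected X M) {p q : Vec n} (hp : p ∈ X) (hq : q ∈ X) :
    ContinuousAt (fun z : Vec n × Vec n => riemDist X M z.1 z.2) (p, q) := by
  obtain ⟨r₁, hr₁, C₁, hC₁, h₁⟩ := exists_riemDist_le_of_isCompact hX hM isCompact_singleton
    (singleton_subset_iff.2 hp)
  obtain ⟨r₂, hr₂, C₂, hC₂, h₂⟩ := exists_riemDist_le_of_isCompact hX hM isCompact_singleton
    (singleton_subset_iff.2 hq)
  rw [ContinuousAt, tendsto_iff_dist_tendsto_zero]
  have hlim : Tendsto (fun z : Vec n × Vec n => C₁ * dist p z.1 + C₂ * dist q z.2) (𝓝 (p, q))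
      (𝓝 0) := by
    have : Continuous (fun z : Vec n × Vec n => C₁ * dist p z.1 + C₂ * dist q z.2) := by fun_prop
    simpa using this.tendsto (p, q)
  refine squeeze_zero' (Eventually.of_forall fun _ => dist_nonneg) ?_ hlim
  have ev : ∀ᶠ z : Vec n × Vec n in 𝓝 (p, q), dist p z.1 < r₁ ∧ dist q z.2 < r₂ := by
    have c1 : Continuous (fun z : Vec n × Vec n => dist p z.1) := by fun_prop
    have c2 : Continuous (fun z : Vec n × Vec n => dist q z.2) := by fun_prop
    exact (c1.continuousAt.eventually_lt continuousAt_const (by simpa using hr₁)).and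
      (c2.continuousAt.eventually_lt continuousAt_const (by simpa using hr₂))
  filter_upwards [ev] with z hz
  obtain ⟨hz1, a1, b1⟩ := h₁ p rfl z.1 hz.1
  obtain ⟨hz2, a2, b2⟩ := h₂ q rfl z.2 hz.2
  have t1 := riemDist_triangle hM hg hz1 hp hz2
  have t2 := riemDist_triangle hM hg hp hq hz2
  have t3 := riemDist_triangle hM hg hp hz1 hq
  have t4 := riemDist_triangle hM hg hz1 hz2 hq
  rw [Real.dist_eq, abs_le]
  constructor <;> linarith

/-- Distance of a constant metric. -/
lemma riemDist_univ_const {Q : Op n} (hQ : IsPosDefOp Q) (p q : Vec n) :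
    riemDist univ (fun _ => Q) p q = √(quad Q (q - p)) := by
  have hmem := segment_mem_curves (X := univ) (p := p) (q := q) (subset_univ _)
  apply le_antisymm
  · refine (riemDist_le hmem).trans (le_of_eq ?_)
    simp only [curveLength, deriv_segment]
    simp
  · refine le_csInf ⟨_, _, hmem, rfl⟩ ?_
    rintro _ ⟨c, hc, rfl⟩
    set v := q - p
    by_cases h0 : √(quad Q v) = 0
    · rw [h0]; exact curveLength_nonneg _ _
    have hpos : 0 < √(quad Q v) := lt_of_le_of_ne (Real.sqrt_nonneg _) (Ne.symm h0)
    have hcd : Continuous (deriv c) := hc.1.continuous_deriv (by simp)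
    -- The form `⟨v, Q ·⟩` is a calibration: its integral along every curve from `p` to `q` is `⟨v,
    -- Q v⟩`, while Cauchy–Schwarz bounds the integrand by `√(quad Q v)` times the speed.
    have hftc : ∫ s in (0 : ℝ)..1, inner ℝ v (Q (deriv c s)) = inner ℝ v (Q v) := by
      have := intervalIntegral.integral_eq_sub_of_hasDerivAt (a := 0) (b := 1)
        (f := fun s => inner ℝ v (Q (c s))) (f' := fun s => inner ℝ v (Q (deriv c s)))
        (fun s _ => by
          have h1 := Q.hasFDerivAt.comp_hasDerivAt s
            (hc.1.differentiable (by simp) s).hasDerivAt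
          simpa using (hasDerivAt_const s v).inner ℝ h1)
        (Continuous.intervalIntegrable (by fun_prop) _ _)
      rw [this, hc.2.1, hc.2.2.1, ← inner_sub_right, ← map_sub]
    have hle : inner ℝ v (Q v) ≤ √(quad Q v) * curveLength (fun _ => Q) c := by
      rw [← hftc, curveLength, ← intervalIntegral.integral_const_mul]
      refine intervalIntegral.integral_mono_on zero_le_one
        (Continuous.intervalIntegrable (by fun_prop) _ _) ?_ fun s _ => hQ.inner_le _ _
      exact (integrable_speed (X := univ) (M := fun _ => Q) continuousOn_const hc).const_mul _
    have hsq : inner ℝ v (Q v) = √(quad Q v) * √(quad Q v) :=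
      (Real.mul_self_sqrt (hQ.quad_nonneg v)).symm
    rw [hsq] at hle
    exact le_of_mul_le_mul_left hle hpos

end Dist

end CORRT

namespace CORRT

open Filter Topology intervalIntegral

/-! ### Absolutely continuous functions -/

section AbsolutelyContinuous

open AbsolutelyContinuousOnInterval

lemma AbsolutelyContinuousOnInterval.of_dist_le {α : Type*} [PseudoMetricSpace α] {f : ℝ → α}
    {F : ℝ → ℝ} {a b C : ℝ} (hC : 0 ≤ C) (hF : AbsolutelyContinuousOnInterval F a b)
    (h : ∀ s ∈ uIcc a b, ∀ t ∈ uIcc a b, dist (f s) (f t) ≤ C * dist (F s) (F t)) :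
    AbsolutelyContinuousOnInterval f a b := by
  rw [absolutelyContinuousOnInterval_iff] at hF ⊢
  intro ε hε
  obtain ⟨δ, hδ, hδ'⟩ := hF (ε / (C + 1)) (by positivity)
  refine ⟨δ, hδ, fun E hE hl => ?_⟩
  have h1 := hδ' E hE hl
  rw [lt_div_iff₀ (by positivity)] at h1
  have h0 : 0 ≤ ∑ i ∈ Finset.range E.1, dist (F (E.2 i).1) (F (E.2 i).2) :=
    Finset.sum_nonneg fun _ _ => dist_nonneg
  calc _ ≤ ∑ i ∈ Finset.range E.1, C * dist (F (E.2 i).1) (F (E.2 i).2) :=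
        Finset.sum_le_sum fun i hi => h _ (hE.1 i hi).1 _ (hE.1 i hi).2
    _ = C * ∑ i ∈ Finset.range E.1, dist (F (E.2 i).1) (F (E.2 i).2) := by rw [Finset.mul_sum]
    _ < ε := by nlinarith

/-- The increments of `x` are dominated by those of the real function `∫ ‖g‖`, which is absolutely
continuous. -/
lemma AbsolutelyContinuousOnInterval.of_integral {E : Type*} [NormedAddCommGroup E]
    [NormedSpace ℝ E] {x g : ℝ → E} {c : E} {a b : ℝ} (hab : a ≤ b)
    (hg : IntervalIntegrable g volume a b)
    (hx : ∀ t ∈ Icc a b, x t = c + ∫ τ in a..t, g τ) :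
    AbsolutelyContinuousOnInterval x a b := by
  have hF := hg.norm.absolutelyContinuousOnInterval_intervalIntegral (c := a) left_mem_uIcc
  refine AbsolutelyContinuousOnInterval.of_dist_le zero_le_one hF fun s hs t ht => ?_
  have hia : ∀ s ∈ uIcc a b, IntervalIntegrable g volume a s := fun s hs =>
    hg.mono_set (uIcc_subset_uIcc left_mem_uIcc hs)
  have hI := hia s hs
  have hJ := hia t ht
  rw [uIcc_of_le hab] at hs ht
  rw [hx s hs, hx t ht, dist_add_left, dist_eq_norm, integral_interval_sub_left hI hJ, one_mul,
    Real.dist_eq, integral_interval_sub_left hI.norm hJ.norm]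
  exact norm_integral_le_abs_integral_norm

lemma ae_hasDerivAt_of_integral {E : Type*} [NormedAddCommGroup E] [NormedSpace ℝ E]
    [CompleteSpace E] {x g : ℝ → E} {c : E} {a b : ℝ}
    (hg : IntervalIntegrable g volume a b)
    (hx : ∀ t ∈ Icc a b, x t = c + ∫ τ in a..t, g τ) :
    ∀ᵐ t, t ∈ Ioo a b → HasDerivAt x (g t) t := by
  filter_upwards [hg.ae_hasDerivAt_integral] with t ht hmem
  have h := (ht (Icc_subset_uIcc (Ioo_subset_Icc_self hmem)) a left_mem_uIcc).const_add c
  refine h.congr_of_eventuallyEq ?_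
  filter_upwards [Icc_mem_nhds hmem.1 hmem.2] with s hs using hx s hs

lemma ae_mem_Ioo_of_mem_Icc (a b : ℝ) : ∀ᵐ t : ℝ, t ∈ Icc a b → t ∈ Ioo a b := by
  have ha : ∀ᵐ t : ℝ, t ≠ a := by simp [ae_iff, measure_singleton]
  have hb : ∀ᵐ t : ℝ, t ≠ b := by simp [ae_iff, measure_singleton]
  filter_upwards [ha, hb] with t h1 h2 ht
  exact ⟨lt_of_le_of_ne ht.1 (Ne.symm h1), lt_of_le_of_ne ht.2 h2⟩

variable {n : ℕ} {X : Set (Vec n)} {M : Vec n → Op n}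

/-- Near the compact images of the two curves the Riemannian distance is at most a multiple of the
Euclidean one. The triangle inequality then bounds the increments of the distance by those of the
curves. -/
lemma AbsolutelyContinuousOnInterval.riemDist (hX : IsOpen X) (hM : ContinuousOn M X)
    (hg : GeodesicallyConnected X M) {x y : ℝ → Vec n} {a b : ℝ}
    (hx : AbsolutelyContinuousOnInterval x a b) (hy : AbsolutelyContinuousOnInterval y a b)
    (hxX : ∀ t ∈ uIcc a b, x t ∈ X) (hyX : ∀ t ∈ uIcc a b, y t ∈ X) :
    AbsolutelyContinuousOnInterval (fun t => riemDist X M (x t) (y t)) a b := by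
  obtain ⟨r, hr, C, hC, hK⟩ := exists_riemDist_le_of_isCompact hX hM
    ((isCompact_uIcc.image_of_continuousOn hx.continuousOn).union
      (isCompact_uIcc.image_of_continuousOn hy.continuousOn))
    (union_subset (by rintro _ ⟨t, ht, rfl⟩; exact hxX t ht)
      (by rintro _ ⟨t, ht, rfl⟩; exact hyX t ht))
  rw [absolutelyContinuousOnInterval_iff] at hx hy ⊢
  intro ε hε
  -- The minimum with `r` makes each single increment small enough for the local bound; the other
  -- entry makes the total at most `ε`.
  have hmin : 0 < min r (ε / (2 * (C + 1))) := by positivity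
  obtain ⟨δ₁, hδ₁, h₁⟩ := hx _ hmin
  obtain ⟨δ₂, hδ₂, h₂⟩ := hy _ hmin
  refine ⟨min δ₁ δ₂, by positivity, fun E hE hl => ?_⟩
  have k1 := h₁ E hE (hl.trans_le (min_le_left _ _))
  have k2 := h₂ E hE (hl.trans_le (min_le_right _ _))
  have small : ∀ z : ℝ → Vec n,
      ∑ i ∈ Finset.range E.1, dist (z (E.2 i).1) (z (E.2 i).2) < min r (ε / (2 * (C + 1))) →
      ∀ i ∈ Finset.range E.1, dist (z (E.2 i).1) (z (E.2 i).2) < r := fun z hz i hi =>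
    ((Finset.single_le_sum (f := fun i => dist (z (E.2 i).1) (z (E.2 i).2))
      (fun _ _ => dist_nonneg) hi).trans_lt hz).trans_le (min_le_left _ _)
  have step : ∀ i ∈ Finset.range E.1,
      dist (CORRT.riemDist X M (x (E.2 i).1) (y (E.2 i).1))
        (CORRT.riemDist X M (x (E.2 i).2) (y (E.2 i).2))
      ≤ C * dist (x (E.2 i).1) (x (E.2 i).2) + C * dist (y (E.2 i).1) (y (E.2 i).2) := by
    intro i hi
    obtain ⟨hs, ht⟩ := hE.1 i hi
    obtain ⟨-, a1, b1⟩ := hK _ (Or.inl ⟨_, hs, rfl⟩) _ (small x k1 i hi)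
    obtain ⟨-, a2, b2⟩ := hK _ (Or.inr ⟨_, hs, rfl⟩) _ (small y k2 i hi)
    have t1 := riemDist_triangle hM hg (hxX _ hs) (hxX _ ht) (hyX _ ht)
    have t2 := riemDist_triangle hM hg (hxX _ hs) (hyX _ ht) (hyX _ hs)
    have t3 := riemDist_triangle hM hg (hxX _ ht) (hxX _ hs) (hyX _ hs)
    have t4 := riemDist_triangle hM hg (hxX _ ht) (hyX _ hs) (hyX _ ht)
    rw [Real.dist_eq, abs_le]
    constructor <;> linarith
  have k1' := k1.trans_le (min_le_right _ _)
  have k2' := k2.trans_le (min_le_right _ _)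
  rw [lt_div_iff₀ (by positivity)] at k1' k2'
  have n1 : 0 ≤ ∑ i ∈ Finset.range E.1, dist (x (E.2 i).1) (x (E.2 i).2) :=
    Finset.sum_nonneg fun _ _ => dist_nonneg
  have n2 : 0 ≤ ∑ i ∈ Finset.range E.1, dist (y (E.2 i).1) (y (E.2 i).2) :=
    Finset.sum_nonneg fun _ _ => dist_nonneg
  refine (Finset.sum_le_sum step).trans_lt ?_
  rw [Finset.sum_add_distrib, ← Finset.mul_sum, ← Finset.mul_sum]
  nlinarith

end AbsolutelyContinuous

/-! ### Comparison -/

section Comparison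

/-- After the last time `s ≤ t` with `p s ≤ 0` the function is positive, so the derivative bound is
available on all of `(s, t]` and can be integrated from there. -/
lemma posPart_le_integral {p φ : ℝ → ℝ} {a t : ℝ} (hat : a ≤ t)
    (hp : AbsolutelyContinuousOnInterval p a t) (hpa : p a ≤ 0)
    (hφ : ContinuousOn φ (Icc a t)) (hφ0 : ∀ s ∈ Icc a t, 0 ≤ φ s)
    (h : ∀ᵐ s, s ∈ Icc a t → 0 < p s → deriv p s ≤ φ s) : p t ≤ ∫ s in a..t, φ s := by
  have hpc : ContinuousOn p (Icc a t) := by simpa [uIcc_of_le hat] using hp.continuousOn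
  have hφi : IntervalIntegrable φ volume a t := hφ.intervalIntegrable_of_Icc hat
  have hclosed : IsClosed (Icc a t ∩ p ⁻¹' Iic 0) :=
    hpc.preimage_isClosed_of_isClosed isClosed_Icc isClosed_Iic
  obtain ⟨s, ⟨hs, hps⟩, hmax⟩ := (isCompact_Icc.of_isClosed_subset hclosed
    inter_subset_left).exists_isGreatest ⟨a, left_mem_Icc.2 hat, hpa⟩
  have hsub : uIcc s t ⊆ uIcc a t := uIcc_subset_uIcc (Icc_subset_uIcc hs) right_mem_uIcc
  have hps' := hp.mono hsub
  have hpos : ∀ r ∈ Ioc s t, 0 < p r := fun r hr => by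
    by_contra hcon
    exact absurd (hmax ⟨⟨hs.1.trans hr.1.le, hr.2⟩, not_lt.1 hcon⟩) (not_le.2 hr.1)
  have h1 : ∫ r in s..t, deriv p r ≤ ∫ r in s..t, φ r := by
    refine intervalIntegral.integral_mono_ae_restrict hs.2 hps'.intervalIntegrable_deriv
      (hφi.mono_set hsub) ?_
    rw [EventuallyLE, ae_restrict_iff' measurableSet_Icc]
    filter_upwards [h, ae_mem_Ioo_of_mem_Icc s t] with r hr hr' hmem
    exact hr ⟨hs.1.trans hmem.1, hmem.2⟩ (hpos r (Ioo_subset_Ioc_self (hr' hmem)))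
  rw [hps'.integral_deriv_eq_sub] at h1
  have h2 : ∫ r in s..t, φ r ≤ ∫ r in a..t, φ r := by
    refine intervalIntegral.integral_mono_interval hs.1 hs.2 le_rfl ?_ hφi
    rw [EventuallyLE, ae_restrict_iff' measurableSet_Ioc]
    exact Eventually.of_forall fun r hr => hφ0 r (Ioc_subset_Icc_self hr)
  have h3 : p s ≤ 0 := hps
  linarith

/-- Comparison principle for a cooperative pair of differential inequalities. -/
lemma nonpos_of_deriv_le {p q : ℝ → ℝ} {a b K : ℝ} (hab : a ≤ b) (hK : 0 ≤ K)
    (hp : AbsolutelyContinuousOnInterval p a b) (hq : AbsolutelyContinuousOnInterval q a b)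
    (hpa : p a ≤ 0) (hqa : q a ≤ 0)
    (h₁ : ∀ᵐ t, t ∈ Icc a b → 0 < p t → deriv p t ≤ K * (max (p t) 0 + max (q t) 0))
    (h₂ : ∀ᵐ t, t ∈ Icc a b → 0 < q t → deriv q t ≤ K * (max (p t) 0 + max (q t) 0)) :
    ∀ t ∈ Icc a b, p t ≤ 0 ∧ q t ≤ 0 := by
  have hpc : ContinuousOn p (Icc a b) := by simpa [uIcc_of_le hab] using hp.continuousOn
  have hqc : ContinuousOn q (Icc a b) := by simpa [uIcc_of_le hab] using hq.continuousOn
  set φ : ℝ → ℝ := fun t => max (p t) 0 + max (q t) 0 with hφdef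
  have hφc : ContinuousOn φ (Icc a b) :=
    (hpc.sup continuousOn_const).add (hqc.sup continuousOn_const)
  have hφ0 : ∀ t, 0 ≤ φ t := fun t => add_nonneg (le_max_right _ _) (le_max_right _ _)
  -- Clamping to `[a, b]` extends `φ` continuously to the line, so that its primitive `Φ` is
  -- differentiable everywhere.
  set π : ℝ → ℝ := fun t => max a (min b t)
  have hπ : ∀ t, π t ∈ Icc a b := fun t => ⟨le_max_left _ _, max_le hab (min_le_left _ _)⟩
  have hπ' : ∀ t ∈ Icc a b, π t = t := fun t ht => by simp [π, ht.1, ht.2]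
  set ψ : ℝ → ℝ := fun t => φ (π t)
  have hψc : Continuous ψ := hφc.comp_continuous (by fun_prop) hπ
  have hψ : ∀ t ∈ Icc a b, ψ t = φ t := fun t ht => by simp [ψ, hπ' t ht]
  set Φ : ℝ → ℝ := fun t => ∫ s in a..t, ψ s
  have hΦ0 : ∀ t ∈ Icc a b, 0 ≤ Φ t := fun t ht =>
    intervalIntegral.integral_nonneg ht.1 fun s _ => hφ0 _
  have key : ∀ r : ℝ → ℝ, AbsolutelyContinuousOnInterval r a b → r a ≤ 0 →
      (∀ᵐ t, t ∈ Icc a b → 0 < r t → deriv r t ≤ K * φ t) →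
      ∀ t ∈ Icc a b, max (r t) 0 ≤ K * Φ t := by
    intro r hr hra h t ht
    refine max_le ?_ (mul_nonneg hK (hΦ0 t ht))
    rw [← intervalIntegral.integral_const_mul]
    have hs : uIcc a t ⊆ uIcc a b := uIcc_subset_uIcc left_mem_uIcc (Icc_subset_uIcc ht)
    refine posPart_le_integral ht.1 (hr.mono hs) hra (by fun_prop)
      (fun s _ => mul_nonneg hK (hφ0 _)) ?_
    filter_upwards [h] with s hs hmem hpos
    have hmem' : s ∈ Icc a b := ⟨hmem.1, hmem.2.trans ht.2⟩
    rw [hψ s hmem']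
    exact hs hmem' hpos
  have k1 := key p hp hpa h₁
  have k2 := key q hq hqa h₂
  have hder : ∀ t, HasDerivAt Φ (ψ t) t := fun t =>
    intervalIntegral.integral_hasDerivAt_right (hψc.intervalIntegrable _ _)
      hψc.aestronglyMeasurable.stronglyMeasurableAtFilter hψc.continuousAt
  -- The two bounds add up to `Φ' = φ ≤ 2 K Φ` with `Φ a = 0`, and Grönwall gives `Φ = 0`.
  have hzero : ∀ t ∈ Icc a b, Φ t = 0 :=
    eq_zero_of_abs_deriv_le_mul_abs_self_of_eq_zero_right (K := 2 * K)
      (fun t _ => (hder t).continuousAt.continuousWithinAt)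
      (fun t _ => (hder t).hasDerivWithinAt) (by simp [Φ]) (by
        intro t ht
        have ht' := Ico_subset_Icc_self ht
        rw [hψ t ht', Real.norm_of_nonneg (hφ0 t), Real.norm_of_nonneg (hΦ0 t ht')]
        have e1 := k1 t ht'
        have e2 := k2 t ht'
        simp only [hφdef]
        linarith)
  intro t ht
  have e1 := k1 t ht
  have e2 := k2 t ht
  rw [hzero t ht, mul_zero] at e1 e2
  exact ⟨(le_max_left _ _).trans e1, (le_max_left _ _).trans e2⟩

end Comparison

end CORRT

namespace CORRT

open Filter Topology intervalIntegral Asymptotics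

/-! ### Variation of the energy -/

section Variation

variable {n : ℕ} {X : Set (Vec n)} {M : Vec n → Op n}

/-- Cauchy–Schwarz on `[0, 1]`, obtained by expanding `∫ (speed - L)² ≥ 0` with `L` the length of
the curve. -/
lemma riemDist_sq_le_energy (hM : ContinuousOn M X) (hpos : ∀ x ∈ X, IsPosDefOp (M x))
    {p q : Vec n} {c : ℝ → Vec n} (hc : c ∈ curves X p q) :
    riemDist X M p q ^ 2 ≤ ∫ s in (0 : ℝ)..1, quad (M (c s)) (deriv c s) := by
  set L := curveLength M c with hL
  have hLd : riemDist X M p q ≤ L := riemDist_le hc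
  have h1 : riemDist X M p q ^ 2 ≤ L ^ 2 := by
    have := riemDist_nonneg X M p q
    gcongr
  refine h1.trans ?_
  have hi := integrable_speed hM hc
  have hcX : ∀ s ∈ uIcc (0 : ℝ) 1, c s ∈ X := by rw [uIcc_of_le zero_le_one]; exact hc.2.2.2
  have hq : IntervalIntegrable (fun s => quad (M (c s)) (deriv c s)) volume 0 1 :=
    (continuous_quad_comp (hM.comp hc.1.continuous.continuousOn hcX)
      (hc.1.continuous_deriv (by simp)).continuousOn).intervalIntegrable
  have h0 : 0 ≤ ∫ s in (0 : ℝ)..1,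
      (quad (M (c s)) (deriv c s) - 2 * L * √(quad (M (c s)) (deriv c s)) + L ^ 2) := by
    refine intervalIntegral.integral_nonneg zero_le_one fun s hs => ?_
    have := Real.sq_sqrt ((hpos _ (hc.2.2.2 s hs)).quad_nonneg (deriv c s))
    nlinarith [sq_nonneg (√(quad (M (c s)) (deriv c s)) - L)]
  rw [intervalIntegral.integral_add (hq.sub (hi.const_mul _)) intervalIntegrable_const,
    intervalIntegral.integral_sub hq (hi.const_mul _), intervalIntegral.integral_const_mul,
    ← curveLength, ← hL, intervalIntegral.integral_const] at h0
  simp only [sub_zero, one_smul] at h0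
  nlinarith

lemma IsGeodesic.energy_eq (hpos : ∀ x ∈ X, IsPosDefOp (M x)) {p q : Vec n} {c : ℝ → Vec n}
    (hc : IsGeodesic X M p q c) :
    ∫ s in (0 : ℝ)..1, quad (M (c s)) (deriv c s) = riemDist X M p q ^ 2 := by
  rw [intervalIntegral.integral_congr (g := fun _ => riemDist X M p q ^ 2)]
  · simp
  · intro s hs
    rw [uIcc_of_le zero_le_one] at hs
    simp only
    rw [← hc.2.2 s hs, Real.sq_sqrt ((hpos _ (hc.1.2.2.2 s hs)).quad_nonneg _)]

lemma hasDerivAt_metric_comp (hX : IsOpen X) (hM : ContDiffOn ℝ ∞ M X) {c : ℝ → Vec n} {v : Vec n}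
    {t : ℝ} (hct : c t ∈ X) (hc : HasDerivAt c v t) :
    HasDerivAt (fun s => M (c s)) (fderiv ℝ M (c t) v) t :=
  (((hM.contDiffAt (hX.mem_nhds hct)).differentiableAt (by simp)).hasFDerivAt).comp_hasDerivAt t hc

/-- Curves with small variations stay in an open set. -/
lemma exists_variation_mem (hX : IsOpen X) {γ δ : ℝ → Vec n} (hγ : Continuous γ) (hδ : Continuous δ)
    (hγX : ∀ s ∈ Icc (0 : ℝ) 1, γ s ∈ X) :
    ∃ r : ℝ, 0 < r ∧ ∀ h ∈ Icc (-r) r, ∀ s ∈ Icc (0 : ℝ) 1, γ s + h • δ s ∈ X := by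
  obtain ⟨η, hη, hsub⟩ := (isCompact_Icc.image hγ).exists_cthickening_subset_open hX
    (by rintro _ ⟨s, hs, rfl⟩; exact hγX s hs)
  obtain ⟨C, hC⟩ := isCompact_Icc.exists_bound_of_continuousOn (hδ.continuousOn (s := Icc (0 : ℝ) 1))
  have hC0 : 0 ≤ C := (norm_nonneg _).trans (hC 0 (by simp))
  refine ⟨η / (C + 1), by positivity, fun h hh s hs => hsub ?_⟩
  refine Metric.closedBall_subset_cthickening (mem_image_of_mem γ hs) η ?_
  rw [Metric.mem_closedBall, dist_eq_norm, add_sub_cancel_left, norm_smul, Real.norm_eq_abs]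
  have hh' : |h| ≤ η / (C + 1) := abs_le.2 hh
  rw [le_div_iff₀ (by positivity)] at hh'
  have := hC s hs
  nlinarith [abs_nonneg h, norm_nonneg (δ s)]

/-- Derivative of the energy under a smooth variation. -/
lemma hasDerivAt_energy (hX : IsOpen X) (hM : ContDiffOn ℝ ∞ M X)
    (hpos : ∀ x ∈ X, IsPosDefOp (M x)) {γ δ : ℝ → Vec n} (hγ : ContDiff ℝ ∞ γ)
    (hδ : ContDiff ℝ ∞ δ) (hγX : ∀ s ∈ Icc (0 : ℝ) 1, γ s ∈ X) :
    HasDerivAt (fun h : ℝ => ∫ s in (0 : ℝ)..1,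
        quad (M (γ s + h • δ s)) (deriv γ s + h • deriv δ s))
      (∫ s in (0 : ℝ)..1, (quad (fderiv ℝ M (γ s) (δ s)) (deriv γ s)
        + 2 * inner ℝ (deriv δ s) (M (γ s) (deriv γ s)))) 0 := by
  obtain ⟨r, hr, hrX⟩ := exists_variation_mem hX hγ.continuous hδ.continuous hγX
  have hγ' : Continuous (deriv γ) := hγ.continuous_deriv (by simp)
  have hδ' : Continuous (deriv δ) := hδ.continuous_deriv (by simp)
  have hγc := hγ.continuous
  have hδc := hδ.continuous
  set F' : ℝ → ℝ → ℝ := fun h s =>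
    quad (fderiv ℝ M (γ s + h • δ s) (δ s)) (deriv γ s + h • deriv δ s)
      + (inner ℝ (deriv δ s) (M (γ s + h • δ s) (deriv γ s + h • deriv δ s))
        + inner ℝ (deriv γ s + h • deriv δ s) (M (γ s + h • δ s) (deriv δ s))) with hF'
  have hMc : ContinuousOn M X := hM.continuousOn
  have hDc : ContinuousOn (fderiv ℝ M) X := hM.continuousOn_fderiv_of_isOpen hX (by simp)
  have hcc : Continuous (fun z : ℝ × ℝ => γ z.2 + z.1 • δ z.2) := by fun_prop
  have hcc' : Continuous (fun z : ℝ × ℝ => deriv γ z.2 + z.1 • deriv δ z.2) := by fun_prop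
  have hmaps : MapsTo (fun z : ℝ × ℝ => γ z.2 + z.1 • δ z.2) (Icc (-r) r ×ˢ Icc (0 : ℝ) 1) X :=
    fun z hz => hrX z.1 hz.1 z.2 hz.2
  have hMz := hMc.comp hcc.continuousOn hmaps
  have hδz : ContinuousOn (fun z : ℝ × ℝ => δ z.2) (Icc (-r) r ×ˢ Icc (0 : ℝ) 1) := by fun_prop
  have hδz' : ContinuousOn (fun z : ℝ × ℝ => deriv δ z.2) (Icc (-r) r ×ˢ Icc (0 : ℝ) 1) := by fun_prop
  have hFc : ContinuousOn (fun z : ℝ × ℝ => quad (M (γ z.2 + z.1 • δ z.2))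
      (deriv γ z.2 + z.1 • deriv δ z.2)) (Icc (-r) r ×ˢ Icc (0 : ℝ) 1) :=
    continuous_quad_comp hMz hcc'.continuousOn
  have hF'c : ContinuousOn (fun z : ℝ × ℝ => F' z.1 z.2) (Icc (-r) r ×ˢ Icc (0 : ℝ) 1) := by
    refine ContinuousOn.add ?_ (ContinuousOn.add ?_ ?_)
    · exact continuous_quad_comp ((hDc.comp hcc.continuousOn hmaps).clm_apply hδz) hcc'.continuousOn
    · exact hδz'.inner (𝕜 := ℝ) (hMz.clm_apply hcc'.continuousOn)
    · exact hcc'.continuousOn.inner (𝕜 := ℝ) (hMz.clm_apply hδz')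
  -- Joint continuity on a compact rectangle provides the constant that dominates the derivative of
  -- the integrand.
  obtain ⟨C, hC⟩ := (isCompact_Icc.prod isCompact_Icc).exists_bound_of_continuousOn hF'c
  have slice : ∀ {G : ℝ × ℝ → ℝ}, ContinuousOn G (Icc (-r) r ×ˢ Icc (0 : ℝ) 1) → ∀ h ∈ Icc (-r) r,
      ContinuousOn (fun s => G (h, s)) (Icc 0 1) := fun hG h hh =>
    hG.comp (by fun_prop) fun s hs => ⟨hh, hs⟩
  have sub : uIoc (0 : ℝ) 1 ⊆ Icc 0 1 := by rw [uIoc_of_le zero_le_one]; exact Ioc_subset_Icc_self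
  have h0 : (0 : ℝ) ∈ Icc (-r) r := ⟨by linarith, hr.le⟩
  have hnhds : Icc (-r) r ∈ 𝓝 (0 : ℝ) := Icc_mem_nhds (by linarith) hr
  have main := intervalIntegral.hasDerivAt_integral_of_dominated_loc_of_deriv_le
    (μ := volume) (a := 0) (b := 1)
    (F := fun (h s : ℝ) => quad (M (γ s + h • δ s)) (deriv γ s + h • deriv δ s)) (F' := F')
    (x₀ := (0 : ℝ)) (s := Icc (-r) r) (bound := fun _ : ℝ => C) hnhds ?_ ?_ ?_ ?_ intervalIntegrable_const ?_
  · refine main.2.congr_deriv ?_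
    refine intervalIntegral.integral_congr fun s hs => ?_
    rw [uIcc_of_le zero_le_one] at hs
    have := IsSelfAdjoint.inner_apply_comm (hpos _ (hγX s hs)).1 (deriv γ s) (deriv δ s)
    simp only [hF', zero_smul, add_zero, this]
    ring
  · filter_upwards [hnhds] with h hh
    exact ((slice hFc h hh).aestronglyMeasurable measurableSet_Icc).mono_set sub
  · exact (slice hFc 0 h0).intervalIntegrable_of_Icc zero_le_one
  · exact ((slice hF'c 0 h0).aestronglyMeasurable measurableSet_Icc).mono_set sub
  · exact Eventually.of_forall fun s hs h hh => hC (h, s) ⟨hh, sub hs⟩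
  · refine Eventually.of_forall fun s hs h hh => ?_
    have hd : ∀ v w : Vec n, HasDerivAt (fun h : ℝ => v + h • w) w h := fun v w => by
      simpa using ((hasDerivAt_id h).smul_const w).const_add v
    have h1 := hasDerivAt_metric_comp hX hM (hrX h hh s (sub hs)) (hd (γ s) (δ s))
    have h2 := hd (deriv γ s) (deriv δ s)
    refine (h2.inner ℝ (h1.clm_apply h2)).congr_deriv ?_
    simp only [hF', quad, inner_add_right]
    ring

/-- The momentum `M(γ) γ'` of a curve. -/
noncomputable def momentum (M : Vec n → Op n) (γ : ℝ → Vec n) (s : ℝ) : Vec n := M (γ s) (deriv γ s)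

/-- The derivative of the momentum. -/
noncomputable def momentumDeriv (M : Vec n → Op n) (γ : ℝ → Vec n) (s : ℝ) : Vec n :=
  fderiv ℝ M (γ s) (deriv γ s) (deriv γ s) + M (γ s) (deriv (deriv γ) s)

lemma hasDerivAt_momentum (hX : IsOpen X) (hM : ContDiffOn ℝ ∞ M X) {γ : ℝ → Vec n}
    (hγ : ContDiff ℝ ∞ γ) {s : ℝ} (hs : γ s ∈ X) :
    HasDerivAt (momentum M γ) (momentumDeriv M γ s) s := by
  have hγ' : ContDiff ℝ ∞ (deriv γ) := (contDiff_infty_iff_deriv.1 hγ).2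
  exact (hasDerivAt_metric_comp hX hM hs (hγ.differentiable (by simp) s).hasDerivAt).clm_apply
    (hγ'.differentiable (by simp) s).hasDerivAt

lemma continuousOn_momentumDeriv (hX : IsOpen X) (hM : ContDiffOn ℝ ∞ M X) {γ : ℝ → Vec n}
    (hγ : ContDiff ℝ ∞ γ) {S : Set ℝ} (hS : ∀ s ∈ S, γ s ∈ X) :
    ContinuousOn (momentumDeriv M γ) S := by
  have hγ' : ContDiff ℝ ∞ (deriv γ) := (contDiff_infty_iff_deriv.1 hγ).2
  have hD : ContinuousOn (fun s => fderiv ℝ M (γ s)) S :=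
    (hM.continuousOn_fderiv_of_isOpen hX (by simp)).comp hγ.continuous.continuousOn hS
  have hM' : ContinuousOn (fun s => M (γ s)) S := hM.continuousOn.comp hγ.continuous.continuousOn hS
  have h1 := hγ'.continuous.continuousOn (s := S)
  have h2 := (hγ'.continuous_deriv (by simp)).continuousOn (s := S)
  exact ((hD.clm_apply h1).clm_apply h1).add (hM'.clm_apply h2)

/-- The Euler–Lagrange equation of a minimizing geodesic. -/
lemma IsGeodesic.euler_lagrange (hX : IsOpen X) (hM : ContDiffOn ℝ ∞ M X)
    (hpos : ∀ x ∈ X, IsPosDefOp (M x)) {p q : Vec n} {γ : ℝ → Vec n} (hγ : IsGeodesic X M p q γ)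
    (v : Vec n) {s : ℝ} (hs : s ∈ Icc (0 : ℝ) 1) :
    2 * inner ℝ v (momentumDeriv M γ s) = quad (fderiv ℝ M (γ s) v) (deriv γ s) := by
  obtain ⟨⟨hγs, hγ0, hγ1, hγX⟩, -, -⟩ := id hγ
  have hγ' : Continuous (deriv γ) := hγs.continuous_deriv (by simp)
  have hD : ContinuousOn (fun s => fderiv ℝ M (γ s) v) (Icc 0 1) :=
    ((hM.continuousOn_fderiv_of_isOpen hX (by simp)).comp hγs.continuous.continuousOn hγX).clm_apply
      continuousOn_const
  have hc1 : ContinuousOn (fun s => quad (fderiv ℝ M (γ s) v) (deriv γ s)) (Icc 0 1) :=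
    continuous_quad_comp hD hγ'.continuousOn
  have hc2 : ContinuousOn (fun s => inner ℝ v (momentumDeriv M γ s)) (Icc 0 1) :=
    continuousOn_const.inner (𝕜 := ℝ) (continuousOn_momentumDeriv hX hM hγs hγX)
  have hc2' : ContinuousOn (fun s => 2 * inner ℝ v (momentumDeriv M γ s)) (Icc 0 1) :=
    continuousOn_const.mul hc2
  have hmom : ∀ s ∈ Icc (0 : ℝ) 1, HasDerivAt (fun s => inner ℝ v (momentum M γ s))
      (inner ℝ v (momentumDeriv M γ s)) s := fun s hs => by
    simpa using (hasDerivAt_const s v).inner ℝ (hasDerivAt_momentum hX hM hγs (hγX s hs))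
  have hcm : ContinuousOn (fun s => inner ℝ v (momentum M γ s)) (Icc 0 1) :=
    fun s hs => (hmom s hs).continuousAt.continuousWithinAt
  set f : ℝ → ℝ := fun s => quad (fderiv ℝ M (γ s) v) (deriv γ s)
    - 2 * inner ℝ v (momentumDeriv M γ s) with hf
  have hfc : ContinuousOn f (Icc 0 1) := hc1.sub hc2'
  -- Fundamental lemma of the calculus of variations, with test functions supported in the open
  -- interval.
  have hae : ∀ᵐ s : ℝ, s ∈ Ioo (0 : ℝ) 1 → f s = 0 := by
    refine isOpen_Ioo.ae_eq_zero_of_integral_contDiff_smul_eq_zero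
      ((hfc.mono Ioo_subset_Icc_self).locallyIntegrableOn measurableSet_Ioo) ?_
    intro g hg _ hsupp
    have hgz : ∀ s, s ∉ Ioo (0 : ℝ) 1 → g s = 0 := fun s hs =>
      image_eq_zero_of_notMem_tsupport fun h => hs (hsupp h)
    have hg0 : g 0 = 0 := hgz 0 (by simp)
    have hg1 : g 1 = 0 := hgz 1 (by simp)
    have hgc := hg.continuous
    have hg' : Continuous (deriv g) := hg.continuous_deriv (by simp)
    set δ : ℝ → Vec n := fun s => g s • v with hδdef
    have hδ : ContDiff ℝ ∞ δ := hg.smul contDiff_const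
    have hδ' : ∀ s, deriv δ s = deriv g s • v := fun s =>
      ((hg.differentiable (by simp) s).hasDerivAt.smul_const v).deriv
    have hE := hasDerivAt_energy hX hM hpos hγs hδ hγX
    obtain ⟨r, hr, hrX⟩ := exists_variation_mem hX hγs.continuous hδ.continuous hγX
    -- The variation `g • v` fixes the end points, so every varied curve has energy at least the
    -- squared distance, which is the energy of the geodesic.
    have hmin : IsLocalMin (fun h : ℝ => ∫ s in (0 : ℝ)..1,
        quad (M (γ s + h • δ s)) (deriv γ s + h • deriv δ s)) 0 := by
      filter_upwards [Icc_mem_nhds (show -r < 0 by linarith) hr] with h hh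
      have hcur : (fun s => γ s + h • δ s) ∈ curves X p q :=
        ⟨hγs.add (hδ.const_smul h), by simp [hδdef, hg0, hγ0], by simp [hδdef, hg1, hγ1], hrX h hh⟩
      have h1 := riemDist_sq_le_energy hM.continuousOn hpos hcur
      have hdc : ∀ s, deriv (fun s => γ s + h • δ s) s = deriv γ s + h • deriv δ s := fun s =>
        ((hγs.differentiable (by simp) s).hasDerivAt.add
          ((hδ.differentiable (by simp) s).hasDerivAt.const_smul h)).deriv
      simp only [hdc] at h1
      simp only [zero_smul, add_zero]
      rw [hγ.energy_eq hpos]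
      exact h1
    have hzero := hmin.hasDerivAt_eq_zero hE
    have hparts := intervalIntegral.integral_mul_deriv_eq_deriv_mul (a := 0) (b := 1)
      (u := fun s => inner ℝ v (momentum M γ s)) (v := g)
      (u' := fun s => inner ℝ v (momentumDeriv M γ s)) (v' := deriv g)
      (fun s hs => hmom s (by rwa [uIcc_of_le zero_le_one] at hs))
      (fun s _ => (hg.differentiable (by simp) s).hasDerivAt)
      (hc2.intervalIntegrable_of_Icc zero_le_one) (hg'.intervalIntegrable _ _)
    rw [hg0, hg1] at hparts
    simp only [mul_zero, sub_zero, zero_sub] at hparts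
    have i1 : IntervalIntegrable (fun s => g s * quad (fderiv ℝ M (γ s) v) (deriv γ s)) volume 0 1 :=
      (hgc.continuousOn.mul hc1).intervalIntegrable_of_Icc zero_le_one
    have i2 : IntervalIntegrable (fun s => inner ℝ v (momentum M γ s) * deriv g s) volume 0 1 :=
      (hcm.mul hg'.continuousOn).intervalIntegrable_of_Icc zero_le_one
    have i3 : IntervalIntegrable (fun s => inner ℝ v (momentumDeriv M γ s) * g s) volume 0 1 :=
      (hc2.mul hgc.continuousOn).intervalIntegrable_of_Icc zero_le_one
    have e1 : ∫ s in (0 : ℝ)..1, (quad (fderiv ℝ M (γ s) (δ s)) (deriv γ s)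
        + 2 * inner ℝ (deriv δ s) (M (γ s) (deriv γ s)))
        = ∫ s in (0 : ℝ)..1, (g s * quad (fderiv ℝ M (γ s) v) (deriv γ s)
          + 2 * (inner ℝ v (momentum M γ s) * deriv g s)) := by
      refine intervalIntegral.integral_congr fun s _ => ?_
      rw [hδ']
      simp only [hδdef, quad, map_smul, smul_apply, inner_smul_right,
        inner_smul_left, RCLike.conj_to_real, momentum]
      ring
    rw [e1, intervalIntegral.integral_add i1 (i2.const_mul 2), intervalIntegral.integral_const_mul,
      hparts] at hzero
    have e2 : ∫ s, g s • f s = ∫ s in (0 : ℝ)..1, g s • f s := by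
      rw [intervalIntegral.integral_of_le zero_le_one,
        setIntegral_eq_integral_of_forall_compl_eq_zero]
      intro s hs
      rw [hgz s fun h => hs (Ioo_subset_Ioc_self h), zero_smul]
    have e3 : ∫ s in (0 : ℝ)..1, g s • f s
        = ∫ s in (0 : ℝ)..1, (g s * quad (fderiv ℝ M (γ s) v) (deriv γ s)
          - 2 * (inner ℝ v (momentumDeriv M γ s) * g s)) := by
      refine intervalIntegral.integral_congr fun s _ => ?_
      simp only [hf, smul_eq_mul]
      ring
    rw [e2, e3, intervalIntegral.integral_sub i1 (i3.const_mul 2),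
      intervalIntegral.integral_const_mul]
    linarith
  have heq : f =ᵐ[volume.restrict (Icc (0 : ℝ) 1)] fun _ => 0 := by
    rw [EventuallyEq, ae_restrict_iff' measurableSet_Icc]
    filter_upwards [hae, ae_mem_Ioo_of_mem_Icc 0 1] with s h1 h2 h3 using h1 (h2 h3)
  -- Continuity of the residual upgrades almost everywhere to everywhere, end points included.
  have := Measure.eqOn_Icc_of_ae_eq volume zero_ne_one heq hfc continuousOn_const hs
  simp only [hf] at this
  linarith

/-- Replacing the curves by their tangent lines changes the distance by `o(h)`, because it is
locally bounded by multiples of Euclidean distances. This transfers the derivative to straight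
variations, although the distance need not be differentiable as a function of its end points. -/
lemma hasDerivAt_riemDist_linear (hX : IsOpen X) (hM : ContinuousOn M X)
    (hg : GeodesicallyConnected X M) {p q : ℝ → Vec n} {p' q' : Vec n} {t D' : ℝ}
    (hp : HasDerivAt p p' t) (hq : HasDerivAt q q' t) (hpX : p t ∈ X) (hqX : q t ∈ X)
    (hD : HasDerivAt (fun s => riemDist X M (p s) (q s)) D' t) :
    HasDerivAt (fun h : ℝ => riemDist X M (p t + h • p') (q t + h • q')) D' 0 := by
  have local_bound : ∀ {y : ℝ → Vec n} {y' : Vec n}, HasDerivAt y y' t → y t ∈ X →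
      ∃ C, 0 ≤ C ∧ ∀ᶠ h : ℝ in 𝓝 0, y (t + h) ∈ X ∧ y t + h • y' ∈ X ∧
        riemDist X M (y (t + h)) (y t + h • y') ≤ C * ‖y (t + h) - y t - h • y'‖ ∧
        riemDist X M (y t + h • y') (y (t + h)) ≤ C * ‖y (t + h) - y t - h • y'‖ := by
    intro y y' hy hyX
    obtain ⟨η, hη, hηX⟩ := Metric.nhds_basis_closedBall.mem_iff.1 (hX.mem_nhds hyX)
    obtain ⟨r, hr, C, hC, hK⟩ := exists_riemDist_le_of_isCompact hX hM
      (isCompact_closedBall (y t) η) hηX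
    refine ⟨C, hC, ?_⟩
    have c1 : Tendsto (fun h : ℝ => y (t + h)) (𝓝 0) (𝓝 (y t)) := by
      have h1 : Tendsto (fun h : ℝ => t + h) (𝓝 0) (𝓝 t) := by
        simpa using (continuous_const_add t).tendsto (0 : ℝ)
      exact hy.continuousAt.tendsto.comp h1
    have c2 : Tendsto (fun h : ℝ => y t + h • y') (𝓝 0) (𝓝 (y t)) := by
      have : Continuous (fun h : ℝ => y t + h • y') := by fun_prop
      simpa using this.tendsto 0
    have c3 := c1.dist c2
    rw [dist_self] at c3
    filter_upwards [c1 (Metric.closedBall_mem_nhds _ hη), c3.eventually_lt_const hr] with h h1 h2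
    obtain ⟨a, b, c⟩ := hK _ h1 _ h2
    rw [dist_eq_norm, ← sub_sub] at b c
    exact ⟨hηX h1, a, b, c⟩
  obtain ⟨C₁, hC₁, h₁⟩ := local_bound hp hpX
  obtain ⟨C₂, hC₂, h₂⟩ := local_bound hq hqX
  rw [hasDerivAt_iff_isLittleO_nhds_zero] at hp hq hD ⊢
  have hb : (fun h : ℝ => riemDist X M (p t + h • p') (q t + h • q')
      - riemDist X M (p (t + h)) (q (t + h))) =o[𝓝 0] fun h : ℝ => h := by
    have hs := (hp.norm_left.const_mul_left C₁).add (hq.norm_left.const_mul_left C₂)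
    refine IsBigO.trans_isLittleO (IsBigO.of_bound 1 ?_) hs
    filter_upwards [h₁, h₂] with h ⟨a1, a2, a3, a4⟩ ⟨b1, b2, b3, b4⟩
    have t1 := riemDist_triangle hM hg a1 a2 b1
    have t2 := riemDist_triangle hM hg a2 b2 b1
    have t3 := riemDist_triangle hM hg a2 a1 b2
    have t4 := riemDist_triangle hM hg a1 b1 b2
    have n1 := mul_nonneg hC₁ (norm_nonneg (p (t + h) - p t - h • p'))
    have n2 := mul_nonneg hC₂ (norm_nonneg (q (t + h) - q t - h • q'))
    rw [one_mul, Real.norm_eq_abs, Real.norm_of_nonneg (add_nonneg n1 n2), abs_le]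
    constructor <;> linarith
  refine (hb.add hD).congr_left fun h => ?_
  simp only [zero_add, zero_smul, add_zero]
  ring

/-- First variation of the Riemannian distance. -/
lemma IsGeodesic.riemDist_mul_deriv (hX : IsOpen X) (hM : ContDiffOn ℝ ∞ M X)
    (hpos : ∀ x ∈ X, IsPosDefOp (M x)) (hg : GeodesicallyConnected X M) {p q : ℝ → Vec n}
    {p' q' : Vec n} {t D' : ℝ} {γ : ℝ → Vec n} (hγ : IsGeodesic X M (p t) (q t) γ)
    (hp : HasDerivAt p p' t) (hq : HasDerivAt q q' t)
    (hD : HasDerivAt (fun s => riemDist X M (p s) (q s)) D' t) :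
    riemDist X M (p t) (q t) * D'
      = inner ℝ (deriv γ 1) (M (q t) q') - inner ℝ (deriv γ 0) (M (p t) p') := by
  obtain ⟨⟨hγs, hγ0, hγ1, hγX⟩, -, -⟩ := id hγ
  have hpX : p t ∈ X := hγ0 ▸ hγX 0 (by simp)
  have hqX : q t ∈ X := hγ1 ▸ hγX 1 (by simp)
  have hD0 := hasDerivAt_riemDist_linear hX hM.continuousOn hg hp hq hpX hqX hD
  -- The variation field interpolates the two end point velocities linearly; any smooth field with
  -- these boundary values would do.
  set δ : ℝ → Vec n := fun s => p' + s • (q' - p') with hδdef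
  have hδ : ContDiff ℝ ∞ δ := by fun_prop
  have hδ' : ∀ s, deriv δ s = q' - p' := deriv_segment p' (q' - p')
  have hE := hasDerivAt_energy hX hM hpos hγs hδ hγX
  obtain ⟨r, hr, hrX⟩ := exists_variation_mem hX hγs.continuous hδ.continuous hγX
  -- Energy dominates squared distance, with equality for the geodesic at `h = 0`.
  have hmin : IsLocalMin (fun h : ℝ => (∫ s in (0 : ℝ)..1,
      quad (M (γ s + h • δ s)) (deriv γ s + h • deriv δ s))
        - riemDist X M (p t + h • p') (q t + h • q') ^ 2) 0 := by
    filter_upwards [Icc_mem_nhds (show -r < 0 by linarith) hr] with h hh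
    have hcur : (fun s => γ s + h • δ s) ∈ curves X (p t + h • p') (q t + h • q') :=
      ⟨hγs.add (hδ.const_smul h), by simp [hδdef, hγ0], by simp [hδdef, hγ1], hrX h hh⟩
    have h1 := riemDist_sq_le_energy hM.continuousOn hpos hcur
    have hdc : ∀ s, deriv (fun s => γ s + h • δ s) s = deriv γ s + h • deriv δ s := fun s =>
      ((hγs.differentiable (by simp) s).hasDerivAt.add
        ((hδ.differentiable (by simp) s).hasDerivAt.const_smul h)).deriv
    simp only [hdc] at h1
    simp only [zero_smul, add_zero]
    rw [hγ.energy_eq hpos]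
    linarith
  have hzero := hmin.hasDerivAt_eq_zero (hE.sub (hD0.pow 2))
  -- By the Euler–Lagrange equation the first variation integrand is the total derivative of `2 ⟨δ,
  -- M γ'⟩`, so only boundary terms survive.
  have hmom : ∀ s ∈ uIcc (0 : ℝ) 1, HasDerivAt (fun s => 2 * inner ℝ (δ s) (momentum M γ s))
      (quad (fderiv ℝ M (γ s) (δ s)) (deriv γ s)
        + 2 * inner ℝ (deriv δ s) (M (γ s) (deriv γ s))) s := fun s hs => by
    rw [uIcc_of_le zero_le_one] at hs
    have h1 := ((hδ.differentiable (by simp) s).hasDerivAt.inner ℝ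
      (hasDerivAt_momentum hX hM hγs (hγX s hs))).const_mul 2
    refine h1.congr_deriv ?_
    rw [mul_add, hγ.euler_lagrange hX hM hpos (δ s) hs]
    rfl
  have hint : IntervalIntegrable (fun s => quad (fderiv ℝ M (γ s) (δ s)) (deriv γ s)
        + 2 * inner ℝ (deriv δ s) (M (γ s) (deriv γ s))) volume 0 1 := by
    have hγ' : Continuous (deriv γ) := hγs.continuous_deriv (by simp)
    have hδc : Continuous (deriv δ) := hδ.continuous_deriv (by simp)
    have hMγ := hM.continuousOn.comp hγs.continuous.continuousOn hγX
    have hDγ := (hM.continuousOn_fderiv_of_isOpen hX (by simp)).comp hγs.continuous.continuousOn hγX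
    refine ContinuousOn.intervalIntegrable_of_Icc zero_le_one (ContinuousOn.add ?_
      (continuousOn_const.mul ?_))
    · exact continuous_quad_comp (hDγ.clm_apply hδ.continuous.continuousOn) hγ'.continuousOn
    · exact hδc.continuousOn.inner (𝕜 := ℝ) (hMγ.clm_apply hγ'.continuousOn)
  rw [intervalIntegral.integral_eq_sub_of_hasDerivAt hmom hint] at hzero
  have e1 : δ 1 = q' := by simp [hδdef]
  have e0 : δ 0 = p' := by simp [hδdef]
  have s1 := IsSelfAdjoint.inner_apply_comm (hpos _ hqX).1 q' (deriv γ 1)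
  have s0 := IsSelfAdjoint.inner_apply_comm (hpos _ hpX).1 p' (deriv γ 0)
  simp only [e1, e0, momentum, hγ0, hγ1, s1, s0, zero_smul, add_zero] at hzero
  norm_num at hzero
  linarith

end Variation

end CORRT

namespace CORRT

open Filter Topology

/-! ### Feasible feedback and contraction of the tracking distance -/

lemma exists_closest {n : ℕ} {S : Set (Vec n)} (hS : IsClosed S) (hne : S.Nonempty) (u : Vec n) :
    ∃ l, IsClosest S u l := by
  obtain ⟨l, hl, hd⟩ := hS.exists_infDist_eq_dist hne u
  refine ⟨l, hl, fun v hv => ?_⟩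
  rw [← dist_eq_norm, ← dist_eq_norm, dist_comm l, dist_comm v, ← hd]
  exact Metric.infDist_le_dist_of_mem hv

/-- A linear map splits off its kernel. -/
lemma exists_ker_decomposition {n m : ℕ} (T : Vec n →L[ℝ] Vec m) :
    ∃ R : Vec m →L[ℝ] Vec n, ∀ v, T (v - R (T v)) = 0 := by
  obtain ⟨g, hg⟩ := (T : Vec n →ₗ[ℝ] Vec m).rangeRestrict.exists_rightInverse_of_surjective
    (LinearMap.range_rangeRestrict _)
  obtain ⟨R, hR⟩ := LinearMap.exists_extend g
  refine ⟨LinearMap.toContinuousLinearMap R, fun v => ?_⟩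
  have h1 : R (T v) = g ((T : Vec n →ₗ[ℝ] Vec m).rangeRestrict v) :=
    LinearMap.congr_fun hR ((T : Vec n →ₗ[ℝ] Vec m).rangeRestrict v)
  have h2 : T (g ((T : Vec n →ₗ[ℝ] Vec m).rangeRestrict v)) = T v :=
    congrArg Subtype.val (LinearMap.congr_fun hg ((T : Vec n →ₗ[ℝ] Vec m).rangeRestrict v))
  rw [map_sub, LinearMap.coe_toContinuousLinearMap', h1, h2, sub_self]

namespace Problem

variable {nx nu nwx ny nwy np nr N : ℕ} {P : Problem nx nu nwx ny nwy np nr N}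

lemma distC_nonneg (p q : Vec nx) : 0 ≤ P.distC p q := riemDist_nonneg _ _ _ _

lemma distE_nonneg (p q : Vec nx) : 0 ≤ P.distE p q := riemDist_nonneg _ _ _ _

namespace Setting

variable (hS : P.Setting)

include hS

lemma continuousOn_Mc : ContinuousOn P.Mc P.X := hS.smooth_Mc.continuousOn

lemma connected : GeodesicallyConnected P.X P.Mc := fun p hp q hq => ⟨_, hS.geodesic p hp q hq⟩

lemma distC_triangle {p q r : Vec nx} (hp : p ∈ P.X) (hq : q ∈ P.X) (hr : r ∈ P.X) :
    P.distC p r ≤ P.distC p q + P.distC q r :=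
  riemDist_triangle hS.continuousOn_Mc hS.connected hp hq hr

lemma posDef_We : IsPosDefOp P.We := hS.posDef_Me.inverse

lemma distE_eq (p q : Vec nx) : P.distE p q = √(quad P.We (q - p)) :=
  riemDist_univ_const hS.posDef_We p q

lemma distE_comm (p q : Vec nx) : P.distE p q = P.distE q p := by
  rw [hS.distE_eq, hS.distE_eq, ← neg_sub, quad, quad, map_neg, inner_neg_neg]

/-! ### The dual metric -/

lemma contDiffOn_Wc : ContDiffOn ℝ ∞ P.Wc P.X := by
  intro x hx
  obtain ⟨e, he⟩ := (hS.posDef_Mc x hx).exists_equiv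
  have hu : (e.toUnit : Op nx) = P.Mc x := he
  have h1 := contDiffAt_ringInverse ℝ (n := ∞) e.toUnit
  rw [hu] at h1
  have h2 := h1.comp x (hS.smooth_Mc.contDiffAt (hS.open_X.mem_nhds hx))
  rw [ContinuousLinearMap.ringInverse_eq_inverse] at h2
  exact h2.contDiffWithinAt

lemma Mc_Wc {x : Vec nx} (hx : x ∈ P.X) (v : Vec nx) : P.Mc x (P.Wc x v) = v :=
  (hS.posDef_Mc x hx).apply_inverse v

lemma Wc_Mc {x : Vec nx} (hx : x ∈ P.X) (v : Vec nx) : P.Wc x (P.Mc x v) = v :=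
  (hS.posDef_Mc x hx).inverse_apply v

/-- The derivative of the dual metric, as a form. -/
lemma inner_fderiv_Wc {x : Vec nx} (hx : x ∈ P.X) (u v : Vec nx) :
    inner ℝ (P.Mc x v) (fderiv ℝ P.Wc x u (P.Mc x v)) = -quad (fderiv ℝ P.Mc x u) v := by
  have hline : HasDerivAt (fun t : ℝ => x + t • u) u 0 := by
    simpa using ((hasDerivAt_id (0 : ℝ)).smul_const u).const_add x
  have hx0 : x + (0 : ℝ) • u ∈ P.X := by simpa using hx
  have hM := hasDerivAt_metric_comp hS.open_X hS.smooth_Mc hx0 hline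
  have hW := hasDerivAt_metric_comp hS.open_X hS.contDiffOn_Wc hx0 hline
  -- Differentiates `M W η = η` along a line, with the fixed covector `η = M(x) v`.
  have hprod := hM.clm_apply (hW.clm_apply (hasDerivAt_const (0 : ℝ) (P.Mc x v)))
  have hconst : (fun t : ℝ => P.Mc (x + t • u) (P.Wc (x + t • u) (P.Mc x v)))
      =ᶠ[𝓝 0] fun _ => P.Mc x v := by
    have : Tendsto (fun t : ℝ => x + t • u) (𝓝 0) (𝓝 (x + (0 : ℝ) • u)) :=
      hline.continuousAt.tendsto
    filter_upwards [this (hS.open_X.mem_nhds hx0)] with t ht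
    exact hS.Mc_Wc ht _
  have h := hprod.unique ((hasDerivAt_const (0 : ℝ) (P.Mc x v)).congr_of_eventuallyEq hconst)
  simp only [zero_smul, add_zero, map_zero, hS.Wc_Mc hx] at h
  have h1 : P.Mc x (fderiv ℝ P.Wc x u (P.Mc x v)) = -(fderiv ℝ P.Mc x u v) :=
    eq_neg_of_add_eq_zero_right h
  rw [real_inner_comm, ← IsSelfAdjoint.inner_apply_comm (hS.posDef_Mc x hx).1 v, h1,
    inner_neg_right]
  rfl

/-! ### Feasible feedback -/

section Geodesic

variable {xs x : Vec nx} (hxs : xs ∈ P.X) (hx : x ∈ P.X)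

include hxs hx

lemma geo_mem {s : ℝ} (hs : s ∈ Icc (0 : ℝ) 1) : P.geo xs x s ∈ P.X :=
  (hS.geodesic xs hxs x hx).1.2.2.2 s hs

/-- The geodesic equation in Hamiltonian form, `η' = -½ ∂ₓ ⟨η, W η⟩`. It brings in the derivatives
of the dual metric, in which the contraction conditions are stated. -/
lemma inner_momentumDeriv {s : ℝ} (hs : s ∈ Icc (0 : ℝ) 1) (v : Vec nx) :
    2 * inner ℝ v (momentumDeriv P.Mc (P.geo xs x) s)
      = -inner ℝ (momentum P.Mc (P.geo xs x) s)
          (fderiv ℝ P.Wc (P.geo xs x s) v (momentum P.Mc (P.geo xs x) s)) := by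
  rw [(hS.geodesic xs hxs x hx).euler_lagrange hS.open_X hS.smooth_Mc hS.posDef_Mc v hs, momentum,
    hS.inner_fderiv_Wc (hS.geo_mem hxs hx hs), neg_neg]

lemma hasDerivAt_geo_momentum {s : ℝ} (hs : s ∈ Icc (0 : ℝ) 1) :
    HasDerivAt (momentum P.Mc (P.geo xs x)) (momentumDeriv P.Mc (P.geo xs x) s) s :=
  hasDerivAt_momentum hS.open_X hS.smooth_Mc (hS.geodesic xs hxs x hx).1.1 (hS.geo_mem hxs hx hs)

/-- Under the strong conditions, a geodesic whose momentum is annihilated by `Bᵀ` at its end point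
has this property everywhere. -/
lemma adjoint_momentum_eq_zero (hCCM : P.IsCCM)
    (hDc : ∀ s ∈ Icc (0 : ℝ) 1, P.geo xs x s ∈ P.Dc)
    (h1 : ContinuousLinearMap.adjoint P.B (momentum P.Mc (P.geo xs x) 1) = 0) {s : ℝ}
    (hs : s ∈ Icc (0 : ℝ) 1) :
    ContinuousLinearMap.adjoint P.B (momentum P.Mc (P.geo xs x) s) = 0 := by
  set γ := P.geo xs x with hγ
  set η := momentum P.Mc γ with hη
  set T := ContinuousLinearMap.adjoint P.B with hT
  -- Each covector splits as `η = (η - R T η) + R T η` with the first part in `ker Bᵀ`.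
  obtain ⟨R, hR⟩ := exists_ker_decomposition T
  have hηc : ContinuousOn η (Icc 0 1) := fun s hs =>
    (hS.hasDerivAt_geo_momentum hxs hx hs).continuousAt.continuousWithinAt
  have hDWc : ContinuousOn (fun s => fderiv ℝ P.Wc (γ s)) (Icc 0 1) :=
    (hS.contDiffOn_Wc.continuousOn_fderiv_of_isOpen hS.open_X (by simp)).comp
      (hS.geodesic xs hxs x hx).1.1.continuous.continuousOn fun s hs => hS.geo_mem hxs hx hs
  obtain ⟨C₁, hC₁⟩ := isCompact_Icc.exists_bound_of_continuousOn hηc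
  obtain ⟨C₂, hC₂⟩ := isCompact_Icc.exists_bound_of_continuousOn
    (E := Vec nx →L[ℝ] Op nx) hDWc
  have hC₁0 : 0 ≤ C₁ := (norm_nonneg _).trans (hC₁ 0 (by simp))
  have hC₂0 : 0 ≤ C₂ := (norm_nonneg _).trans (hC₂ 0 (by simp))
  have hker : ∀ s ∈ Icc (0 : ℝ) 1, ∀ v w, T v = 0 → T w = 0 → ∀ u,
      inner ℝ v (fderiv ℝ P.Wc (γ s) (P.B u) w) = 0 := by
    intro s hs v w hv hw u
    have hlin : (innerₛₗ ℝ v) ∘ₗ ((ContinuousLinearMap.apply ℝ (Vec nx) w : Op nx →ₗ[ℝ] Vec nx) ∘ₗ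
        (fderiv ℝ P.Wc (γ s) : Vec nx →ₗ[ℝ] Op nx) ∘ₗ (P.B : Vec nu →ₗ[ℝ] Vec nx)) = 0 := by
      refine (EuclideanSpace.basisFun (Fin nu) ℝ).toBasis.ext fun j => ?_
      simpa using (hCCM _ (hDc s hs)).2 j v w hv hw
    exact LinearMap.congr_fun hlin u
  set K : ℝ := C₂ * ‖P.B‖ * (((1 + ‖R‖ * ‖T‖) * C₁) * ‖R‖ + ‖R‖ * C₁) with hK
  -- With `u = T η'`, the Hamiltonian equation gives `2 ‖u‖² = -⟨η, S η⟩` for `S = ∂_{Bu} W`. The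
  -- strong condition removes the part of this form on `ker Bᵀ`; every remaining term carries a
  -- factor `T η`, and `S` supplies one factor `‖u‖` to cancel.
  have hbound : ∀ s ∈ Icc (0 : ℝ) 1, ‖T (momentumDeriv P.Mc γ s)‖ ≤ K * ‖T (η s)‖ := by
    intro s hs
    set u := T (momentumDeriv P.Mc γ s) with hu
    set S := fderiv ℝ P.Wc (γ s) (P.B u) with hSdef
    have e1 : ‖u‖ ^ 2 = inner ℝ (P.B u) (momentumDeriv P.Mc γ s) := by
      rw [← ContinuousLinearMap.adjoint_inner_right, ← hT, ← hu, real_inner_self_eq_norm_sq]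
    have e2 := hS.inner_momentumDeriv hxs hx hs (P.B u)
    rw [← hγ, ← hη, ← e1, ← hSdef] at e2
    have e3 : inner ℝ (η s) (S (η s)) = inner ℝ (η s - R (T (η s))) (S (R (T (η s))))
        + inner ℝ (R (T (η s))) (S (η s)) := by
      have h0 := hker s hs _ _ (hR (η s)) (hR (η s)) u
      rw [← hSdef, map_sub, inner_sub_right] at h0
      simp only [inner_sub_left] at h0 ⊢
      linarith
    have nS : ‖S‖ ≤ C₂ * ‖P.B‖ * ‖u‖ := by
      calc ‖S‖ ≤ ‖fderiv ℝ P.Wc (γ s)‖ * ‖P.B u‖ := ContinuousLinearMap.le_opNorm _ _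
        _ ≤ C₂ * (‖P.B‖ * ‖u‖) := by
          gcongr
          · exact hC₂ s hs
          · exact P.B.le_opNorm u
        _ = _ := by ring
    have nη := hC₁ s hs
    have nR : ‖R (T (η s))‖ ≤ ‖R‖ * ‖T (η s)‖ := R.le_opNorm _
    have nA : ‖η s - R (T (η s))‖ ≤ (1 + ‖R‖ * ‖T‖) * C₁ := by
      calc ‖η s - R (T (η s))‖ ≤ ‖η s‖ + ‖R (T (η s))‖ := norm_sub_le _ _
        _ ≤ ‖η s‖ + ‖R‖ * (‖T‖ * ‖η s‖) := by
          gcongr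
          exact nR.trans (by gcongr; exact T.le_opNorm _)
        _ = (1 + ‖R‖ * ‖T‖) * ‖η s‖ := by ring
        _ ≤ _ := by gcongr
    have b1 : |inner ℝ (η s - R (T (η s))) (S (R (T (η s))))|
        ≤ ((1 + ‖R‖ * ‖T‖) * C₁) * ((C₂ * ‖P.B‖ * ‖u‖) * (‖R‖ * ‖T (η s)‖)) := by
      refine (abs_real_inner_le_norm _ _).trans ?_
      gcongr
      exact (S.le_opNorm _).trans (by gcongr)
    have b2 : |inner ℝ (R (T (η s))) (S (η s))|
        ≤ (‖R‖ * ‖T (η s)‖) * ((C₂ * ‖P.B‖ * ‖u‖) * C₁) := by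
      refine (abs_real_inner_le_norm _ _).trans ?_
      gcongr
      exact (S.le_opNorm _).trans (by gcongr)
    rw [e3] at e2
    have b3 : ‖u‖ * ‖u‖ ≤ (K * ‖T (η s)‖) * ‖u‖ := by
      have a1 := (abs_le.1 b1).1
      have a2 := (abs_le.1 b2).1
      have a3 : (K * ‖T (η s)‖) * ‖u‖
          = ((1 + ‖R‖ * ‖T‖) * C₁) * ((C₂ * ‖P.B‖ * ‖u‖) * (‖R‖ * ‖T (η s)‖))
            + (‖R‖ * ‖T (η s)‖) * ((C₂ * ‖P.B‖ * ‖u‖) * C₁) := by rw [hK]; ring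
      nlinarith [sq_nonneg ‖u‖]
    rcases (norm_nonneg u).eq_or_lt with h | h
    · rw [← h]; positivity
    · exact le_of_mul_le_mul_right b3 h
  -- Time is reversed, since the vanishing is known at the end point `1` and Grönwall runs forward.
  have hmem : ∀ t ∈ Icc (0 : ℝ) 1, 1 - t ∈ Icc (0 : ℝ) 1 := fun t ht =>
    ⟨by linarith [ht.2], by linarith [ht.1]⟩
  have hder : ∀ t ∈ Icc (0 : ℝ) 1, HasDerivAt (fun t => T (η (1 - t)))
      (-T (momentumDeriv P.Mc γ (1 - t))) t := fun t ht => by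
    have h := T.hasFDerivAt.comp_hasDerivAt (1 - t)
      (hS.hasDerivAt_geo_momentum hxs hx (hmem t ht))
    simpa using! h.scomp t ((hasDerivAt_id t).const_sub 1)
  have hz := eq_zero_of_abs_deriv_le_mul_abs_self_of_eq_zero_right (K := K)
    (f := fun t => T (η (1 - t))) (a := 0) (b := 1)
    (fun t ht => (hder t ht).continuousAt.continuousWithinAt)
    (fun t ht => (hder t (Ico_subset_Icc_self ht)).hasDerivWithinAt) (by simpa using h1)
    (fun t ht => by
      rw [norm_neg]
      exact hbound _ (hmem t (Ico_subset_Icc_self ht))) (1 - s) (hmem s hs)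
  simpa using hz

/-- Along a geodesic whose momentum is annihilated by `Bᵀ`, the drift contracts. -/
lemma drift_contracts (hCCM : P.IsCCM) (hDc : ∀ s ∈ Icc (0 : ℝ) 1, P.geo xs x s ∈ P.Dc)
    (h0 : ∀ s ∈ Icc (0 : ℝ) 1, ContinuousLinearMap.adjoint P.B (momentum P.Mc (P.geo xs x) s) = 0) :
    inner ℝ (momentum P.Mc (P.geo xs x) 1) (P.f x) - inner ℝ (momentum P.Mc (P.geo xs x) 0) (P.f xs)
      ≤ -P.lamc * P.distC xs x ^ 2 := by
  have hgeo := hS.geodesic xs hxs x hx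
  set γ := P.geo xs x with hγ
  set η := momentum P.Mc γ with hη
  have hf : ∀ s ∈ Icc (0 : ℝ) 1,
      HasDerivAt (fun s => P.f (γ s)) (fderiv ℝ P.f (γ s) (deriv γ s)) s := fun s hs =>
    (((hS.smooth_f.contDiffAt (hS.open_X.mem_nhds (hS.geo_mem hxs hx hs))).differentiableAt
      (by simp)).hasFDerivAt).comp_hasDerivAt s (hgeo.1.1.differentiable (by simp) s).hasDerivAt
  have hψ : ∀ s ∈ Icc (0 : ℝ) 1, HasDerivAt (fun s => inner ℝ (η s) (P.f (γ s)))
      (inner ℝ (η s) (fderiv ℝ P.f (γ s) (deriv γ s))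
        + inner ℝ (momentumDeriv P.Mc γ s) (P.f (γ s))) s := fun s hs =>
    (hS.hasDerivAt_geo_momentum hxs hx hs).inner ℝ (hf s hs)
  have hle : ∀ s ∈ Icc (0 : ℝ) 1, inner ℝ (η s) (fderiv ℝ P.f (γ s) (deriv γ s))
      + inner ℝ (momentumDeriv P.Mc γ s) (P.f (γ s)) ≤ -P.lamc * P.distC xs x ^ 2 := by
    intro s hs
    have hsX := hS.geo_mem hxs hx hs
    -- The condition is tested on the momentum, for which `W η = γ'`. By the Hamiltonian equation,
    -- the derivative of `⟨η, f⟩` is half of its first three terms, and the last one is `2 λ_c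
    -- d_c²`.
    have c := (hCCM _ (hDc s hs)).1 (η s) (h0 s hs)
    have m := hS.inner_momentumDeriv hxs hx hs (P.f (γ s))
    rw [← hγ, ← hη] at m
    have w : P.Wc (γ s) (η s) = deriv γ s := hS.Wc_Mc hsX _
    have w' : inner ℝ (η s) (P.Wc (γ s)
        (ContinuousLinearMap.adjoint (fderiv ℝ P.f (γ s)) (η s)))
        = inner ℝ (η s) (fderiv ℝ P.f (γ s) (deriv γ s)) := by
      rw [Wc, (hS.posDef_Mc _ hsX).inner_inverse, ← Wc, w,
        ContinuousLinearMap.adjoint_inner_left]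
    have dd : inner ℝ (η s) (deriv γ s) = P.distC xs x ^ 2 := by
      rw [distC, ← hgeo.2.2 s hs, Real.sq_sqrt ((hS.posDef_Mc _ hsX).quad_nonneg _), hη, momentum,
        real_inner_comm]
      rfl
    simp only [add_apply, neg_apply, smul_apply, ContinuousLinearMap.comp_apply, inner_add_right,
      inner_neg_right, inner_smul_right, w'] at c
    rw [w, dd] at c
    rw [real_inner_comm (P.f (γ s)) (momentumDeriv P.Mc γ s)]
    linarith
  have := (convex_Icc (0 : ℝ) 1).image_sub_le_mul_sub_of_deriv_le
    (f := fun s => inner ℝ (η s) (P.f (γ s)))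
    (fun s hs => (hψ s hs).continuousAt.continuousWithinAt)
    (fun s hs => (hψ s (interior_subset hs)).differentiableAt.differentiableWithinAt)
    (C := -P.lamc * P.distC xs x ^ 2)
    (fun s hs => by rw [(hψ s (interior_subset hs)).deriv]; exact hle s (interior_subset hs))
    0 (by simp) 1 (by simp) zero_le_one
  have e0 : γ 0 = xs := hgeo.1.2.1
  have e1 : γ 1 = x := hgeo.1.2.2.1
  simpa only [e0, e1, sub_zero, mul_one] using this

lemma inner_geo_one (v : Vec nx) :
    inner ℝ (deriv (P.geo xs x) 1) (P.Mc x v) = inner ℝ (momentum P.Mc (P.geo xs x) 1) v := by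
  have h := (hS.geodesic xs hxs x hx).1.2.2.1
  rw [IsSelfAdjoint.inner_apply_comm (hS.posDef_Mc x hx).1, momentum, h, real_inner_comm]

lemma inner_geo_zero (v : Vec nx) :
    inner ℝ (deriv (P.geo xs x) 0) (P.Mc xs v) = inner ℝ (momentum P.Mc (P.geo xs x) 0) v := by
  have h := (hS.geodesic xs hxs x hx).1.2.1
  rw [IsSelfAdjoint.inner_apply_comm (hS.posDef_Mc xs hxs).1, momentum, h, real_inner_comm]

/-- The constraint on `k` is affine with normal `a = Bᵀ M γ'(1)`. If `a ≠ 0` it defines a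
half-space. If `a = 0`, the momentum is annihilated by `Bᵀ` along the whole geodesic, the nominal
input drops out at both ends, and contraction of the drift makes `k = 0` feasible. -/
lemma Ufeas_nonempty (hCCM : P.IsCCM) (hDc : ∀ s ∈ Icc (0 : ℝ) 1, P.geo xs x s ∈ P.Dc)
    (us : Vec nu) : (P.Ufeas x xs us).Nonempty := by
  set a := ContinuousLinearMap.adjoint P.B (momentum P.Mc (P.geo xs x) 1) with ha
  have hB : ∀ u, inner ℝ (momentum P.Mc (P.geo xs x) 1) (P.B u) = inner ℝ a u := fun u =>
    (ContinuousLinearMap.adjoint_inner_left _ _ _).symm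
  by_cases h : a = 0
  · have h0 := fun s hs => hS.adjoint_momentum_eq_zero hxs hx hCCM hDc h (s := s) hs
    have hd := hS.drift_contracts hxs hx hCCM hDc h0
    refine ⟨0, ?_⟩
    have hB0 : inner ℝ (momentum P.Mc (P.geo xs x) 0) (P.B us) = 0 := by
      rw [← ContinuousLinearMap.adjoint_inner_left, h0 0 (by simp), inner_zero_left]
    rw [Ufeas, mem_ofPred_eq, hS.inner_geo_one hxs hx, hS.inner_geo_zero hxs hx, inner_add_right,
      inner_add_right, hB, hB0, h, inner_zero_left, add_zero, add_zero]
    exact hd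
  · set c := inner ℝ (momentum P.Mc (P.geo xs x) 1) (P.f x + P.B us)
      - inner ℝ (momentum P.Mc (P.geo xs x) 0) (P.f xs + P.B us) + P.lamc * P.distC xs x ^ 2
      with hc
    -- A multiple of the normal that attains equality in the constraint.
    refine ⟨-(c / ‖a‖ ^ 2) • a, ?_⟩
    have hn : ‖a‖ ^ 2 ≠ 0 := by simpa using h
    rw [Ufeas, mem_ofPred_eq, hS.inner_geo_one hxs hx, hS.inner_geo_zero hxs hx, map_add, ← add_assoc,
      inner_add_right, hB, inner_smul_right, real_inner_self_eq_norm_sq, neg_mul,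
      div_mul_cancel₀ _ hn, hc]
    linarith

omit hS hxs hx in
lemma isClosed_Ufeas (us : Vec nu) : IsClosed (P.Ufeas x xs us) := by
  refine isClosed_le ?_ continuous_const
  fun_prop

lemma le_gain (v : Vec nu) : √(quad (P.Mc x) (P.B v)) ≤ P.gain x xs v := by
  have hgeo := hS.geodesic xs hxs x hx
  have hcont : ContinuousOn (fun s => √(quad (P.Mc (P.geo xs x s)) (P.B v))) (Icc 0 1) :=
    (continuous_quad_comp (hS.continuousOn_Mc.comp hgeo.1.1.continuous.continuousOn hgeo.1.2.2.2)
      continuousOn_const).sqrt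
  refine le_csSup (isCompact_Icc.image_of_continuousOn hcont).bddAbove ⟨1, by simp, ?_⟩
  simp only [hgeo.1.2.2.1]

omit hS hxs hx in
lemma gain_zero : P.gain x xs 0 = 0 := by
  have : (fun s => √(quad (P.Mc (P.geo xs x s)) (P.B 0))) = fun _ => 0 := by
    funext s
    simp [quad]
  rw [gain, this, Set.Nonempty.image_const ⟨0, by simp⟩, csSup_singleton]

/-- The closed loop with the feedback at the estimate contracts up to the estimation error and the
disturbance. -/
lemma closedLoop_contracts (hCCM : P.IsCCM) (hLk : P.ValidLk)
    (hDc : ∀ s ∈ Icc (0 : ℝ) 1, P.geo xs x s ∈ P.Dc) (hDx : xs ∈ P.Dx) {us : Vec nu}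
    (hus : us ∈ P.U) (hc : P.distC xs x ≤ P.cBar) {z : Vec nx} (hz : z ∈ P.X)
    (he : P.distE x z ≤ P.eBar) {k : Vec nu} (hk : IsMinNorm (P.Ufeas z xs us) k) (ζ : Vec nx) :
    inner ℝ (deriv (P.geo xs x) 1) (P.Mc x (P.f x + P.B (us + k) + ζ))
      - inner ℝ (deriv (P.geo xs x) 0) (P.Mc xs (P.f xs + P.B us))
      ≤ P.distC xs x * (-P.lamc * P.distC xs x + P.Lk * P.distE x z + √P.mcHi * ‖ζ‖) := by
  have hgeo := hS.geodesic xs hxs x hx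
  have hne := hS.Ufeas_nonempty hxs hx hCCM hDc us
  have hcl := isClosed_Ufeas (P := P) (xs := xs) (x := x) us
  obtain ⟨l, hl⟩ := exists_closest hcl hne k
  -- The minimum norm feedback `m` at the true state is its own closest feasible point, so the
  -- controller error vanishes there. Comparing the estimate with the true state bounds the error by
  -- `Lk * d_e`.
  obtain ⟨m, hm⟩ := exists_closest hcl hne 0
  have hm' : IsMinNorm (P.Ufeas x xs us) m := ⟨hm.1, fun v hv => by simpa using hm.2 v hv⟩
  have hmm : IsClosest (P.Ufeas x xs us) m m := ⟨hm.1, fun v _ => by simp⟩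
  have hxx : P.distE x x = 0 := by rw [hS.distE_eq]; simp [quad]
  have hL := hLk xs hDx us hus x hx hc z hz x hx he (hxx.trans_le ((distE_nonneg _ _).trans he))
    k m l m hk hm' hl hmm
  rw [sub_self, gain_zero, sub_zero, hS.distE_comm z x] at hL
  have hg := (hS.le_gain hxs hx (k - l)).trans ((le_abs_self _).trans hL)
  have hd : √(quad (P.Mc x) (deriv (P.geo xs x) 1)) = P.distC xs x := by
    have := hgeo.2.2 1 (by simp)
    rwa [hgeo.1.2.2.1] at this
  have i1 := (hS.posDef_Mc x hx).inner_le (deriv (P.geo xs x) 1) (P.B (k - l))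
  have i2 := (hS.posDef_Mc x hx).inner_le (deriv (P.geo xs x) 1) ζ
  rw [hd] at i1 i2
  have hxDc : x ∈ P.Dc := by
    have := hDc 1 (by simp)
    rwa [hgeo.1.2.2.1] at this
  have hζ := sqrt_quad_le_of_quad_le (hS.eig_Mc x hxDc ζ).2
  have hfe : inner ℝ (deriv (P.geo xs x) 1) (P.Mc x (P.f x + P.B (us + l)))
      - inner ℝ (deriv (P.geo xs x) 0) (P.Mc xs (P.f xs + P.B us))
      ≤ -P.lamc * P.distC xs x ^ 2 := hl.1
  have hsplit : P.f x + P.B (us + k) + ζ = P.f x + P.B (us + l) + P.B (k - l) + ζ := by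
    simp only [map_add, map_sub]; abel
  rw [hsplit, map_add, map_add, inner_add_right, inner_add_right]
  have d0 : 0 ≤ P.distC xs x := distC_nonneg _ _
  have j1 := mul_le_mul_of_nonneg_left hg d0
  have j2 := mul_le_mul_of_nonneg_left hζ d0
  nlinarith

end Geodesic

/-- Differential inequality for the tracking distance. -/
lemma deriv_distC_le (hCCM : P.IsCCM) (hLk : P.ValidLk) {p x : ℝ → Vec nx} {t D' : ℝ} {us k : Vec nu}
    {z ζ : Vec nx} (hp : p t ∈ P.X) (hx : x t ∈ P.X)
    (hDc : ∀ s ∈ Icc (0 : ℝ) 1, P.geo (p t) (x t) s ∈ P.Dc) (hDx : p t ∈ P.Dx)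
    (hus : us ∈ P.U) (hc : P.distC (p t) (x t) ≤ P.cBar) (hz : z ∈ P.X)
    (he : P.distE (x t) z ≤ P.eBar) (hk : IsMinNorm (P.Ufeas z (p t) us) k) (hζ : ‖ζ‖ ≤ P.wxBar)
    (hpd : HasDerivAt p (P.f (p t) + P.B us) t)
    (hxd : HasDerivAt x (P.f (x t) + P.B (us + k) + ζ) t)
    (hD : HasDerivAt (fun s => P.distC (p s) (x s)) D' t) :
    D' ≤ P.rhsC (P.distC (p t) (x t)) (P.distE (x t) z) := by
  have hgeo := hS.geodesic _ hp _ hx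
  have hζ' : √P.mcHi * ‖ζ‖ ≤ √P.mcHi * P.wxBar := by gcongr
  -- At distance zero the first variation carries no information, but a nonnegative function has
  -- derivative zero at a zero. Otherwise the distance can be divided out.
  rcases (distC_nonneg (P := P) (p t) (x t)).eq_or_lt with h | h
  · have hmin : IsLocalMin (fun s => P.distC (p s) (x s)) t :=
      Eventually.of_forall fun s => h.symm.le.trans (distC_nonneg _ _)
    rw [hmin.hasDerivAt_eq_zero hD, rhsC, ← h, mul_zero, zero_add]
    have h1 := mul_nonneg hS.Lk_nonneg (distE_nonneg (P := P) (x t) z)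
    have h2 : 0 ≤ √P.mcHi * P.wxBar := le_trans (by positivity) hζ'
    linarith
  · have h1 := hgeo.riemDist_mul_deriv hS.open_X hS.smooth_Mc hS.posDef_Mc hS.connected hpd hxd hD
    have h2 := hS.closedLoop_contracts hp hx hCCM hLk hDc hDx hus hc hz he hk ζ
    rw [← h1] at h2
    have h3 := le_of_mul_le_mul_left h2 h
    rw [rhsC]
    linarith

end Setting

end Problem

end CORRT

namespace CORRT

open Filter Topology

namespace Problem

variable {nx nu nwx ny nwy np nr N : ℕ} {P : Problem nx nu nwx ny nwy np nr N}

lemma norm_Cr_le (v : Vec nx) : ‖P.Cr v‖ ≤ ‖v‖ := by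
  refine le_of_sq_le_sq ?_ (norm_nonneg _)
  rw [EuclideanSpace.norm_sq_eq, EuclideanSpace.norm_sq_eq]
  have h : ∑ i, ‖P.Cr v i‖ ^ 2 = ∑ j ∈ Finset.univ.map P.sel, ‖v j‖ ^ 2 := by
    rw [Finset.sum_map]
    rfl
  rw [h]
  exact Finset.sum_le_sum_of_subset_of_nonneg (Finset.subset_univ _) fun _ _ _ => by positivity

lemma percErr_nonneg (x : Vec nx) (θ' : Vec np) : 0 ≤ P.percErr x θ' := norm_nonneg _

namespace Setting

variable (hS : P.Setting)

include hS

/-! ### The observer -/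

/-- Mean value inequality along the segment, with half of the observer condition as derivative
bound. The term with `rho` is left for the innovation to cancel. -/
lemma inner_We_drift_le (hOCM : P.IsOCM) {x z : Vec nx} (hseg : segment ℝ x z ⊆ P.De) :
    inner ℝ (z - x) (P.We (P.f z - P.f x))
      ≤ P.rho / 2 * ‖P.Cr (z - x)‖ ^ 2 - P.lame * quad P.We (z - x) := by
  set v := z - x with hv
  have hmem : ∀ s ∈ Icc (0 : ℝ) 1, x + s • v ∈ P.De := fun s hs => hseg (by
    rw [segment_eq_image']
    exact ⟨s, hs, rfl⟩)
  have hline : ∀ s : ℝ, HasDerivAt (fun s : ℝ => x + s • v) v s := fun s => by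
    simpa using ((hasDerivAt_id s).smul_const v).const_add x
  have hd : ∀ s ∈ Icc (0 : ℝ) 1, HasDerivAt (fun s : ℝ => inner ℝ v (P.We (P.f (x + s • v))))
      (inner ℝ v (P.We (fderiv ℝ P.f (x + s • v) v))) s := fun s hs => by
    have h1 := ((hS.smooth_f.contDiffAt (hS.open_X.mem_nhds (hS.De_sub (hmem s hs)))).differentiableAt
      (by simp)).hasFDerivAt.comp_hasDerivAt s (hline s)
    simpa using (hasDerivAt_const s v).inner ℝ (P.We.hasFDerivAt.comp_hasDerivAt s h1)
  have hle : ∀ s ∈ Icc (0 : ℝ) 1, inner ℝ v (P.We (fderiv ℝ P.f (x + s • v) v))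
      ≤ P.rho / 2 * ‖P.Cr v‖ ^ 2 - P.lame * quad P.We v := fun s hs => by
    have h := hOCM _ (hmem s hs) v
    have e1 : inner ℝ v (ContinuousLinearMap.adjoint (fderiv ℝ P.f (x + s • v)) (P.We v))
        = inner ℝ v (P.We (fderiv ℝ P.f (x + s • v) v)) := by
      rw [ContinuousLinearMap.adjoint_inner_right,
        IsSelfAdjoint.inner_apply_comm hS.posDef_We.1]
    simp only [add_apply, sub_apply, smul_apply, ContinuousLinearMap.comp_apply, inner_add_right,
      inner_sub_right, inner_smul_right, e1, ContinuousLinearMap.adjoint_inner_right,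
      real_inner_self_eq_norm_sq] at h
    rw [quad]
    linarith
  have := (convex_Icc (0 : ℝ) 1).image_sub_le_mul_sub_of_deriv_le
    (f := fun s : ℝ => inner ℝ v (P.We (P.f (x + s • v))))
    (fun s hs => (hd s hs).continuousAt.continuousWithinAt)
    (fun s hs => (hd s (interior_subset hs)).differentiableAt.differentiableWithinAt)
    (C := P.rho / 2 * ‖P.Cr v‖ ^ 2 - P.lame * quad P.We v)
    (fun s hs => by rw [(hd s (interior_subset hs)).deriv]; exact hle s (interior_subset hs))
    0 (by simp) 1 (by simp) zero_le_one
  simp only [one_smul, zero_smul, add_zero, sub_zero, mul_one] at this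
  rw [hv, add_sub_cancel, ← hv, ← inner_sub_right, ← map_sub] at this
  exact this

lemma inner_We_Me (v w : Vec nx) : inner ℝ v (P.We (P.Me w)) = inner ℝ v w := by
  rw [We, hS.posDef_Me.inverse_apply]

/-- Differential inequality for the estimation distance. -/
lemma deriv_distE_le (hOCM : P.IsOCM) {x z : ℝ → Vec nx} {t D' ε : ℝ} {b ζ : Vec nx} {g : Vec nr}
    (hseg : segment ℝ (x t) (z t) ⊆ P.De) (hζ : ‖ζ‖ ≤ P.wxBar) (hg : ‖g - P.Cr (x t)‖ ≤ ε)
    (hxd : HasDerivAt x (P.f (x t) + b + ζ) t)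
    (hzd : HasDerivAt z (P.f (z t) + b
      + (P.rho / 2) • P.Me (ContinuousLinearMap.adjoint P.Cr (g - P.Cr (z t)))) t)
    (hD : HasDerivAt (fun s => P.distE (x s) (z s)) D' t) :
    D' ≤ -P.lame * P.distE (x t) (z t) + √P.weHi * P.wxBar + P.rho / 2 * √P.meHi * ε := by
  have hζ' : √P.weHi * ‖ζ‖ ≤ √P.weHi * P.wxBar := by gcongr
  have hρ := hS.rho_nonneg
  have hε : 0 ≤ ε := (norm_nonneg _).trans hg
  rcases (distE_nonneg (P := P) (x t) (z t)).eq_or_lt with h | h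
  · have hmin : IsLocalMin (fun s => P.distE (x s) (z s)) t :=
      Eventually.of_forall fun s => h.symm.le.trans (distE_nonneg _ _)
    rw [hmin.hasDerivAt_eq_zero hD, ← h, mul_zero, zero_add]
    have h2 : 0 ≤ √P.weHi * P.wxBar := le_trans (by positivity) hζ'
    positivity
  set d := P.distE (x t) (z t) with hd
  set v := z t - x t with hv
  have hdv : d = √(quad P.We v) := hS.distE_eq _ _
  have hsq : d ^ 2 = quad P.We v := by rw [hdv, Real.sq_sqrt (hS.posDef_We.quad_nonneg v)]
  have hvd := hzd.sub hxd
  set v' := P.f (z t) + b + (P.rho / 2) • P.Me (ContinuousLinearMap.adjoint P.Cr (g - P.Cr (z t)))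
    - (P.f (x t) + b + ζ) with hv'
  have hq : HasDerivAt (fun s => quad P.We (z s - x s)) (2 * inner ℝ v (P.We v')) t := by
    have h1 := hvd.inner ℝ (P.We.hasFDerivAt.comp_hasDerivAt t hvd)
    refine h1.congr_deriv ?_
    have := IsSelfAdjoint.inner_apply_comm hS.posDef_We.1 v v'
    change inner ℝ v (P.We v') + inner ℝ v' (P.We v) = _
    rw [← this]
    ring
  have hq2 : HasDerivAt (fun s => quad P.We (z s - x s)) (2 * d * D') t := by
    have h1 := hD.pow 2
    have e : (fun s => P.distE (x s) (z s)) ^ 2 = fun s => quad P.We (z s - x s) := by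
      funext s
      simp only [Pi.pow_apply]
      rw [hS.distE_eq, Real.sq_sqrt (hS.posDef_We.quad_nonneg _)]
    rw [e] at h1
    simpa [hd] using h1
  -- Two expressions for the derivative of the squared distance. In the expansion below the common
  -- input `b` drops out, and the gain `½ ρ M_e C_rᵀ` produces exactly `-ρ/2 ‖C_r v‖²`.
  have key := hq2.unique hq
  have hexp : inner ℝ v (P.We v') = inner ℝ v (P.We (P.f (z t) - P.f (x t))) - inner ℝ v (P.We ζ)
      + P.rho / 2 * (inner ℝ (P.Cr v) (g - P.Cr (x t)) - ‖P.Cr v‖ ^ 2) := by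
    have e1 : v' = (P.f (z t) - P.f (x t)) - ζ
        + (P.rho / 2) • P.Me (ContinuousLinearMap.adjoint P.Cr (g - P.Cr (z t))) := by
      rw [hv']; abel
    have e2 : g - P.Cr (z t) = g - P.Cr (x t) - P.Cr v := by rw [hv, map_sub]; abel
    rw [e1, map_add, map_sub, map_smul, inner_add_right, inner_sub_right, inner_smul_right,
      hS.inner_We_Me, ContinuousLinearMap.adjoint_inner_right, e2, inner_sub_right,
      real_inner_self_eq_norm_sq]
  have b1 := hS.inner_We_drift_le hOCM hseg
  rw [← hv, ← hsq] at b1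
  have b2 := (abs_le.1 (hS.posDef_We.abs_inner_le v ζ)).1
  rw [← hdv] at b2
  have b3 : d * √(quad P.We ζ) ≤ d * (√P.weHi * P.wxBar) := by
    gcongr
    exact (sqrt_quad_le_of_quad_le (hS.eig_We ζ)).trans hζ'
  have b4 : inner ℝ (P.Cr v) (g - P.Cr (x t)) ≤ d * (√P.meHi * ε) := by
    calc inner ℝ (P.Cr v) (g - P.Cr (x t)) ≤ ‖P.Cr v‖ * ‖g - P.Cr (x t)‖ := real_inner_le_norm _ _
      _ ≤ (√P.meHi * d) * ε := by
        gcongr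
        refine (norm_Cr_le v).trans ?_
        rw [hdv]
        exact hS.posDef_Me.norm_le_of_quad_le hS.eig_Me v
      _ = _ := by ring
  have b5 := mul_le_mul_of_nonneg_left b4 (div_nonneg hρ zero_le_two)
  have hfin : d * D' ≤ d * (-P.lame * d + √P.weHi * P.wxBar + P.rho / 2 * √P.meHi * ε) := by
    nlinarith
  exact le_of_mul_le_mul_left hfin h

/-! ### The perception error -/

lemma data_mem_Dr (i : Fin N) : (P.data i).fst ∈ P.Dr :=
  ⟨hS.Dp_sub (hS.data_mem i).1, _, (hS.data_mem i).1, rfl⟩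

/-- The noisy perception error. -/
lemma norm_perception_le (hLh : P.ValidLh) {x : Vec nx} (hx : x ∈ P.Dr) {w : Vec nwy}
    (hw : ‖w‖ ≤ P.wyBar) :
    ‖P.hinv (P.h x P.θ + P.By w) P.θ - P.Cr x‖
      ≤ P.Lh * ‖P.By‖ * P.wyBar + P.percErr x P.θ := by
  have h0 : 0 ≤ P.wyBar := (norm_nonneg _).trans hw
  have hy : ∀ w : Vec nwy, ‖w‖ ≤ P.wyBar → P.h x P.θ + P.By w ∈ P.noisyObs := fun w hw =>
    Set.add_mem_add ⟨x, hx, P.θ, hS.θ_mem, rfl⟩ ⟨w, hw, rfl⟩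
  have hl := hLh _ (hy w hw) _ (hy 0 (by simpa using h0)) P.θ hS.θ_mem
  rw [map_zero, add_zero, add_sub_cancel_left] at hl
  calc ‖P.hinv (P.h x P.θ + P.By w) P.θ - P.Cr x‖
      ≤ ‖P.hinv (P.h x P.θ + P.By w) P.θ - P.hinv (P.h x P.θ) P.θ‖
        + ‖P.hinv (P.h x P.θ) P.θ - P.Cr x‖ := norm_sub_le_norm_sub_add_norm_sub _ _ _
    _ ≤ P.Lh * ‖P.By w‖ + P.percErr x P.θ := add_le_add hl le_rfl
    _ ≤ P.Lh * (‖P.By‖ * P.wyBar) + P.percErr x P.θ := by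
      have := hS.Lh_nonneg
      gcongr
      exact (P.By.le_opNorm w).trans (by gcongr)
    _ = _ := by ring

/-- Serves the nonnegativity of the tubes. In the uniform case a datapoint supplies a state of `Dr`,
at which `eps1` dominates an actual error. -/
lemma errLevel_nonneg {κ : BoundKind} (hB : P.ValidBound κ) {p : Vec nx} {r e : ℝ}
    (he : P.IsErrLevel κ p r e) : 0 ≤ e := by
  cases κ with
  | uniform =>
    exact (percErr_nonneg _ _).trans ((hB _ (hS.data_mem_Dr ⟨0, hS.data_pos⟩) _ hS.θ_mem).trans he)
  | lipschitz =>
    refine le_trans (Real.iInf_nonneg fun i => ?_) he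
    exact add_nonneg (mul_nonneg hB.1 dist_nonneg) (percErr_nonneg _ _)
  | dispersed =>
    refine le_trans (add_nonneg (mul_nonneg hB.1 hB.2.1) (Real.sSup_nonneg ?_)) he.2
    rintro _ ⟨i, -, rfl⟩
    exact percErr_nonneg _ _

omit hS in
lemma coupling_nonneg (hρ : 0 ≤ P.rho) {κ : BoundKind} (hB : P.ValidBound κ) : 0 ≤ P.coupling κ := by
  cases κ with
  | uniform => exact le_rfl
  | lipschitz =>
    have := hB.1
    rw [coupling]
    positivity
  | dispersed => exact le_rfl

omit hS in
lemma dist_pair (x y : Vec nx) (θ' : Vec np) :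
    dist (WithLp.toLp 2 (x, θ')) (WithLp.toLp 2 (y, θ')) = ‖x - y‖ := by
  rw [WithLp.prod_dist_eq_of_L2]
  simp [dist_eq_norm]

/-- The dispersion bound for the perception error inside a tube section. -/
lemma percErr_le_of_mem_tubeC (hB : P.ValidBound .dispersed) {p : Vec nx} {r e : ℝ}
    (he : P.IsErrLevel .dispersed p r e) (hp : p ∈ P.Dx) (hr : 0 ≤ r) (hrc : r ≤ P.cBar)
    (htube : P.tubeC p r ⊆ P.Dc ∩ P.Dr) {y : Vec nx} (hy : y ∈ P.tubeC p r) :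
    P.percErr y P.θ ≤ e := by
  obtain ⟨hLp0, hR0, hLp, hR⟩ := hB
  obtain ⟨hdata, hle⟩ := he
  have hdisp := hR p hp r hr hrc htube hdata
  set Ω := P.tubeC p r with hΩ
  have hη : 0 ≤ P.etaStar Ω := by
    refine Real.sInf_nonneg ?_
    rintro _ ⟨i, -, rfl⟩
    exact dist_nonneg
  have hyDr : y ∈ P.Dr := (htube hy).2
  set ζ : WithLp 2 (Vec nx × Vec np) := WithLp.toLp 2 (y, P.θ) with hζ
  have hζB : ζ ∈ P.buffered Ω := ⟨hy, by simpa [hζ] using hη, hyDr, hS.θ_mem⟩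
  have hinf : ⨅ a ∈ range P.data ∩ P.buffered Ω, edist ζ a ≤ ENNReal.ofReal P.R :=
    (le_iSup₂ (f := fun z (_ : z ∈ P.buffered Ω) => ⨅ a ∈ range P.data ∩ P.buffered Ω, edist z a)
      ζ hζB).trans hdisp
  have hfin : (range P.data ∩ P.buffered Ω).Finite := (finite_range P.data).inter_of_left _
  -- An infimum over the empty set would be `⊤`, which a finite dispersion bound excludes; hence a
  -- nearest datapoint exists.
  have hne : (range P.data ∩ P.buffered Ω).Nonempty := by
    by_contra hemp
    rw [not_nonempty_iff_eq_empty] at hemp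
    simp [hemp] at hinf
  obtain ⟨a, ⟨⟨i, rfl⟩, haB⟩, hmin⟩ := exists_min_image _ (fun a => edist ζ a) hfin hne
  have hdist : dist ζ (P.data i) ≤ P.R := by
    have h1 : edist ζ (P.data i) ≤ ENNReal.ofReal P.R := (le_iInf₂ hmin).trans hinf
    rwa [edist_dist, ENNReal.ofReal_le_ofReal_iff hR0] at h1
  have hlip := hLp y hyDr _ (hS.data_mem_Dr i) P.θ hS.θ_mem _ (hS.data_mem i).2
  have hlip' : |P.percErr y P.θ - P.trainErr i| ≤ P.Lp * dist ζ (P.data i) := hlip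
  have hsup : P.trainErr i ≤ sSup {a | ∃ i, P.data i ∈ P.buffered Ω ∧ a = P.trainErr i} := by
    refine le_csSup ((finite_range P.trainErr).subset ?_).bddAbove ⟨i, haB, rfl⟩
    rintro _ ⟨j, -, rfl⟩
    exact ⟨j, rfl⟩
  have h1 := (le_abs_self _).trans hlip'
  have h2 := mul_le_mul_of_nonneg_left hdist hLp0
  linarith

/-- The perception error at a state near the tube section. -/
lemma percErr_le {κ : BoundKind} (hB : P.ValidBound κ) {p : Vec nx} {r e : ℝ}
    (he : P.IsErrLevel κ p r e) (hp : p ∈ P.Dx) (hr : 0 ≤ r) (hrc : r ≤ P.cBar)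
    (htube : P.tubeC p r ⊆ P.Dc ∩ P.Dr) {x : Vec nx} (hx : x ∈ P.Dr)
    (hDc : ∀ s ∈ Icc (0 : ℝ) 1, P.geo p x s ∈ P.Dc) :
    P.rho / 2 * √P.meHi * P.percErr x P.θ ≤ P.coupling κ * P.distC p x + P.rho / 2 * √P.meHi * e
      + P.rho / 2 * √P.meHi * (|P.Lp| / √P.mcLo) * max (P.distC p x - r) 0 := by
  have hρ := hS.rho_nonneg
  have hm := hS.mcLo_pos
  have hm' : 0 < √P.mcLo := Real.sqrt_pos.2 hm
  have hpX : p ∈ P.X := hp.1.1.1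
  have hgeo := hS.geodesic p hpX x hx.1
  set d := P.distC p x with hd
  have hd0 : 0 ≤ d := distC_nonneg _ _
  have hnear : ∀ s ∈ Icc (0 : ℝ) 1, ‖x - P.geo p x s‖ ≤ (1 - s) * d / √P.mcLo := fun s hs =>
    hgeo.norm_sub_le hm (fun s hs v => (hS.eig_Mc _ (hDc s hs) v).1) hs
  -- The absolute value makes this term nonnegative for every bound kind; the uniform bound does not
  -- constrain the sign of `Lp`.
  have hrest : 0 ≤ P.rho / 2 * √P.meHi * (|P.Lp| / √P.mcLo) * max (d - r) 0 :=
    mul_nonneg (by positivity) (le_max_right _ _)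
  have hc : 0 ≤ P.rho / 2 * √P.meHi := by positivity
  cases κ with
  | uniform =>
    have h1 := mul_le_mul_of_nonneg_left ((hB x hx P.θ hS.θ_mem).trans he) hc
    simp only [coupling, zero_mul, zero_add]
    linarith
  | lipschitz =>
    obtain ⟨hLp0, hLp⟩ := hB
    have : Nonempty (Fin N) := ⟨⟨0, hS.data_pos⟩⟩
    obtain ⟨i, hi⟩ := exists_eq_ciInf_of_finite
      (f := fun i => P.Lp * dist (WithLp.toLp 2 (p, P.θ)) (P.data i) + P.trainErr i)
    have he' : P.Lp * dist (WithLp.toLp 2 (p, P.θ)) (P.data i) + P.trainErr i ≤ e := hi.trans_le he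
    have hlip : |P.percErr x P.θ - P.trainErr i| ≤ P.Lp * dist (WithLp.toLp 2 (x, P.θ)) (P.data i) :=
      hLp x hx _ (hS.data_mem_Dr i) P.θ hS.θ_mem _ (hS.data_mem i).2
    have h0 := hnear 0 (by simp)
    rw [hgeo.1.2.1, sub_zero, one_mul] at h0
    have htri : dist (WithLp.toLp 2 (x, P.θ)) (P.data i)
        ≤ d / √P.mcLo + dist (WithLp.toLp 2 (p, P.θ)) (P.data i) := by
      refine (dist_triangle _ (WithLp.toLp 2 (p, P.θ)) _).trans ?_
      rw [dist_pair]
      gcongr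
    have h1 := (le_abs_self _).trans hlip
    have h2 := mul_le_mul_of_nonneg_left htri hLp0
    have h3 : P.percErr x P.θ ≤ P.Lp * (d / √P.mcLo) + e := by linarith
    have h4 := mul_le_mul_of_nonneg_left h3 hc
    have h5 : P.rho / 2 * √P.meHi * (P.Lp * (d / √P.mcLo)) = P.coupling .lipschitz * d := by
      rw [coupling, Real.sqrt_div' _ hm.le]
      field_simp
    rw [mul_add, h5] at h4
    linarith
  | dispersed =>
    have hLp0 := hB.1
    simp only [coupling, zero_mul, zero_add]
    -- The dispersion bound holds only inside the tube. A state outside is compared with the point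
    -- of the geodesic at parameter `r / d`, which lies in the tube at Euclidean distance at most
    -- `(d - r) / √mcLo`. The comparison principle absorbs this excess.
    have key : P.percErr x P.θ ≤ e + |P.Lp| / √P.mcLo * max (d - r) 0 := by
      rcases le_or_gt d r with hdr | hdr
      · have h1 := hS.percErr_le_of_mem_tubeC hB he hp hr hrc htube (y := x) ⟨hx.1, hdr⟩
        have : 0 ≤ |P.Lp| / √P.mcLo * max (d - r) 0 := mul_nonneg (by positivity) (le_max_right _ _)
        linarith
      · have hdpos : 0 < d := hr.trans_lt hdr
        have hs : r / d ∈ Icc (0 : ℝ) 1 := ⟨by positivity, (div_le_one hdpos).2 hdr.le⟩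
        have hmem : P.geo p x (r / d) ∈ P.tubeC p r := by
          refine ⟨hgeo.1.2.2.2 _ hs, (hgeo.riemDist_le hS.continuousOn_Mc hs).trans (le_of_eq ?_)⟩
          exact div_mul_cancel₀ _ hdpos.ne'
        have h1 := hS.percErr_le_of_mem_tubeC hB he hp hr hrc htube hmem
        have h2 := hB.2.2.1 x hx _ (htube hmem).2 P.θ hS.θ_mem P.θ hS.θ_mem
        rw [dist_pair] at h2
        have h3 := hnear _ hs
        have h4 : (1 - r / d) * d / √P.mcLo = (d - r) / √P.mcLo := by
          field_simp
        rw [h4] at h3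
        have h5 := (le_abs_self _).trans (h2.trans (mul_le_mul_of_nonneg_left h3 hLp0))
        rw [max_eq_left (by linarith), abs_of_nonneg hLp0]
        have h6 : P.Lp * ((d - r) / √P.mcLo) = P.Lp / √P.mcLo * (d - r) := by ring
        linarith
    have h4 := mul_le_mul_of_nonneg_left key hc
    linarith

end Setting

end Problem

end CORRT

namespace CORRT

open Filter Topology

/-! ### Tubes, planner checks and continuation in time -/

lemma geodesicallyConnected_univ_const {n : ℕ} {Q : Op n} (hQ : IsPosDefOp Q) :
    GeodesicallyConnected univ (fun _ => Q) := by
  intro p _ q _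
  refine ⟨_, segment_mem_curves (subset_univ _), ?_, fun s _ => ?_⟩
  · rw [riemDist_univ_const hQ, curveLength]
    simp only [deriv_segment]
    simp
  · rw [riemDist_univ_const hQ, deriv_segment]

lemma _root_.ContinuousWithinAt.riemDist {n : ℕ} {X : Set (Vec n)} {M : Vec n → Op n} {S : Set ℝ}
    {t : ℝ} {y w : ℝ → Vec n} (hy : ContinuousWithinAt y S t) (hX : IsOpen X)
    (hM : ContinuousOn M X) (hg : GeodesicallyConnected X M) (hw : ContinuousWithinAt w S t)
    (hyX : y t ∈ X) (hwX : w t ∈ X) :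
    ContinuousWithinAt (fun s => riemDist X M (y s) (w s)) S t :=
  (continuousAt_riemDist hX hM hg hyX hwX).comp_continuousWithinAt (f := fun s => (y s, w s))
    (hy.prodMk hw)

namespace Problem

variable {nx nu nwx ny nwy np nr N : ℕ} {P : Problem nx nu nwx ny nwy np nr N}

/-- `Cr` is surjective, hence open; extension by zero off the selected coordinates is a right
inverse. -/
lemma isOpen_Dr (hX : IsOpen P.X) (hDp : IsOpen P.Dp) : IsOpen P.Dr := by
  refine hX.inter (IsOpen.preimage P.Cr.continuous (P.Cr.isOpenMap ?_ _ hDp))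
  intro y
  refine ⟨WithLp.toLp 2 (Function.extend P.sel y 0), ?_⟩
  ext i
  exact P.sel.injective.extend_apply _ _ _

/-! ### Tubes -/

section Tube

variable {κ : BoundKind} {t₀ t₁ c₀ e₀ : ℝ} {xp : ℝ → Vec nx} {dc de : ℝ → ℝ}

/-- Tubes are absolutely continuous and satisfy the tube equation almost everywhere. -/
lemma IsTube.ae_deriv (h : P.IsTube κ t₀ t₁ c₀ e₀ xp dc de) (ht : t₀ ≤ t₁) :
    AbsolutelyContinuousOnInterval dc t₀ t₁ ∧ AbsolutelyContinuousOnInterval de t₀ t₁ ∧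
      dc t₀ = c₀ ∧ de t₀ = e₀ ∧ ∃ e : ℝ → ℝ,
      (∀ t ∈ Ico t₀ t₁, P.IsErrLevel κ (xp t) (dc t) (e t)) ∧
      (∀ᵐ t, t ∈ Ioo t₀ t₁ → HasDerivAt dc (P.rhsC (dc t) (de t)) t) ∧
      ∀ᵐ t, t ∈ Ioo t₀ t₁ → HasDerivAt de (P.rhsE κ (e t) (dc t) (de t)) t := by
  obtain ⟨hdc, hde, e, he, hlevel, heq⟩ := h
  have hidc : IntervalIntegrable dc volume t₀ t₁ := hdc.intervalIntegrable_of_Icc ht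
  have hide : IntervalIntegrable de volume t₀ t₁ := hde.intervalIntegrable_of_Icc ht
  have hC : IntervalIntegrable (fun τ => P.rhsC (dc τ) (de τ)) volume t₀ t₁ :=
    ((hidc.const_mul _).add (hide.const_mul _)).add intervalIntegrable_const
  have hE : IntervalIntegrable (fun τ => P.rhsE κ (e τ) (dc τ) (de τ)) volume t₀ t₁ :=
    (((hidc.const_mul _).sub (hide.const_mul _)).add intervalIntegrable_const).add
      ((intervalIntegrable_const.add he).const_mul _)
  have heC := fun t ht => (heq t ht).1
  have heE := fun t ht => (heq t ht).2
  refine ⟨AbsolutelyContinuousOnInterval.of_integral ht hC heC,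
    AbsolutelyContinuousOnInterval.of_integral ht hE heE, ?_, ?_, e, hlevel,
    ae_hasDerivAt_of_integral hC heC, ae_hasDerivAt_of_integral hE heE⟩
  · simpa using heC t₀ (left_mem_Icc.2 ht)
  · simpa using heE t₀ (left_mem_Icc.2 ht)

/-- The comparison principle for `-dc` and `-de`: forcing terms and cross coefficients of the tube
equations are nonnegative. -/
lemma IsTube.nonneg (hS : P.Setting) (hB : P.ValidBound κ) (h : P.IsTube κ t₀ t₁ c₀ e₀ xp dc de)
    (hwx : 0 ≤ P.wxBar) (hwy : 0 ≤ P.wyBar) (ht : t₀ ≤ t₁) (hc₀ : 0 ≤ c₀) (he₀ : 0 ≤ e₀) :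
    ∀ t ∈ Icc t₀ t₁, 0 ≤ dc t ∧ 0 ≤ de t := by
  obtain ⟨hac, hae, hc, he, e, hlevel, hdc, hde⟩ := h.ae_deriv ht
  have hLk := hS.Lk_nonneg
  have hLh := hS.Lh_nonneg
  have hρ := hS.rho_nonneg
  have hlc := hS.lamc_pos
  have hle := hS.lame_pos
  have hκ := Setting.coupling_nonneg hρ hB
  have hmain := nonpos_of_deriv_le (p := fun t => -dc t) (q := fun t => -de t)
    (K := P.Lk + P.coupling κ) ht (by positivity) hac.neg hae.neg (by simpa [hc] using hc₀)
    (by simpa [he] using he₀) ?_ ?_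
  · intro t ht
    have := hmain t ht
    exact ⟨by linarith [this.1], by linarith [this.2]⟩
  · filter_upwards [hdc, ae_mem_Ioo_of_mem_Icc t₀ t₁] with t h1 h2 hmem hpos
    rw [(h1 (h2 hmem)).fun_neg.deriv, rhsC]
    have m1 := le_max_left (-de t) 0
    have m2 := le_max_right (-de t) 0
    have m3 := le_max_right (-dc t) 0
    have w := mul_nonneg (Real.sqrt_nonneg P.mcHi) hwx
    have a1 := mul_le_mul_of_nonneg_left m1 hLk
    have a2 := mul_nonneg hLk m3
    have a3 := mul_nonneg hκ (add_nonneg m3 m2)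
    have a4 := mul_nonneg hlc.le hpos.le
    nlinarith
  · filter_upwards [hde, ae_mem_Ioo_of_mem_Icc t₀ t₁] with t h1 h2 hmem hpos
    rw [(h1 (h2 hmem)).fun_neg.deriv, rhsE]
    have m1 := le_max_left (-dc t) 0
    have m2 := le_max_right (-dc t) 0
    have m3 := le_max_right (-de t) 0
    have w := mul_nonneg (Real.sqrt_nonneg P.weHi) hwx
    have e0 := hS.errLevel_nonneg hB (hlevel t (Ioo_subset_Ico_self (h2 hmem)))
    have w' : 0 ≤ P.rho / 2 * √P.meHi * (P.Lh * ‖P.By‖ * P.wyBar + e t) := by positivity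
    have a1 := mul_le_mul_of_nonneg_left m1 hκ
    have a2 := mul_nonneg hκ m3
    have a3 := mul_nonneg hLk (add_nonneg m2 m3)
    have a4 := mul_nonneg hle.le hpos.le
    nlinarith

end Tube

namespace Setting

variable (hS : P.Setting)

include hS

/-- A compact tube section in an open set can be enlarged. -/
lemma exists_tubeC_subset {p : Vec nx} (hp : p ∈ P.X) {r : ℝ} {O : Set (Vec nx)} (hO : IsOpen O)
    (h : P.tubeC p r ⊆ O) : ∃ r' > r, P.tubeC p r' ⊆ O := by
  -- Otherwise the compact sets `tubeC p (r + 1/(n+1)) \ O` are nested and nonempty, and a common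
  -- point would lie in `tubeC p r` but not in `O`.
  by_contra! hcon
  have hmono : ∀ {r r' : ℝ}, r ≤ r' → P.tubeC p r ⊆ P.tubeC p r' := fun hr y hy =>
    ⟨hy.1, hy.2.trans hr⟩
  obtain ⟨y, hy⟩ := IsCompact.nonempty_iInter_of_sequence_nonempty_isCompact_isClosed
    (fun n : ℕ => P.tubeC p (r + 1 / (n + 1)) \ O)
    (fun n => by
      refine sdiff_subset_sdiff_left (hmono ?_)
      have := Nat.one_div_le_one_div (α := ℝ) (Nat.le_succ n)
      push_cast at this ⊢
      linarith)
    (fun n => sdiff_nonempty.2 (hcon _ (by have := Nat.one_div_pos_of_nat (α := ℝ) (n := n); linarith)))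
    ((hS.complete_Mc p hp _).diff hO)
    (fun n => ((hS.complete_Mc p hp _).diff hO).isClosed)
  rw [mem_iInter] at hy
  refine (hy 0).2 (h ⟨(hy 0).1.1, le_of_forall_pos_le_add fun ε hε => ?_⟩)
  obtain ⟨n, hn⟩ := exists_nat_one_div_lt hε
  exact (hy n).1.2.trans (by linarith)

variable {κ : BoundKind} {n : Node nx nu} {u : Vec nu} {tp : ℝ} {xp : ℝ → Vec nx} {dc de : ℝ → ℝ}
  (hA : P.Accepted κ n u tp xp dc de)

include hA

omit hS in
lemma plan_hasDerivAt {t : ℝ} (ht : t ∈ Ioo n.time (n.time + tp)) :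
    HasDerivAt xp (P.f (xp t) + P.B u) t :=
  (hA.dynamics t (Ioo_subset_Icc_self ht)).hasDerivAt (Icc_mem_nhds ht.1 ht.2)

lemma plan_absolutelyContinuous :
    AbsolutelyContinuousOnInterval xp n.time (n.time + tp) := by
  have hle : n.time ≤ n.time + tp := by linarith [hA.dwell]
  have hc : ContinuousOn xp (Icc n.time (n.time + tp)) := fun t ht =>
    (hA.dynamics t ht).continuousWithinAt
  have hfc : ContinuousOn (fun t => P.f (xp t) + P.B u) (Icc n.time (n.time + tp)) :=
    (hS.smooth_f.continuousOn.comp hc hA.mem).add continuousOn_const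
  obtain ⟨C, hC⟩ := isCompact_Icc.exists_bound_of_continuousOn hfc
  have hC0 : 0 ≤ C := (norm_nonneg _).trans (hC _ (left_mem_Icc.2 hle))
  have := (convex_Icc n.time (n.time + tp)).lipschitzOnWith_of_nnnorm_hasDerivWithin_le
    (C := ⟨C, hC0⟩) hA.dynamics fun t ht => hC t ht
  rw [← uIcc_of_le hle] at this
  exact this.absolutelyContinuousOnInterval

omit hS in
-- Nonnegative radii put the centre into its own tube sections, so the checks apply to the planned
-- state itself.
lemma plan_mem_Dx {t : ℝ} (ht : t ∈ Ico n.time (n.time + tp)) (hdc : 0 ≤ dc t) (hde : 0 ≤ de t) :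
    xp t ∈ P.Dx := by
  have hX := hA.mem t (Ico_subset_Icc_self ht)
  have hmem : xp t ∈ P.tubeC (xp t) (dc t) := ⟨hX, (riemDist_self hX).trans_le hdc⟩
  have h1 := hA.tracking t ht hmem
  have h2 : xp t ∈ P.tubeC (xp t) (dc t) + (P.tubeE (xp t) (de t) - {xp t}) := by
    refine Set.mem_add.2 ⟨xp t, hmem, 0, ?_, add_zero _⟩
    refine Set.mem_sub.2 ⟨xp t, ?_, xp t, rfl, sub_self _⟩
    exact (riemDist_self (mem_univ _)).trans_le hde
  exact ⟨⟨h1.1.2, h1.1.1⟩, (hA.estimation t ht _ hmem h2).1⟩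

/-- The estimator check covers a translated ball of the norm of `W_e`, which contains `s • (z - x)`
for every `s` in `[0, 1]`. -/
lemma segment_subset_De {t : ℝ} (ht : t ∈ Ico n.time (n.time + tp)) {x z : Vec nx} (hx : x ∈ P.X)
    (hdc : P.distC (xp t) x ≤ dc t) (hde : P.distE x z ≤ de t) : segment ℝ x z ⊆ P.De := by
  rw [segment_eq_image']
  rintro _ ⟨s, hs, rfl⟩
  have hmem : x ∈ P.tubeC (xp t) (dc t) := ⟨hx, hdc⟩
  refine (hA.estimation t ht x hmem (Set.mem_add.2 ⟨x, hmem, s • (z - x), ?_, rfl⟩)).1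
  refine Set.mem_sub.2 ⟨x + s • (z - x), ?_, x, rfl, by simp⟩
  refine le_trans ?_ hde
  rw [hS.distE_eq, hS.distE_eq, add_sub_cancel_left, sqrt_quad_smul _ hs.1]
  exact mul_le_of_le_one_left (Real.sqrt_nonneg _) hs.2

/-! ### Tracking of an accepted extension -/

variable (hCCM : P.IsCCM) (hOCM : P.IsOCM) (hLk : P.ValidLk) (hLh : P.ValidLh)
  (hB : P.ValidBound κ) {T : ℝ} {xs : ℝ → Vec nx} {us : ℝ → Vec nu} {x z : ℝ → Vec nx}
  {k : ℝ → Vec nu} {wx : ℝ → Vec nwx} {wy : ℝ → Vec nwy}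
  (hE : P.IsExecution T xs us x z k wx wy)

/-- The domains in which the differential inequalities at time `t` are valid. -/
structure Trusted (P : Problem nx nu nwx ny nwy np nr N) (xp x z : ℝ → Vec nx) (t : ℝ) : Prop where
  distC_le : P.distC (xp t) (x t) ≤ P.cBar
  distE_le : P.distE (x t) (z t) ≤ P.eBar
  geo_mem : ∀ s ∈ Icc (0 : ℝ) 1, P.geo (xp t) (x t) s ∈ P.Dc ∩ P.Dr
  segment_subset : segment ℝ (x t) (z t) ⊆ P.De

omit hS hA in
lemma Trusted.mem_Dr (hS : P.Setting) {t : ℝ} (h : Trusted P xp x z t) (hp : xp t ∈ P.X)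
    (hx : x t ∈ P.X) : x t ∈ P.Dr := by
  have h1 := (h.geo_mem 1 (by simp)).2
  rwa [(hS.geodesic _ hp _ hx).1.2.2.1] at h1

/-- Times after a time with valid tubes are trusted. -/
lemma eventually_trusted {S : Set ℝ} {t : ℝ} (ht : t ∈ Ico n.time (n.time + tp))
    (htS : t ∈ S) (hxp : ContinuousOn xp S) (hx : ContinuousOn x S) (hz : ContinuousOn z S)
    (hxpX : ∀ t ∈ S, xp t ∈ P.X) (hxX : ∀ t ∈ S, x t ∈ P.X)
    (hdc : P.distC (xp t) (x t) ≤ dc t) (hde : P.distE (x t) (z t) ≤ de t) :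
    ∀ᶠ s in 𝓝[S] t, Trusted P xp x z s := by
  have hxpt := hxpX t htS
  have hxt := hxX t htS
  have t1 := (hxp t htS).riemDist hS.open_X hS.continuousOn_Mc hS.connected (hx t htS) hxpt hxt
  have t2 := (hx t htS).riemDist isOpen_univ continuousOn_const
    (geodesicallyConnected_univ_const hS.posDef_We) (hz t htS) (mem_univ _) (mem_univ _)
  -- The sum `d_c(x*(t), x*(s)) + d_c(x*(s), x(s))` bounds the distance of the whole geodesic at
  -- time `s` from the fixed centre `x*(t)`. It tends to `d_c(x*(t), x(t))`, so the geodesic enters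
  -- the enlarged section around `x*(t)`.
  have t3 := ((continuousWithinAt_const (b := xp t)).riemDist hS.open_X hS.continuousOn_Mc hS.connected
    (hxp t htS) hxpt hxpt).tendsto.add t1.tendsto
  rw [riemDist_self hxpt, zero_add] at t3
  obtain ⟨hb1, hb2⟩ := hA.bounds t ht
  obtain ⟨r', hr', hsub⟩ := hS.exists_tubeC_subset hxpt
    (hS.open_Dc.inter (isOpen_Dr hS.open_X hS.open_Dp))
    fun y hy => (hA.tracking t ht hy).1
  have hseg := hS.segment_subset_De hA ht hxt hdc hde
  have hcomp : IsCompact (segment ℝ (x t) (z t)) := by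
    rw [segment_eq_image']
    exact isCompact_Icc.image (by fun_prop)
  obtain ⟨ε, hε, hεsub⟩ := hcomp.exists_thickening_subset_open hS.open_De hseg
  have near : ∀ {y : ℝ → Vec nx}, ContinuousWithinAt y S t → y t ∈ segment ℝ (x t) (z t) →
      ∀ᶠ s in 𝓝[S] t, y s ∈ Metric.thickening ε (segment ℝ (x t) (z t)) := fun hy hmem =>
    hy.tendsto (Metric.isOpen_thickening.mem_nhds (Metric.self_subset_thickening hε _ hmem))
  filter_upwards [t1.tendsto.eventually_lt_const (hdc.trans_lt hb1), t2.tendsto.eventually_lt_const (hde.trans_lt hb2),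
    t3.eventually_lt_const (hdc.trans_lt hr'), near (hx t htS) (left_mem_segment _ _ _),
    near (hz t htS) (right_mem_segment _ _ _), self_mem_nhdsWithin] with s h1 h2 h3 h4 h5 hsS
  refine ⟨h1.le, h2.le, fun σ hσ => hsub ⟨hS.geo_mem (hxpX s hsS) (hxX s hsS) hσ, ?_⟩,
    (((convex_segment _ _).thickening ε).segment_subset h4 h5).trans hεsub⟩
  have hy := hS.geo_mem (hxpX s hsS) (hxX s hsS) hσ
  have h6 := hS.distC_triangle hxpt (hxpX s hsS) hy
  have h7 : P.distC (xp s) (P.geo (xp s) (x s) σ) ≤ σ * P.distC (xp s) (x s) :=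
    (hS.geodesic _ (hxpX s hsS) _ (hxX s hsS)).riemDist_le hS.continuousOn_Mc hσ
  have h8 : σ * P.distC (xp s) (x s) ≤ P.distC (xp s) (x s) :=
    mul_le_of_le_one_left (distC_nonneg _ _) hσ.2
  exact h6.trans ((add_le_add le_rfl (h7.trans h8)).trans h3.le)

omit hA in
lemma norm_disturbance_le (hE : P.IsExecution T xs us x z k wx wy) {t : ℝ} (ht : t ∈ Icc 0 T) :
    ‖P.Bw t (wx t)‖ ≤ P.wxBar :=
  ((P.Bw t).le_opNorm _).trans ((mul_le_of_le_one_left (norm_nonneg _) (hS.norm_Bw t ht.1)).trans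
    (hE.bound_wx t ht))

include hCCM hOCM hLk hLh hB hE

/-- Along an accepted extension, the tracking and estimation distances stay below the tubes. -/
lemma distances_le_tubes {c : ℝ} (h0 : 0 ≤ n.time) (hac : n.time ≤ c) (hcb : c ≤ n.time + tp)
    (hcT : c ≤ T) (hagree : ∀ t ∈ Ico n.time c, xs t = xp t ∧ us t = u)
    (hinit : P.distC (xp n.time) (x n.time) ≤ n.dc)
    (hinit' : P.distE (x n.time) (z n.time) ≤ n.de) :
    ∀ t ∈ Icc n.time c, P.distC (xp t) (x t) ≤ dc t ∧ P.distE (x t) (z t) ≤ de t := by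
  have h0T : (0 : ℝ) ≤ T := h0.trans (hac.trans hcT)
  have hwx : 0 ≤ P.wxBar := (norm_nonneg _).trans (hE.bound_wx 0 ⟨le_rfl, h0T⟩)
  have hwy : 0 ≤ P.wyBar := (norm_nonneg _).trans (hE.bound_wy 0 ⟨le_rfl, h0T⟩)
  have hle : n.time ≤ n.time + tp := by linarith [hA.dwell]
  have hsubT : Icc n.time c ⊆ Icc 0 T := Icc_subset_Icc h0 hcT
  have hsubB : Icc n.time c ⊆ Icc n.time (n.time + tp) := Icc_subset_Icc le_rfl hcb
  have husubT : uIcc n.time c ⊆ uIcc 0 T := by rwa [uIcc_of_le hac, uIcc_of_le h0T]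
  have husubB : uIcc n.time c ⊆ uIcc n.time (n.time + tp) := by
    rwa [uIcc_of_le hac, uIcc_of_le hle]
  have hpos := hA.tube.nonneg hS hB hwx hwy hle ((distC_nonneg _ _).trans hinit)
    ((distE_nonneg _ _).trans hinit')
  obtain ⟨hdcAC, hdeAC, hdc0, hde0, e, hlevel, hdcD, hdeD⟩ := hA.tube.ae_deriv hle
  have hxAC := (AbsolutelyContinuousOnInterval.of_integral h0T hE.integrable_x hE.system).mono husubT
  have hzAC := (AbsolutelyContinuousOnInterval.of_integral h0T hE.integrable_z hE.observer).mono husubT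
  have hxD := ae_hasDerivAt_of_integral hE.integrable_x hE.system
  have hzD := ae_hasDerivAt_of_integral hE.integrable_z hE.observer
  have hpAC := (hS.plan_absolutelyContinuous hA).mono husubB
  have hxX : ∀ t ∈ Icc n.time c, x t ∈ P.X := fun t ht => hE.mem_x t (hsubT ht)
  have hpX : ∀ t ∈ Icc n.time c, xp t ∈ P.X := fun t ht => hA.mem t (hsubB ht)
  have hCAC : AbsolutelyContinuousOnInterval (fun t => P.distC (xp t) (x t)) n.time c :=
    AbsolutelyContinuousOnInterval.riemDist hS.open_X hS.continuousOn_Mc hS.connected hpAC hxAC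
      (by rwa [uIcc_of_le hac]) (by rwa [uIcc_of_le hac])
  have hEAC : AbsolutelyContinuousOnInterval (fun t => P.distE (x t) (z t)) n.time c :=
    AbsolutelyContinuousOnInterval.riemDist isOpen_univ continuousOn_const
      (geodesicallyConnected_univ_const hS.posDef_We) hxAC hzAC (fun _ _ => mem_univ _)
      (fun _ _ => mem_univ _)
  have hpAC' := hCAC.sub (hdcAC.mono husubB)
  have hqAC' := hEAC.sub (hdeAC.mono husubB)
  set p : ℝ → ℝ := (fun t => P.distC (xp t) (x t)) - dc with hp
  set q : ℝ → ℝ := (fun t => P.distE (x t) (z t)) - de with hq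
  have hpc : ContinuousOn p (Icc n.time c) := by simpa [uIcc_of_le hac] using hpAC'.continuousOn
  have hqc : ContinuousOn q (Icc n.time c) := by simpa [uIcc_of_le hac] using hqAC'.continuousOn
  have hmc : 0 < √P.mcLo := Real.sqrt_pos.2 hS.mcLo_pos
  have hLk0 := hS.Lk_nonneg
  have hρ := hS.rho_nonneg
  have hκ := coupling_nonneg hρ hB
  set K₀ : ℝ := P.rho / 2 * √P.meHi * (|P.Lp| / √P.mcLo) with hK₀
  have hK₀0 : 0 ≤ K₀ := by positivity
  have step : ∀ t₀ ∈ Icc n.time c, ∀ t₁ ∈ Icc n.time c, t₀ ≤ t₁ → p t₀ ≤ 0 → q t₀ ≤ 0 →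
      (∀ t ∈ Icc t₀ t₁, Trusted P xp x z t) → ∀ t ∈ Icc t₀ t₁, p t ≤ 0 ∧ q t ≤ 0 := by
    intro t₀ ht₀ t₁ ht₁ hle₁ hp₀ hq₀ htr
    have husub : uIcc t₀ t₁ ⊆ uIcc n.time c :=
      uIcc_subset_uIcc (Icc_subset_uIcc ht₀) (Icc_subset_uIcc ht₁)
    have hin : ∀ᵐ t, t ∈ Icc t₀ t₁ → t ∈ Ioo n.time c ∧ t ∈ Ioo n.time (n.time + tp) ∧
        t ∈ Ioo 0 T := by
      filter_upwards [ae_mem_Ioo_of_mem_Icc t₀ t₁] with t h1 h2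
      have h3 := h1 h2
      have h4 := h3.1
      have h5 := h3.2
      have h6 := ht₀.1
      have h7 := ht₁.2
      exact ⟨⟨by linarith, by linarith⟩, ⟨by linarith, by linarith⟩, ⟨by linarith, by linarith⟩⟩
    -- `K` collects the cross coefficients and the constant of the excess outside the tube. The
    -- decay terms only help where `p` or `q` is positive.
    refine nonpos_of_deriv_le (K := P.Lk + (P.coupling κ + K₀)) hle₁ (by positivity)
      (hpAC'.mono husub) (hqAC'.mono husub) hp₀ hq₀ ?_ ?_
    · filter_upwards [hin, hdcD, hxD, hCAC.ae_differentiableAt] with t hin' hdc' hx' hdiff hmem hpt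
      obtain ⟨i1, i2, i3⟩ := hin' hmem
      have itc := Ioo_subset_Icc_self i1
      obtain ⟨hxs, hus⟩ := hagree t (Ioo_subset_Ico_self i1)
      have hD := (hdiff (Icc_subset_uIcc itc)).hasDerivAt
      have htt := htr t hmem
      have hpos' := hpos t (hsubB itc)
      have hx'' := hx' i3
      have hfb := hE.feedback t (Ioo_subset_Icc_self i3)
      rw [hus] at hx''
      rw [hxs, hus] at hfb
      have hζ := hS.norm_disturbance_le hE (Ioo_subset_Icc_self i3)
      have hineq := hS.deriv_distC_le hCCM hLk (hpX t itc) (hxX t itc)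
        (fun s hs => (htt.geo_mem s hs).1)
        (plan_mem_Dx hA (Ioo_subset_Ico_self i2) hpos'.1 hpos'.2) hA.control htt.distC_le
        (hE.mem_z t (Ioo_subset_Icc_self i3)) htt.distE_le hfb hζ (plan_hasDerivAt hA i2) hx'' hD
      rw [(hD.sub (hdc' i2)).deriv]
      refine (sub_le_sub_right hineq _).trans ?_
      have hpt' : 0 < P.distC (xp t) (x t) - dc t := hpt
      have m1 : P.distE (x t) (z t) - de t ≤ max (q t) 0 := le_max_left _ _
      have m2 := le_max_right (q t) 0
      have m3 := le_max_right (p t) 0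
      have a1 := mul_le_mul_of_nonneg_left m1 hLk0
      have a2 := mul_nonneg hLk0 m3
      have a3 := mul_nonneg (add_nonneg hκ hK₀0) (add_nonneg m3 m2)
      have a4 := mul_nonneg hS.lamc_pos.le hpt'.le
      simp only [rhsC]
      nlinarith
    · filter_upwards [hin, hdeD, hxD, hzD, hEAC.ae_differentiableAt] with
        t hin' hde' hx' hz' hdiff hmem hqt
      obtain ⟨i1, i2, i3⟩ := hin' hmem
      have itc := Ioo_subset_Icc_self i1
      have hD := (hdiff (Icc_subset_uIcc itc)).hasDerivAt
      have htt := htr t hmem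
      have hpos' := hpos t (hsubB itc)
      have hζ := hS.norm_disturbance_le hE (Ioo_subset_Icc_self i3)
      have hxDr := htt.mem_Dr hS (hpX t itc) (hxX t itc)
      have hperc := hS.norm_perception_le hLh hxDr (hE.bound_wy t (Ioo_subset_Icc_self i3))
      have hineq := hS.deriv_distE_le hOCM htt.segment_subset hζ hperc (hx' i3) (hz' i3) hD
      have herr := hS.percErr_le hB (hlevel t (Ioo_subset_Ico_self i2))
        (plan_mem_Dx hA (Ioo_subset_Ico_self i2) hpos'.1 hpos'.2) hpos'.1
        (hA.bounds t (Ioo_subset_Ico_self i2)).1.le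
        (fun y hy => (hA.tracking t (Ioo_subset_Ico_self i2) hy).1) hxDr
        (fun s hs => (htt.geo_mem s hs).1)
      rw [(hD.sub (hde' i2)).deriv]
      refine (sub_le_sub_right hineq _).trans ?_
      have hqt' : 0 < P.distE (x t) (z t) - de t := hqt
      have m1 : P.distC (xp t) (x t) - dc t ≤ max (p t) 0 := le_max_left _ _
      have m2 := le_max_right (q t) 0
      have m3 := le_max_right (p t) 0
      have a1 := mul_le_mul_of_nonneg_left m1 hκ
      have a2 := mul_nonneg (add_nonneg hκ hK₀0) m2
      have a3 := mul_nonneg hLk0 (add_nonneg m3 m2)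
      have a4 := mul_nonneg hS.lame_pos.le hqt'.le
      have a5 : max (P.distC (xp t) (x t) - dc t) 0 = max (p t) 0 := rfl
      rw [a5, ← hK₀] at herr
      simp only [rhsE]
      nlinarith
  have hp0 : p n.time ≤ 0 := sub_nonpos.2 (hinit.trans hdc0.ge)
  have hq0 : q n.time ≤ 0 := sub_nonpos.2 (hinit'.trans hde0.ge)
  -- Continuous induction: the set of good times is closed, and from each good time before `c` it
  -- extends to the right. The planner's checks are thus needed only on the half-open interval.
  have hsub : Icc n.time c ⊆ {t | p t ≤ 0 ∧ q t ≤ 0} := by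
    refine IsClosed.Icc_subset_of_forall_exists_gt ?_ ⟨hp0, hq0⟩ ?_
    · have h1 := hpc.preimage_isClosed_of_isClosed isClosed_Icc (isClosed_Iic (a := (0 : ℝ)))
      have h2 := hqc.preimage_isClosed_of_isClosed isClosed_Icc (isClosed_Iic (a := (0 : ℝ)))
      convert h1.inter h2 using 1
      ext t
      simp only [mem_inter_iff, mem_ofPred_eq, mem_preimage, mem_Iic]
      tauto
    · rintro t₀ ⟨⟨hpt, hqt⟩, ht₀⟩ y hy
      have hev := hS.eventually_trusted hA (S := Icc n.time c) (x := x) (z := z)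
        ⟨ht₀.1, ht₀.2.trans_le hcb⟩ (Ico_subset_Icc_self ht₀)
        (by simpa [uIcc_of_le hac] using hpAC.continuousOn)
        (hE.cont_x.mono hsubT) (hE.cont_z.mono hsubT) hpX hxX (sub_nonpos.1 hpt) (sub_nonpos.1 hqt)
      rw [eventually_nhdsWithin_iff, Metric.eventually_nhds_iff] at hev
      obtain ⟨ε, hε, hev⟩ := hev
      have hy' : t₀ < y := hy
      set t₁ := min (min y c) (t₀ + ε / 2) with ht₁
      have hlt : t₀ < t₁ := lt_min (lt_min hy' ht₀.2) (by linarith)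
      have h1y : t₁ ≤ y := (min_le_left _ _).trans (min_le_left _ _)
      have h1c : t₁ ≤ c := (min_le_left _ _).trans (min_le_right _ _)
      have h1ε : t₁ ≤ t₀ + ε / 2 := min_le_right _ _
      refine ⟨t₁, ?_, hlt, h1y⟩
      refine step t₀ (Ico_subset_Icc_self ht₀) t₁ ⟨ht₀.1.trans hlt.le, h1c⟩ hlt.le hpt hqt
        (fun t ht => hev ?_ ⟨ht₀.1.trans ht.1, ht.2.trans h1c⟩) t₁ ⟨hlt.le, le_rfl⟩
      rw [Real.dist_eq, abs_of_nonneg (by linarith [ht.1])]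
      linarith [ht.2]
  intro t ht
  exact ⟨sub_nonpos.1 (hsub ht).1, sub_nonpos.1 (hsub ht).2⟩

end Setting

/-- What a node of the tree guarantees for executions of its branch. -/
def NodeSafe (P : Problem nx nu nwx ny nwy np nr N) (n : Node nx nu) : Prop :=
  0 ≤ n.time ∧ ∀ {T : ℝ} {xs : ℝ → Vec nx} {us : ℝ → Vec nu} {x z : ℝ → Vec nx} {k : ℝ → Vec nu}
    {wx : ℝ → Vec nwx} {wy : ℝ → Vec nwy}, P.IsExecution T xs us x z k wx wy → n.time ≤ T →
    (∀ t ∈ Ico 0 n.time, xs t = n.xs t ∧ us t = n.us t) → (n.time = 0 → xs 0 = n.state) →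
    (∀ t ∈ Ico 0 n.time, x t ∈ P.Xsafe) ∧ P.distC n.state (x n.time) ≤ n.dc ∧
      P.distE (x n.time) (z n.time) ≤ n.de

/-! ### Induction over the search tree -/

section Tree

variable {κ : BoundKind} (hS : P.Setting) (hCCM : P.IsCCM) (hOCM : P.IsOCM) (hLk : P.ValidLk)
  (hLh : P.ValidLh) (hB : P.ValidBound κ)

include hS hCCM hOCM hLk hLh hB

/-- A safe node stays safe along an accepted extension. -/
lemma NodeSafe.extension {n : Node nx nu} {u : Vec nu} {tp : ℝ} {xp : ℝ → Vec nx} {dc de : ℝ → ℝ}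
    (hn : NodeSafe P n) (hA : P.Accepted κ n u tp xp dc de) {T : ℝ} {xs : ℝ → Vec nx}
    {us : ℝ → Vec nu} {x z : ℝ → Vec nx} {k : ℝ → Vec nu} {wx : ℝ → Vec nwx} {wy : ℝ → Vec nwy}
    (hE : P.IsExecution T xs us x z k wx wy) {c : ℝ} (hac : n.time ≤ c) (hcb : c ≤ n.time + tp)
    (hcT : c ≤ T) (hroot : n.time = 0 → xs 0 = n.state)
    (hagree : ∀ t ∈ Ico 0 c, xs t = (n.splice xp u).1 t ∧ us t = (n.splice xp u).2 t) :
    (∀ t ∈ Ico 0 n.time, x t ∈ P.Xsafe) ∧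
      ∀ t ∈ Icc n.time c, P.distC (xp t) (x t) ≤ dc t ∧ P.distE (x t) (z t) ≤ de t := by
  obtain ⟨h1, h2, h3⟩ := hn.2 hE (hac.trans hcT) (fun t ht => by
    have := hagree t ⟨ht.1, ht.2.trans_le hac⟩
    simpa [Node.splice, ht.2] using this) hroot
  refine ⟨h1, hS.distances_le_tubes hA hCCM hOCM hLk hLh hB hE hn.1 hac hcb hcT (fun t ht => ?_) ?_ h3⟩
  · have := hagree t ⟨hn.1.trans ht.1, ht.2⟩
    simpa [Node.splice, not_lt.2 ht.1] using this
  · rw [hA.start]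
    exact h2

omit hS hCCM hOCM hLk hLh hB in
lemma Accepted.mem_Xsafe {n : Node nx nu} {u : Vec nu} {tp : ℝ} {xp : ℝ → Vec nx} {dc de : ℝ → ℝ}
    (hA : P.Accepted κ n u tp xp dc de) {t : ℝ} (ht : t ∈ Ico n.time (n.time + tp)) {x : Vec nx}
    (hx : x ∈ P.X) (h : P.distC (xp t) x ≤ dc t) : x ∈ P.Xsafe :=
  (hA.tracking t ht ⟨hx, h⟩).2

lemma IsTree.nodeSafe {𝒯 : Set (Node nx nu)} (h𝒯 : P.IsTree κ 𝒯) : ∀ n ∈ 𝒯, NodeSafe P n := by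
  induction h𝒯 with
  | root =>
    rintro n rfl
    refine ⟨le_rfl, fun hE _ _ h0 => ⟨fun t ht => absurd ht.2 (not_lt.2 ht.1), ?_, hE.start_e⟩⟩
    rw [← h0 rfl]
    exact hE.start_c
  | @grow 𝒯 n u tp xp dc de _ hn hA ih =>
    rintro m (rfl | hm)
    · have hns := ih n hn
      have htp := hA.dwell
      refine ⟨add_nonneg hns.1 htp.le, fun {T xs us x z k wx wy} hE hT hagree _ => ?_⟩
      have hT' : n.time + tp ≤ T := hT
      -- Agreement on `[0, n.time)` is void for a node at time zero, so the initial planned state is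
      -- read off from the start of the extension, which has positive dwell time.
      have hroot : n.time = 0 → xs 0 = n.state := fun h => by
        have := (hagree 0 ⟨le_rfl, by change 0 < n.time + tp; linarith⟩).1
        rw [this]
        simp only [Node.extend, Node.splice, h, lt_irrefl, if_false]
        rw [← hA.start, h]
      obtain ⟨h1, h2⟩ := hns.extension hS hCCM hOCM hLk hLh hB hA hE (c := n.time + tp)
        (by linarith) le_rfl hT' hroot hagree
      refine ⟨fun t ht => ?_, (h2 _ ⟨by linarith, le_rfl⟩).1, (h2 _ ⟨by linarith, le_rfl⟩).2⟩
      have ht2 : t < n.time + tp := ht.2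
      rcases lt_or_ge t n.time with hlt | hge
      · exact h1 t ⟨ht.1, hlt⟩
      · exact hA.mem_Xsafe ⟨hge, ht2⟩ (hE.mem_x t ⟨ht.1, ht2.le.trans hT'⟩)
          (h2 t ⟨hge, ht2.le⟩).1
    · exact ih m hm

end Tree

end Problem

end CORRT

theorem theorem2 {nx nu nwx ny nwy np nr N : ℕ} (P : CORRT.Problem nx nu nwx ny nwy np nr N)
    (κ : CORRT.BoundKind) (hS : P.Setting) (hCCM : P.IsCCM) (hOCM : P.IsOCM)
    (hLk : P.ValidLk) (hLh : P.ValidLh) (hBound : P.ValidBound κ)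
    (T : ℝ) (xs : ℝ → CORRT.Vec nx) (us : ℝ → CORRT.Vec nu) (hPlan : P.Returns κ T xs us)
    (x z : ℝ → CORRT.Vec nx) (k : ℝ → CORRT.Vec nu) (wx : ℝ → CORRT.Vec nwx)
    (wy : ℝ → CORRT.Vec nwy) (hExec : P.IsExecution T xs us x z k wx wy) :
    (∀ t ∈ Set.Icc 0 T, x t ∈ P.Xsafe) ∧ x T ∈ P.goal := by
  obtain ⟨𝒯, n, u, tp, xp, dc, de, h𝒯, hn, hA, hT, hgoal, hagree⟩ := hPlan
  have hns := CORRT.Problem.IsTree.nodeSafe hS hCCM hOCM hLk hLh hBound h𝒯 n hn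
  have h0T : (0 : ℝ) ≤ T := hns.1.trans hT.1
  have hroot : n.time = 0 → xs 0 = n.state := fun h => by
    rw [(hagree 0 ⟨le_rfl, h0T⟩).1]
    simp only [CORRT.Node.splice, h, lt_irrefl, if_false]
    rw [← hA.start, h]
  -- The last extension is followed only up to `T`, which is strictly before its end, so the
  -- tracking check is available at `T` as well.
  obtain ⟨h1, h2⟩ := hns.extension hS hCCM hOCM hLk hLh hBound hA hExec (c := T) hT.1 hT.2.le le_rfl
    hroot fun t ht => hagree t ⟨ht.1, ht.2.le⟩
  refine ⟨fun t ht => ?_, hgoal ⟨hExec.mem_x T ⟨h0T, le_rfl⟩, (h2 T ⟨hT.1, le_rfl⟩).1⟩⟩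
  rcases lt_or_ge t n.time with hlt | hge
  · exact h1 t ⟨ht.1, hlt⟩
  · exact CORRT.Problem.Accepted.mem_Xsafe hA ⟨hge, ht.2.trans_lt hT.2⟩ (hExec.mem_x t ht)
      (h2 t ⟨hge, ht.2⟩).1
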